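/- Let $Q$ be a quiver, possibly with loops, with vertex set $I$ and finitely many edges between any two vertices (for example any finite quiver). For $i\in I$ let $\omega_i$ be the number of loops at $i$, and for $i\ne j$ let $n_{ij}$ be the number of edges connecting $i$ and $j$. Equip $\mathbb{Z}I$ with the symmetric bilinear form given by $(i,i)=2-2\omega_i$ and $(i,j)=-n_{ij}$ for $i\neq j$. A vertex $i$ is real if $\omega_i=0$, imaginary otherwise, and isotropic if $\omega_i=1$. Put $I_\infty=I^{re}\cup\{(i,l): i\in I^{im},\, l\ge 1\}$, let $j\in I^{re}$ have weight $j$ and $(i,l)$ have weight $li$, and extend $(\cdot,\cdot)$ to $I_\infty$ through the weights. With $[n]=\frac{v^n-v^{-n}}{v-v^{-1}}$, $[n]!=[n]\cdots[1]$ and $x^{(n)}=x^n/[n]!$, let $U^-$ be the $\mathbb{C}(v)$-algebra generated by $F_\iota$ $(\iota\in I_\infty)$ with the relations $[F_\iota,F_\kappa]=0$ whenever $(\iota,\kappa)=0$, and $\sum_{t+t'=1-(j,\iota)}(-1)^tF_j^{(t)}F_\iota F_j^{(t')}=0$ for $j\in I^{re}$, $\iota\ne j$. It is graded by $\mathbb{Z}I$,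 with $\deg F_\iota=-\mathrm{weight}(\iota)$; write $|y|$ for the degree of a homogeneous element $y$. Let $b_j=F_j$ for $j\in I^{re}$. For $i\in I^{im}$ and $l\ge1$ let $b_{i,l}$ be Bozec's element: the unique homogeneous element of degree $-li$ such that $b_{i,l}-F_{i,l}\in\mathbb{C}(v)\langle F_{i,k}:k<l\rangle$ and $b_{i,l}$ is primitive, i.e. $\delta(b_{i,l})=b_{i,l}\otimes1+1\otimes b_{i,l}$. Here $\delta$ is the algebra homomorphism from $U^-$ to $U^-\otimes U^-$, the latter with multiplication $(a\otimes b)(c\otimes d)=v^{(|b|,|c|)}ac\otimes bd$, given by $\delta(F_j)=F_j\otimes1+1\otimes F_j$ for $j$ real and $\delta(F_{i,l})=\sum_{s+t=l}v^{(1-\omega_i)st}F_{i,s}\otimes F_{i,t}$, $F_{i,0}=1$, for $i$ imaginary. For $\iota\in I_\infty$ let $e'_\iota:U^-\to U^-$ be the unique linear map with $e'_\iota(yz)=e'_\iota(y)z+v^{(-\iota,|y|)}y\,e'_\iota(z)$ ($y$ homogeneous) and $e'_\iota(b_\kappa)=\delta_{\iota,\kappa}$. Put $\mathcal{K}_j=\ker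 e'_j$ for $j$ real and $\mathcal{K}_i=\bigcap_{l\ge1}\ker e'_{(i,l)}$ for $i$ imaginary. The Kashiwara operators $\tilde f_\iota:U^-\to U^-$ are defined as follows. For $j$ real, write $u=\sum_nF_j^{(n)}z_n$ (finite sum, uniquely) with $z_n\in\mathcal{K}_j$ and set $\tilde f_j(u)=\sum_nF_j^{(n+1)}z_n$. For $i$ imaginary, write $u=\sum_cb_{i,c}z_c$ (finite sum, uniquely) with $z_c\in\mathcal{K}_i$, where $c=(c_1,\dots,c_k)$ runs over all compositions if $i$ is not isotropic and over all partitions if $i$ is isotropic, and $b_{i,c}=b_{i,c_1}\cdots b_{i,c_k}$; set $\tilde f_{i,l}(u)=\sum_cb_{i,(l,c)}z_c$ if $i$ is not isotropic and $\tilde f_{i,l}(u)=\sum_\lambda\sqrt{\tfrac{l}{m_l(\lambda)+1}}\,b_{i,\lambda\cup l}z_\lambda$ if $i$ is isotropic, where $m_l(\lambda)$ is the number of parts of $\lambda$ equal to $l$. **Lemma.** If $\iota,\iota'\in I_\infty$ satisfy $(\iota,\iota')=0$, then $\tilde f_\iota\tilde f_{\iota'}(u)=\tilde f_{\iota'}\tilde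 f_\iota(u)$ for all $u\in U^-$. Moreover, if $j,k\in I^{re}$ satisfy $(j,k)=0$, then $e'_je'_k=e'_ke'_j$ on $U^-$, and whenever $z\in\mathcal{K}_k$ is written as a finite sum $z=\sum_nF_j^{(n)}z_n$ with all $z_n\in\mathcal{K}_j$, then $z_n\in\mathcal{K}_k$ for all $n$. -/

import Mathlib

open scoped TensorProduct

universe u w

namespace GenQuantum

noncomputable section

/-! ### The quiver: loops, edges, the symmetric form on `ℤI`, and the index set `I_∞` -/

/-- The base field `ℂ(v)`. -/
abbrev Kv : Type := RatFunc ℂ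

/-- The indeterminate `v`. -/
def v : Kv := RatFunc.X

section Vertices

variable {V : Type u} [Quiver.{w + 1} V]

/-- The number of loops at the vertex `i`. -/
def loops (i : V) : ℕ := Nat.card (i ⟶ i)

/-- The number of edges, in either direction, connecting two distinct vertices `i` and `j`. -/
def edges (i j : V) : ℕ := Nat.card (i ⟶ j) + Nat.card (j ⟶ i)

open Classical in
/-- The form on basis vectors: `(i, i) = 2 - 2 ω_i` and `(i, j) = - n_{ij}` for `i ≠ j`. -/
def vertexForm (i j : V) : ℤ :=
  if i = j then 2 - 2 * (loops i : ℤ) else -(edges i j : ℤ)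

/-- The bilinear extension of `vertexForm` to the free abelian group `ℤI`. -/
def form (x y : V →₀ ℤ) : ℤ :=
  x.sum fun i a => y.sum fun j c => a * c * vertexForm i j

/-- A vertex is real if it carries no loop. -/
def IsRealVertex (i : V) : Prop := loops i = 0

/-- A vertex is imaginary if it is not real. -/
def IsImagVertex (i : V) : Prop := ¬ IsRealVertex i

/-- A vertex is isotropic if it carries exactly one loop. -/
def IsIsotropic (i : V) : Prop := loops i = 1

variable (V) in
/-- The index set `I_∞ = I^re ∪ {(i, l) : i ∈ I^im, l ≥ 1}`. -/
inductive IInf : Type u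
  | re (j : V) (hj : IsRealVertex j) : IInf
  | im (i : V) (hi : IsImagVertex i) (l : ℕ+) : IInf

/-- The element of `ℤI` attached to an index: `j` for a real vertex, `l i` for `(i, l)`. -/
def IInf.weight : IInf V → (V →₀ ℤ)
  | .re j _ => Finsupp.single j 1
  | .im i _ l => Finsupp.single i (l : ℤ)

/-- The pairing extended to `I_∞`, so that `(j, (i, l)) = l (j, i)` and
`((j, k), (i, l)) = k l (j, i)`. -/
def IInf.pairing (ι κ : IInf V) : ℤ := form ι.weight κ.weight

end Vertices

/-! ### `v`-analogues -/

/-- `[n] = (v^n - v^{-n}) / (v - v^{-1})`. -/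
def qInt (n : ℕ) : Kv := (v ^ (n : ℤ) - v ^ (-(n : ℤ))) / (v - v⁻¹)

/-- `[n]! = [n] ⋯ [1]`. -/
def qFactorial (n : ℕ) : Kv := ∏ k ∈ Finset.Icc 1 n, qInt k

/-- The divided power `x^{(n)} = x^n / [n]!`. -/
def divPow {A : Type*} [Ring A] [Algebra Kv A] (x : A) (n : ℕ) : A := (qFactorial n)⁻¹ • x ^ n

/-! ### The algebra `U^-` -/

section Algebra

variable (V : Type u) [Quiver.{w + 1} V]

/-- The free `ℂ(v)`-algebra on the generators `F_ι`, `ι ∈ I_∞`. -/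
abbrev FreeU : Type u := FreeAlgebra Kv (IInf V)

variable {V}

/-- The generator `F_ι` of the free algebra. -/
abbrev freeF (ι : IInf V) : FreeU V := FreeAlgebra.ι Kv ι

variable (V)

/-- The defining relations of `U^-`: the commutation relations and the Serre relations. In the
latter `1 - (j, ι) ≥ 1`, so that passing to a natural number loses nothing. -/
inductive Rel : FreeU V → FreeU V → Prop
  | comm (ι κ : IInf V) (h : ι.pairing κ = 0) :
      Rel (freeF ι * freeF κ) (freeF κ * freeF ι)
  | serre (j : V) (hj : IsRealVertex j) (ι : IInf V) (h : ι ≠ .re j hj) :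
      Rel (∑ p ∈ Finset.HasAntidiagonal.antidiagonal (1 - (IInf.re j hj).pairing ι).toNat,
        (-1 : Kv) ^ p.1 • (divPow (freeF (.re j hj)) p.1 * freeF ι *
          divPow (freeF (.re j hj)) p.2)) 0

/-- The algebra `U^-`. -/
abbrev UMinus : Type u := RingQuot (Rel V)

/-- The quotient map from the free algebra onto `U^-`. -/
def proj : FreeU V →ₐ[Kv] UMinus V := RingQuot.mkAlgHom Kv (Rel V)

variable {V}

/-- The generator `F_ι` of `U^-`. -/
def F (ι : IInf V) : UMinus V := proj V (freeF ι)

/-- The homogeneous subspace `U^-[d]`, spanned by the monomials in the `F_ι` of degree `d`, where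
`F_ι` has degree `- weight ι`. -/
def degreePart (d : V →₀ ℤ) : Submodule Kv (UMinus V) :=
  Submodule.span Kv
    {x | ∃ s : List (IInf V), (s.map fun ι => -ι.weight).sum = d ∧ x = (s.map F).prod}

/-! ### The twisted coproduct and the elements `b_ι`

The tensor square of the free algebra carries the multiplication
`(a ⊗ b) (c ⊗ d) = v ^ (|b|, |c|) • (a c ⊗ b d)`, and the coproduct `δ` is the algebra homomorphism
for this multiplication with `δ(F_j) = F_j ⊗ 1 + 1 ⊗ F_j` for `j` real and
`δ(F_{i,l}) = ∑_{s+t=l} v_i^{st} F_{i,s} ⊗ F_{i,t}` for `i` imaginary, where `F_{i,0} = 1` and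
`v_i = v^{(i,i)/2} = v^{1 - ω_i}`. -/

/-- The automorphism `c ↦ v ^ (β, |c|) c` of the free algebra (`c` homogeneous). -/
def twist (β : V →₀ ℤ) : FreeU V →ₐ[Kv] FreeU V :=
  FreeAlgebra.lift Kv fun κ => v ^ form β (-κ.weight) • freeF κ

/-- Left multiplication by `a ⊗ b`, with `b` homogeneous of degree `β`, for the twisted
multiplication on the tensor square: `c ⊗ d ↦ v ^ (β, |c|) • (a c ⊗ b d)`. -/
def twistedMulLeft (a b : FreeU V) (β : V →₀ ℤ) : Module.End Kv (FreeU V ⊗[Kv] FreeU V) :=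
  TensorProduct.map (LinearMap.mulLeft Kv a ∘ₗ (twist β).toLinearMap) (LinearMap.mulLeft Kv b)

/-- `F_{i,t}` for `t ≥ 0`, with `F_{i,0} = 1`. -/
def freeF₀ (i : V) (hi : IsImagVertex i) (t : ℕ) : FreeU V :=
  if h : 0 < t then freeF (.im i hi ⟨t, h⟩) else 1

/-- Left multiplication by `δ(F_ι)` on the tensor square. -/
def coprodGen : IInf V → Module.End Kv (FreeU V ⊗[Kv] FreeU V)
  | .re j hj =>
      twistedMulLeft (freeF (.re j hj)) 1 0 +
        twistedMulLeft 1 (freeF (.re j hj)) (-Finsupp.single j 1)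
  | .im i hi l =>
      ∑ p ∈ Finset.HasAntidiagonal.antidiagonal (l : ℕ), v ^ ((1 - (loops i : ℤ)) * (p.1 * p.2)) •
        twistedMulLeft (freeF₀ i hi p.1) (freeF₀ i hi p.2) (-Finsupp.single i (p.2 : ℤ))

/-- The twisted coproduct `δ` of the free algebra. -/
def coprod : FreeU V →ₗ[Kv] FreeU V ⊗[Kv] FreeU V :=
  LinearMap.applyₗ (1 ⊗ₜ[Kv] 1) ∘ₗ (FreeAlgebra.lift Kv coprodGen).toLinearMap

/-- `b ∈ U^-` is primitive: `δ(b) = b ⊗ 1 + 1 ⊗ b` in `U^- ⊗ U^-`, the coproduct of `U^-` being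
computed on a representative in the free algebra. -/
def IsPrimitive (b : UMinus V) : Prop :=
  ∃ x : FreeU V, proj V x = b ∧
    TensorProduct.map (proj V).toLinearMap (proj V).toLinearMap (coprod x) =
      b ⊗ₜ[Kv] 1 + 1 ⊗ₜ[Kv] b

/-- The conditions that single out Bozec's element `b_{i,l}`: it is a primitive element of
`U^-[-li]` that differs from `F_{i,l}` by an element of the subalgebra generated by the `F_{i,k}`
with `k < l`. -/
structure IsBozecElement (i : V) (hi : IsImagVertex i) (l : ℕ+) (b : UMinus V) : Prop where
  mem_degreePart : b ∈ degreePart (-(IInf.im i hi l).weight)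
  sub_mem : b - F (.im i hi l) ∈ Algebra.adjoin Kv {x | ∃ k : ℕ+, k < l ∧ x = F (.im i hi k)}
  primitive : IsPrimitive b

/-- The elements `b_ι`: `b_j = F_j` for a real vertex `j`, and `b_{i,l}` is Bozec's element (the
unique one satisfying `IsBozecElement`) for an imaginary vertex `i`. -/
def b : IInf V → UMinus V
  | .re j hj => F (.re j hj)
  | .im i hi l => Classical.epsilon (IsBozecElement i hi l)

/-! ### The twisted derivations `e'_ι` and their kernels -/

open Classical in
/-- The two properties characterizing `e'_ι`. -/
structure IsTwistedDerivation (ι : IInf V) (e : UMinus V →ₗ[Kv] UMinus V) : Prop where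
  map_mul : ∀ (d : V →₀ ℤ) (y z : UMinus V), y ∈ degreePart d →
    e (y * z) = e y * z + v ^ form (-ι.weight) d • (y * e z)
  map_b : ∀ κ : IInf V, e (b κ) = if ι = κ then 1 else 0

/-- The twisted derivation `e'_ι`, i.e. the unique linear map satisfying
`IsTwistedDerivation ι`. -/
def ePrime (ι : IInf V) : UMinus V →ₗ[Kv] UMinus V := Classical.epsilon (IsTwistedDerivation ι)

/-- `K_j = ker e'_j` for a real vertex `j`. -/
def kerRe (j : V) (hj : IsRealVertex j) : Submodule Kv (UMinus V) :=
  LinearMap.ker (ePrime (.re j hj))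

/-- `K_i = ⋂_{l ≥ 1} ker e'_{(i,l)}` for an imaginary vertex `i`. -/
def kerIm (i : V) (hi : IsImagVertex i) : Submodule Kv (UMinus V) :=
  ⨅ l : ℕ+, LinearMap.ker (ePrime (.im i hi l))

/-! ### The Kashiwara operators `f̃_ι` -/

/-- `u = ∑_{n ≥ 0} F_j^{(n)} z_n` with all `z_n ∈ K_j`. -/
def IsDecompRe (j : V) (hj : IsRealVertex j) (u : UMinus V) (z : ℕ →₀ UMinus V) : Prop :=
  (∀ n, z n ∈ kerRe j hj) ∧ u = z.sum fun n x => divPow (F (.re j hj)) n * x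

/-- `b_{i,c} = b_{i,c_1} ⋯ b_{i,c_k}` for a list `c = (c_1, …, c_k)` of positive integers. -/
def bList (i : V) (hi : IsImagVertex i) (c : List ℕ+) : UMinus V :=
  (c.map fun l => b (.im i hi l)).prod

/-- `b_{i,λ}` for a partition `λ`, given as the multiset of its parts. (It is used for isotropic
`i` only, where the `b_{i,l}` commute, so that the order of the factors does not matter.) -/
def bMultiset (i : V) (hi : IsImagVertex i) (c : Multiset ℕ+) : UMinus V :=
  bList i hi (c.sort (· ≤ ·))

/-- `u = ∑_c b_{i,c} z_c`, over all compositions `c`, with all `z_c ∈ K_i`. -/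
def IsDecompComp (i : V) (hi : IsImagVertex i) (u : UMinus V) (z : List ℕ+ →₀ UMinus V) : Prop :=
  (∀ c, z c ∈ kerIm i hi) ∧ u = z.sum fun c x => bList i hi c * x

/-- `u = ∑_λ b_{i,λ} z_λ`, over all partitions `λ`, with all `z_λ ∈ K_i`. -/
def IsDecompPart (i : V) (hi : IsImagVertex i) (u : UMinus V)
    (z : Multiset ℕ+ →₀ UMinus V) : Prop :=
  (∀ c, z c ∈ kerIm i hi) ∧ u = z.sum fun c x => bMultiset i hi c * x

open Classical in
/-- The Kashiwara operator `f̃_ι : U^- → U^-`, computed from the unique decomposition of its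
argument along `K_j` (`ι = j` real) or `K_i` (`ι = (i, l)`, `i` imaginary). -/
def fTilde : IInf V → UMinus V → UMinus V
  | .re j hj, u =>
      (Classical.epsilon (IsDecompRe j hj u)).sum fun n x => divPow (F (.re j hj)) (n + 1) * x
  | .im i hi l, u =>
      if IsIsotropic i then
        (Classical.epsilon (IsDecompPart i hi u)).sum fun c x =>
          algebraMap ℂ Kv ((Real.sqrt ((l : ℝ) / ((c.count l : ℝ) + 1)) : ℝ) : ℂ) •
            (bMultiset i hi (l ::ₘ c) * x)
      else
        (Classical.epsilon (IsDecompComp i hi u)).sum fun c x => bList i hi (l :: c) * x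

end Algebra

end

end GenQuantum

/-!
The Kashiwara operators at a vertex `i` change the coefficients in the decomposition of `U^-` along
the common kernel of the derivations `e'_ι` at `i`. The theorem therefore rests on three facts: the
elements `b_ι` and the derivations `e'_ι` exist, these decompositions exist and are unique, and
everything attached to one of two orthogonal vertices commutes with everything attached to the
other.

*Decompositions.* Left multiplication by `b_κ` and the derivations `e'_ι` satisfy the `q`-boson
relations `e'_ι b_κ = δ_{ικ} + v ^ (ι, κ) b_κ e'_ι` (`ePrime_b_mul`). Applying a product of
derivations to `b_{i,c} z`, with `z` in the common kernel at `i`, gives a multiple of `z`, and in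
each degree these scalars form a finite matrix `T` (`DecompSystem`). Once `T` is invertible, the
components of top degree of an element can be read off and subtracted, and induction on the degree
gives existence and uniqueness. At a real vertex `T` is diagonal, with nonzero entries since the
`q`-integers do not vanish (`exists_decompSystem_powers`). At an imaginary vertex that is not
isotropic the entries of `T` are integral polynomials in the transcendental element
`q = v ^ (2 - 2 ω_i)`, and `T` is the identity modulo `q`; hence its determinant does not vanish
(`exists_decompSystem_words`). At an isotropic vertex `q = 1` and the `b_{i,l}` commute, so that
`T`, now indexed by partitions, is diagonal with nonzero integers as entries
(`exists_decompSystem_multisets`).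

*Bozec's elements.* The subalgebra generated by the `F_{i,l}` in the free algebra is, after a
rescaling of the generators, the free algebra on `ℕ+` with the `q`-twisted coproduct
`G_n ↦ ∑ G_s ⊗ G_t`. It has twisted derivations `G_n ↦ G_{n-m}`, which describe the coproduct. For generic `q` the
decomposition along the derivations of index less than `l` provides an element with leading term
`G_l` and dual to the derivations (`exists_dual_element`). An element killed by all derivations is
a scalar, and this forces the dual elements to be primitive (`exists_primitive_of_generic`). For
`q = 1` the generating series of the `G_n` is group-like and its logarithmic derivative has primitive
coefficients (`exists_primitive_of_one`).

*Derivations.* On the free algebra, `e'_ι` is the twisted derivation given by the component of the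
coproduct whose first factor is dual to `F_ι` (`slice_dualGen_coprod`). It descends to `U^-`, since
the Serre relation for `j` and `κ` is an iterated `q`-commutator with `F_j` (`serre_sum_eq_qAd`):
`e'_j` kills it, and the other derivations turn it into an iterated `q`-commutator whose last
factors form another Serre relation or the commutator of `F_j` with `1` (`projDer_rel`). The values
on the `b_κ` result from evaluating the coproduct of a primitive element
(`projDer_of_isPrimitive`).

*Orthogonality.* If `(ι, κ) = 0`, the vertices of `ι` and `κ` are orthogonal, so that the `b` at
one vertex commute with the `b` at the other, and likewise the derivations; if the vertices differ,
the derivations at one also commute with multiplication by the `b` at the other. By uniqueness, the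
components of an element of one kernel in the decomposition along the other stay in the first
kernel (`component_mem_vertexKer`), and every element is a sum of products `a d z` with `a`, `d`
coefficients at the two vertices and `z` in both kernels. On these the two operators act on
commuting factors (`fTilde_comm_of_ne`). If the vertices coincide, the vertex is real and the
indices are equal, or it is isotropic and the operators commute by inspection of their coefficients
(`fTilde_comm_of_isotropic`).
-/

namespace GenQuantum

noncomputable section

/-! ### Decompositions along the common kernel of a family of lowering operators -/

section Decomposition

variable {k M C : Type*} [Field k] [AddCommGroup M] [Module k M]

open Classical in
/-- Raising operators `B c` and lowering operators `E c` on a module `M`, indexed by a set `C` with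
a degree that has finite fibres, such that `E c' ∘ B c` restricted to `K` is the scalar `T c' c`
when `c` and `c'` have the same degree and vanishes when `c'` has the larger degree, every diagonal
block of `T` being invertible. The subspaces `W d` play the role of a grading bounded below. -/
structure DecompSystem (K : Submodule k M) (W : ℤ → Submodule k M) (deg : C → ℕ)
    (B E : C → Module.End k M) (T : C → C → k) : Prop where
  fin : ∀ n, {c | deg c = n}.Finite
  W_neg : ∀ d < 0, W d = ⊥
  B_mem : ∀ c d u, u ∈ W d → B c u ∈ W (d + deg c)
  E_mem : ∀ c d u, u ∈ W d → E c u ∈ W (d - deg c)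
  lower : ∀ c c' z, deg c < deg c' → z ∈ K → E c' (B c z) = 0
  level : ∀ c c' z, deg c = deg c' → z ∈ K → E c' (B c z) = T c' c • z
  inv : ∀ n, ∃ S : C → C → k, ∀ c d, deg c = n → deg d = n →
    (∑ e ∈ (fin n).toFinset, S c e * T e d = if c = d then 1 else 0) ∧
      (∑ e ∈ (fin n).toFinset, T c e * S e d = if c = d then 1 else 0)
  top : ∀ u n, (∀ c, n < deg c → E c u = 0) → ∀ c, deg c = n → E c u ∈ K
  zero : ∀ u, (∀ c, E c u = 0) → u = 0

namespace DecompSystem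

variable {K : Submodule k M} {W : ℤ → Submodule k M} {deg : C → ℕ}
  {B E : C → Module.End k M} {T : C → C → k}

/-- Uniqueness: the lowering operators of the top degree that occurs see only the components of that
degree, and determine them since `T` is invertible. -/
theorem eq_zero_of_sum_eq_zero (h : DecompSystem K W deg B E T) {z : C →₀ M}
    (hz : ∀ c, z c ∈ K) (h0 : (z.sum fun c x => B c x) = 0) : z = 0 := by
  classical
  by_contra hne
  obtain ⟨c₀, hc₀, hmax⟩ := Finset.exists_max_image z.support deg
    (Finsupp.support_nonempty_iff.mpr hne)
  obtain ⟨S, hS⟩ := h.inv (deg c₀)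
  have key : ∀ c', deg c' = deg c₀ →
      ∑ c ∈ (h.fin (deg c₀)).toFinset, T c' c • z c = 0 := by
    intro c' hc'
    have h1 : ∑ c ∈ z.support, E c' (B c (z c)) = 0 := by
      rw [← map_sum]
      simpa [Finsupp.sum] using congrArg (E c') h0
    have h2 : ∑ c ∈ z.support with deg c = deg c₀, E c' (B c (z c)) = 0 := by
      rw [← h1]
      refine Finset.sum_subset (Finset.filter_subset _ _) fun c hc hc2 => ?_
      refine h.lower c c' _ ?_ (hz c)
      rw [hc']
      refine lt_of_le_of_ne (hmax c hc) fun he => hc2 ?_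
      simp only [Finset.mem_filter]
      exact ⟨hc, he⟩
    rw [← h2]
    symm
    calc _ = ∑ c ∈ z.support with deg c = deg c₀, T c' c • z c := by
          refine Finset.sum_congr rfl fun c hc => ?_
          rw [Finset.mem_filter] at hc
          exact h.level c c' _ (by rw [hc.2, hc']) (hz c)
      _ = _ := by
          refine Finset.sum_subset (fun c hc => ?_) fun c hc hc2 => ?_
          · simp only [Finset.mem_filter] at hc
            simpa using hc.2
          · have : z c = 0 := by
              by_contra hzc
              refine hc2 (Finset.mem_filter.mpr ⟨Finsupp.mem_support_iff.mpr hzc, ?_⟩)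
              simpa using hc
            rw [this, smul_zero]
  have : z c₀ = 0 := by
    calc z c₀ = ∑ c ∈ (h.fin (deg c₀)).toFinset, (if c₀ = c then (1 : k) else 0) • z c := by
          simp
      _ = ∑ c ∈ (h.fin (deg c₀)).toFinset, (∑ e ∈ (h.fin (deg c₀)).toFinset,
            S c₀ e * T e c) • z c := by
          refine Finset.sum_congr rfl fun c hc => ?_
          rw [(hS c₀ c rfl (by simpa using hc)).1]
      _ = ∑ e ∈ (h.fin (deg c₀)).toFinset, S c₀ e •
            ∑ c ∈ (h.fin (deg c₀)).toFinset, T e c • z c := by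
          simp_rw [Finset.sum_smul, Finset.smul_sum, mul_smul]
          exact Finset.sum_comm
      _ = 0 := Finset.sum_eq_zero fun e he => by
          rw [key e (by simpa using he), smul_zero]
  exact Finsupp.mem_support_iff.mp hc₀ this

theorem unique (h : DecompSystem K W deg B E T) {z z' : C →₀ M}
    (hz : ∀ c, z c ∈ K) (hz' : ∀ c, z' c ∈ K)
    (he : (z.sum fun c x => B c x) = z'.sum fun c x => B c x) : z = z' := by
  rw [← sub_eq_zero]
  refine h.eq_zero_of_sum_eq_zero (fun c => K.sub_mem (hz c) (hz' c)) ?_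
  rw [Finsupp.sum_sub_index (fun c x y => map_sub _ _ _), he, sub_self]

/-- If `u` is killed by the lowering operators of degree at least `n + 1`, those of degree `n` map
it to `K`; inverting `T` gives components in degree `n` whose removal makes `u` be killed by the
lowering operators of degree `n` as well. -/
theorem exists_decomp_aux (h : DecompSystem K W deg B E T) (d : ℤ) (n : ℕ) :
    ∀ u ∈ W d, (∀ c, n ≤ deg c → E c u = 0) →
      ∃ z : C →₀ M, (∀ c, z c ∈ K ∧ z c ∈ W (d - deg c)) ∧ u = z.sum fun c x => B c x := by
  classical
  induction n with
  | zero =>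
    intro u _ h0
    refine ⟨0, fun c => ⟨K.zero_mem, (W _).zero_mem⟩, ?_⟩
    rw [h.zero u fun c => h0 c (Nat.zero_le _), Finsupp.sum_zero_index]
  | succ n ih =>
    intro u hu h0
    obtain ⟨S, hS⟩ := h.inv n
    set L := (h.fin n).toFinset with hL
    have memL : ∀ c, c ∈ L ↔ deg c = n := fun c => by simp [hL]
    have hEK : ∀ c, deg c = n → E c u ∈ K := h.top u n fun c hc => h0 c hc
    let y : C → M := fun c => if deg c = n then ∑ e ∈ L, S c e • E e u else 0
    let z₁ : C →₀ M := Finsupp.onFinset L y fun c hc => by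
      rw [memL]; by_contra hne; exact hc (if_neg hne)
    have hz₁ : ∀ c, z₁ c = y c := fun c => rfl
    have hyK : ∀ c, y c ∈ K ∧ y c ∈ W (d - deg c) := by
      intro c
      by_cases hc : deg c = n
      · simp only [y, if_pos hc]
        refine ⟨K.sum_mem fun e he => K.smul_mem _ (hEK e ((memL e).mp he)),
          (W _).sum_mem fun e he => (W _).smul_mem _ ?_⟩
        rw [hc, ← (memL e).mp he]
        exact h.E_mem e d u hu
      · simp only [y, if_neg hc]
        exact ⟨K.zero_mem, (W _).zero_mem⟩
    have hsum : (z₁.sum fun c x => B c x) = ∑ c ∈ L, B c (y c) :=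
      Finsupp.onFinset_sum _ fun c => map_zero _
    have hmem : u - (z₁.sum fun c x => B c x) ∈ W d := by
      refine (W d).sub_mem hu ?_
      rw [hsum]
      refine (W d).sum_mem fun c _ => ?_
      have := h.B_mem c _ _ (hyK c).2
      rwa [sub_add_cancel] at this
    have hE : ∀ c, n ≤ deg c → E c (u - z₁.sum fun c x => B c x) = 0 := by
      intro c hc
      rw [map_sub, hsum, map_sum]
      rcases hc.eq_or_lt with hc | hc
      · have h1 : ∑ x ∈ L, E c (B x (y x)) = E c u := by
          calc _ = ∑ x ∈ L, T c x • ∑ e ∈ L, S x e • E e u := by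
                refine Finset.sum_congr rfl fun x hx => ?_
                rw [h.level x c _ (by rw [(memL x).mp hx, hc]) (hyK x).1]
                simp only [y, if_pos ((memL x).mp hx)]
            _ = ∑ e ∈ L, (∑ x ∈ L, T c x * S x e) • E e u := by
                simp_rw [Finset.sum_smul, Finset.smul_sum, mul_smul]
                exact Finset.sum_comm
            _ = ∑ e ∈ L, (if c = e then (1 : k) else 0) • E e u := by
                refine Finset.sum_congr rfl fun e he => ?_
                rw [(hS c e hc.symm ((memL e).mp he)).2]
            _ = E c u := by simp [memL, ← hc]
        rw [h1, sub_self]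
      · rw [h0 c hc, zero_sub, neg_eq_zero]
        refine Finset.sum_eq_zero fun x hx => h.lower x c _ ?_ (hyK x).1
        rw [(memL x).mp hx]; exact hc
    obtain ⟨z₂, hz₂, he⟩ := ih _ hmem hE
    refine ⟨z₁ + z₂, fun c => ⟨K.add_mem (hyK c).1 (hz₂ c).1,
        (W _).add_mem (hyK c).2 (hz₂ c).2⟩, ?_⟩
    rw [Finsupp.sum_add_index' (fun c => map_zero _) (fun c x y => map_add _ _ _), ← he]
    abel

theorem exists_decomp (h : DecompSystem K W deg B E T) {d : ℤ} {u : M} (hu : u ∈ W d) :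
    ∃ z : C →₀ M, (∀ c, z c ∈ K ∧ z c ∈ W (d - deg c)) ∧ u = z.sum fun c x => B c x := by
  refine h.exists_decomp_aux d (d.toNat + 1) u hu fun c hc => ?_
  have := h.E_mem c d u hu
  rw [h.W_neg _ (by omega)] at this
  exact (Submodule.mem_bot k).mp this

theorem exists_decomp_of_iSup (h : DecompSystem K W deg B E T) (hW : ⨆ d, W d = ⊤) (u : M) :
    ∃ z : C →₀ M, (∀ c, z c ∈ K) ∧ u = z.sum fun c x => B c x := by
  have hu : u ∈ ⨆ d, W d := hW ▸ Submodule.mem_top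
  induction hu using Submodule.iSup_induction' with
  | mem d x hx =>
    obtain ⟨z, hz, he⟩ := h.exists_decomp hx
    exact ⟨z, fun c => (hz c).1, he⟩
  | zero => exact ⟨0, fun c => K.zero_mem, by simp⟩
  | add x y _ _ hx hy =>
    obtain ⟨z, hz, he⟩ := hx
    obtain ⟨z', hz', he'⟩ := hy
    refine ⟨z + z', fun c => K.add_mem (hz c) (hz' c), ?_⟩
    rw [Finsupp.sum_add_index' (fun c => map_zero _) (fun c x y => map_add _ _ _), ← he, ← he']

end DecompSystem

open Classical in
/-- Invertibility of the diagonal blocks of `T`, from the non-vanishing of their determinants. -/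
theorem exists_inverse_of_det_ne_zero {L : Set C} (hL : L.Finite) (T : C → C → k)
    (hdet : ∀ [Fintype L] [DecidableEq L], (Matrix.of fun c c' : L => T c c').det ≠ 0) :
    ∃ S : C → C → k, ∀ c d, c ∈ L → d ∈ L →
      (∑ e ∈ hL.toFinset, S c e * T e d = if c = d then 1 else 0) ∧
        (∑ e ∈ hL.toFinset, T c e * S e d = if c = d then 1 else 0) := by
  let _ : Fintype L := hL.fintype
  set A : Matrix L L k := Matrix.of fun c c' : L => T c c'
  have hA : IsUnit A.det := isUnit_iff_ne_zero.mpr hdet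
  refine ⟨fun c c' => if h : c ∈ L ∧ c' ∈ L then A⁻¹ ⟨c, h.1⟩ ⟨c', h.2⟩ else 0, ?_⟩
  intro c d hc hd
  have e1 : ∀ f : C → k, ∑ e ∈ hL.toFinset, f e = ∑ e : L, f e := fun f => by
    rw [← Finset.sum_coe_sort]
    refine Fintype.sum_equiv (Equiv.subtypeEquivRight fun x => by simp) _ _ fun x => rfl
  rw [e1, e1]
  have h1 := congrFun (congrFun (Matrix.nonsing_inv_mul A hA) ⟨c, hc⟩) ⟨d, hd⟩
  have h2 := congrFun (congrFun (Matrix.mul_nonsing_inv A hA) ⟨c, hc⟩) ⟨d, hd⟩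
  rw [Matrix.mul_apply, Matrix.one_apply] at h1 h2
  simp only [Subtype.mk.injEq] at h1 h2
  refine ⟨Eq.trans ?_ h1, Eq.trans ?_ h2⟩ <;>
    refine Finset.sum_congr rfl fun e _ => ?_ <;> simp [hc, hd, A]

end Decomposition

/-! ### The `q`-boson relations and the decompositions that they yield -/

section Bosons

variable {k M Λ : Type*} [Field k] [AddCommGroup M] [Module k M]

/-- The weight of a word. -/
def wordWeight (wt : Λ → ℕ+) (c : List Λ) : ℕ := (c.map fun l => (wt l : ℕ)).sum

@[simp] theorem wordWeight_nil (wt : Λ → ℕ+) : wordWeight wt [] = 0 := rfl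

@[simp] theorem wordWeight_cons (wt : Λ → ℕ+) (l : Λ) (c : List Λ) :
    wordWeight wt (l :: c) = wt l + wordWeight wt c := by simp [wordWeight]

@[simp] theorem wordWeight_append (wt : Λ → ℕ+) (c d : List Λ) :
    wordWeight wt (c ++ d) = wordWeight wt c + wordWeight wt d := by simp [wordWeight]

theorem wordWeight_perm (wt : Λ → ℕ+) {c d : List Λ} (h : c.Perm d) :
    wordWeight wt c = wordWeight wt d := (h.map _).sum_eq

theorem wordWeight_eq_zero {wt : Λ → ℕ+} {c : List Λ} (h : wordWeight wt c = 0) : c = [] := by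
  cases c with
  | nil => rfl
  | cons l c => have := (wt l).pos; simp at h

theorem finite_wordWeight {wt : Λ → ℕ+} (hwt : Function.Injective wt) (n : ℕ) :
    {c | wordWeight wt c = n}.Finite := by
  induction n using Nat.strong_induction_on with
  | _ n ih =>
    have hfin : {l : Λ | (wt l : ℕ) ≤ n}.Finite := by
      refine Set.Finite.of_finite_image (f := fun l => (wt l : ℕ))
        ((Set.finite_Iic n).subset ?_) (fun a _ b _ h => hwt (PNat.coe_injective h))
      rintro _ ⟨l, hl, rfl⟩
      exact hl
    refine ((Set.finite_singleton []).union (hfin.biUnion fun l hl =>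
      (ih (n - wt l) (by have := (wt l).pos; have : (wt l : ℕ) ≤ n := hl; omega)).image
        (List.cons l))).subset ?_
    rintro (_ | ⟨l, c⟩) hc
    · exact Or.inl rfl
    · simp only [Set.mem_ofPred_eq, wordWeight_cons] at hc
      refine Or.inr (Set.mem_biUnion (x := l) (by simp; omega) ⟨c, ?_, rfl⟩)
      simp only [Set.mem_ofPred_eq]
      omega

/-- The raising operator attached to a word `c₁ ⋯ cᵣ`, namely `b c₁ ∘ ⋯ ∘ b cᵣ`. -/
def raise (b : Λ → Module.End k M) (c : List Λ) : Module.End k M := (c.map b).prod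

/-- The lowering operator attached to a word `c₁ ⋯ cᵣ`, namely `e cᵣ ∘ ⋯ ∘ e c₁`. The order is
such that `e c₁` meets the leftmost factor of `raise b (c₁ ⋯ cᵣ)` first. -/
def lowerWord (e : Λ → Module.End k M) : List Λ → Module.End k M
  | [] => 1
  | l :: c => lowerWord e c * e l

variable {b e : Λ → Module.End k M}

@[simp] theorem raise_nil (z : M) : raise b [] z = z := rfl

@[simp] theorem raise_cons (l : Λ) (c : List Λ) (z : M) :
    raise b (l :: c) z = b l (raise b c z) := by simp [raise]

@[simp] theorem raise_append (c d : List Λ) (z : M) :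
    raise b (c ++ d) z = raise b c (raise b d z) := by simp [raise]

@[simp] theorem lowerWord_nil (z : M) : lowerWord e [] z = z := rfl

@[simp] theorem lowerWord_cons (l : Λ) (c : List Λ) (z : M) :
    lowerWord e (l :: c) z = lowerWord e c (e l z) := rfl

@[simp] theorem lowerWord_append (c d : List Λ) (z : M) :
    lowerWord e (c ++ d) z = lowerWord e d (lowerWord e c z) := by
  induction c generalizing z with
  | nil => rfl
  | cons l c ih => simp [ih]

theorem raise_perm (hb : ∀ l m z, b l (b m z) = b m (b l z)) {c d : List Λ} (h : c.Perm d)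
    (z : M) : raise b c z = raise b d z := by
  induction h with
  | nil => rfl
  | cons l _ ih => simp [ih]
  | swap l m c => simp [hb l m]
  | trans _ _ h1 h2 => rw [h1, h2]

theorem lowerWord_perm (he : ∀ l m z, e l (e m z) = e m (e l z)) {c d : List Λ}
    (h : c.Perm d) (z : M) : lowerWord e c z = lowerWord e d z := by
  induction h generalizing z with
  | nil => rfl
  | cons l _ ih => simp [ih]
  | swap l m c => simp [he l m]
  | trans _ _ h1 h2 => rw [h1, h2]

open Classical in
/-- Operators `b l`, `e l` satisfying the `q`-boson relations
`e l ∘ b m = δ_{l m} + q ^ (wt l * wt m) • b m ∘ e l` and compatible with the subspaces `W d`. -/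
structure BosonSystem (wt : Λ → ℕ+) (q : k) (W : ℤ → Submodule k M)
    (b e : Λ → Module.End k M) : Prop where
  inj : Function.Injective wt
  W_neg : ∀ d < 0, W d = ⊥
  b_mem : ∀ l d u, u ∈ W d → b l u ∈ W (d + wt l)
  e_mem : ∀ l d u, u ∈ W d → e l u ∈ W (d - wt l)
  comm : ∀ l m z, e l (b m z) =
    (if l = m then z else 0) + q ^ ((wt l : ℕ) * (wt m : ℕ)) • b m (e l z)

namespace BosonSystem

variable {wt : Λ → ℕ+} {q : k} {W : ℤ → Submodule k M}

theorem raise_mem (h : BosonSystem wt q W b e) (c : List Λ) :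
    ∀ d u, u ∈ W d → raise b c u ∈ W (d + wordWeight wt c) := by
  induction c with
  | nil => intro d u hu; simpa using hu
  | cons l c ih =>
    intro d u hu
    have := h.b_mem l _ _ (ih d u hu)
    rw [raise_cons]
    convert this using 2
    push_cast [wordWeight_cons]
    ring

theorem lowerWord_mem (h : BosonSystem wt q W b e) (c : List Λ) :
    ∀ d u, u ∈ W d → lowerWord e c u ∈ W (d - wordWeight wt c) := by
  induction c with
  | nil => intro d u hu; simpa using hu
  | cons l c ih =>
    intro d u hu
    have := ih _ _ (h.e_mem l d u hu)
    rw [lowerWord_cons]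
    convert this using 2
    push_cast [wordWeight_cons]
    ring

open Polynomial

/-- Contracting a raising word against a lowering word of at least the same weight produces a
scalar which is a polynomial in `q`; modulo `q` only the contraction without crossings survives. -/
theorem exists_contraction (h : BosonSystem wt q W b e) (c' : List Λ) :
    ∀ c, wordWeight wt c ≤ wordWeight wt c' → ∃ p : ℤ[X],
      (c = c' → p.eval 0 = 1) ∧ (c ≠ c' → p.eval 0 = 0) ∧
      (wordWeight wt c < wordWeight wt c' → p = 0) ∧
      ∀ z ∈ ⨅ l, LinearMap.ker (e l), lowerWord e c' (raise b c z) = aeval q p • z := by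
  classical
  induction c' with
  | nil =>
    intro c hc
    have : c = [] := wordWeight_eq_zero (by simpa using hc)
    subst this
    exact ⟨1, by simp, by simp, by simp, fun z _ => by simp⟩
  | cons l c' ih =>
    -- The operator `e l` is moved to the right through `raise b c`, the factors it has already
    -- passed being collected in the prefix `a`.
    have key : ∀ c a, wordWeight wt a + wordWeight wt c ≤ wordWeight wt (l :: c') → ∃ p : ℤ[X],
        p.eval 0 = (if c ≠ [] ∧ a ++ c.tail = c' ∧ c.head? = some l then 1 else 0) ∧
        (wordWeight wt a + wordWeight wt c < wordWeight wt (l :: c') → p = 0) ∧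
        ∀ z ∈ ⨅ l, LinearMap.ker (e l),
          lowerWord e c' (raise b a (e l (raise b c z))) = aeval q p • z := by
      intro c
      induction c with
      | nil =>
        intro a _
        refine ⟨0, by simp, by simp, fun z hz => ?_⟩
        have : e l z = 0 := by simpa using (Submodule.mem_iInf _).mp hz l
        simp [this]
      | cons m c ihc =>
        intro a ha
        obtain ⟨t, ht0, htlt, ht⟩ := ihc (a ++ [m]) (by simp at ha ⊢; omega)
        have hpos : (wt l : ℕ) * (wt m : ℕ) ≠ 0 := by positivity
        by_cases hlm : l = m
        · subst hlm
          obtain ⟨s, hs1, hs0, hslt, hs⟩ := ih (a ++ c) (by simp at ha ⊢; omega)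
          refine ⟨s + X ^ ((wt l : ℕ) * (wt l : ℕ)) * t, ?_, ?_, ?_⟩
          · by_cases hc : a ++ c = c'
            · simp [hc, hs1 hc]
            · simp [hc, hs0 hc]
          · intro hlt
            rw [hslt (by simp at hlt ⊢; omega), htlt (by simp at hlt ⊢; omega)]
            simp
          · intro z hz
            have e1 := hs z hz
            have e2 := ht z hz
            simp only [raise_append, raise_cons, raise_nil] at e1 e2
            simp only [raise_cons, h.comm, if_true, map_add, map_smul, e1, e2, map_mul,
              map_pow, aeval_X, add_smul, mul_smul]
        · refine ⟨X ^ ((wt l : ℕ) * (wt m : ℕ)) * t, ?_, ?_, ?_⟩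
          · simp [Ne.symm hlm]
          · intro hlt
            rw [htlt (by simp at hlt ⊢; omega)]
            simp
          · intro z hz
            have e2 := ht z hz
            simp only [raise_append, raise_cons, raise_nil] at e2
            simp only [raise_cons, h.comm, if_neg hlm, map_smul, e2, map_mul,
              map_pow, aeval_X, mul_smul, zero_add]
    intro c hc
    obtain ⟨p, hp0, hplt, hp⟩ := key c [] (by simpa using hc)
    have hiff : (c ≠ [] ∧ [] ++ c.tail = c' ∧ c.head? = some l) ↔ c = l :: c' := by
      cases c with
      | nil => simp
      | cons m c => simp [and_comm]
    refine ⟨p, fun he => ?_, fun he => ?_, fun hlt => hplt (by simpa using hlt), fun z hz => ?_⟩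
    · rw [hp0, if_pos (hiff.mpr he)]
    · rw [hp0, if_neg (fun hh => he (hiff.mp hh))]
    · simpa using hp z hz

theorem lowerWord_mem_iInf_ker (u : M) (c : List Λ)
    (h : ∀ l, lowerWord e (c ++ [l]) u = 0) : lowerWord e c u ∈ ⨅ l, LinearMap.ker (e l) := by
  rw [Submodule.mem_iInf]
  intro l
  simpa using h l

/-- For `q` generic, the boson relations yield a decomposition indexed by words: modulo `q` the
contraction matrix is the identity, so that it is invertible. -/
theorem exists_decompSystem_words (h : BosonSystem wt q W b e)
    (hq : ∀ p : ℤ[X], p.eval 0 = 1 → aeval q p ≠ 0) :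
    ∃ T, DecompSystem (⨅ l, LinearMap.ker (e l)) W (wordWeight wt) (raise b) (lowerWord e) T := by
  classical
  have key : ∀ c' c, ∃ p : ℤ[X], wordWeight wt c ≤ wordWeight wt c' →
      (p.eval 0 = if c' = c then 1 else 0) ∧
      (wordWeight wt c < wordWeight wt c' → p = 0) ∧
      ∀ z ∈ ⨅ l, LinearMap.ker (e l), lowerWord e c' (raise b c z) = aeval q p • z := by
    intro c' c
    by_cases hc : wordWeight wt c ≤ wordWeight wt c'
    · obtain ⟨p, h1, h2, h3, h4⟩ := h.exists_contraction c' c hc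
      refine ⟨p, fun _ => ⟨?_, h3, h4⟩⟩
      by_cases hcc : c' = c
      · rw [if_pos hcc, h1 hcc.symm]
      · rw [if_neg hcc, h2 (Ne.symm hcc)]
    · exact ⟨0, fun hh => absurd hh hc⟩
  choose P hP using key
  refine ⟨fun c' c => aeval q (P c' c), ⟨finite_wordWeight h.inj, h.W_neg,
    h.raise_mem, h.lowerWord_mem, ?_, ?_, ?_, ?_, ?_⟩⟩
  · intro c c' z hlt hz
    obtain ⟨-, h2, h3⟩ := hP c' c hlt.le
    rw [h3 z hz, h2 hlt, map_zero, zero_smul]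
  · intro c c' z hd hz
    exact (hP c' c hd.le).2.2 z hz
  · intro n
    obtain ⟨S, hS⟩ := exists_inverse_of_det_ne_zero (finite_wordWeight h.inj n)
      (fun c' c => aeval q (P c' c)) (by
        intro _ _
        set A : Matrix {c | wordWeight wt c = n} {c | wordWeight wt c = n} ℤ[X] :=
          Matrix.of fun c' c => P c' c with hA
        have h1 : (Matrix.of fun c' c : {c | wordWeight wt c = n} =>
            (aeval q (P c' c) : k)) = (aeval q : ℤ[X] →ₐ[ℤ] k).mapMatrix A := rfl
        rw [h1, ← AlgHom.map_det]
        refine hq _ ?_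
        rw [← coe_evalRingHom, RingHom.map_det]
        have h2 : (evalRingHom (0 : ℤ)).mapMatrix A = 1 := by
          ext c' c
          have : (c : List Λ) ∈ {c | wordWeight wt c = n} := c.2
          have := (hP c' c (by rw [show wordWeight wt (c : List Λ) = n from c.2,
            show wordWeight wt (c' : List Λ) = n from c'.2])).1
          simp only [RingHom.mapMatrix_apply, Matrix.map_apply, hA, Matrix.of_apply,
            coe_evalRingHom, this, Matrix.one_apply, Subtype.ext_iff]
        rw [h2, Matrix.det_one])
    exact ⟨S, fun c d hc hd => hS c d hc hd⟩
  · intro u n hu c hc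
    exact lowerWord_mem_iInf_ker u c fun l => hu _ (by simp; have := (wt l).pos; omega)
  · intro u hu
    simpa using hu []

/-- Contraction of commuting bosons at `q = 1`: only words with the same letters pair
non-trivially. -/
theorem contraction_of_comm [CharZero k] (h : BosonSystem wt 1 W b e)
    (hb : ∀ l m z, b l (b m z) = b m (b l z)) (c' : List Λ) :
    ∀ c, wordWeight wt c ≤ wordWeight wt c' →
      (c.Perm c' → ∃ t : k, t ≠ 0 ∧ ∀ z ∈ ⨅ l, LinearMap.ker (e l),
        lowerWord e c' (raise b c z) = t • z) ∧
      (¬ c.Perm c' → ∀ z ∈ ⨅ l, LinearMap.ker (e l), lowerWord e c' (raise b c z) = 0) := by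
  classical
  have hcount : ∀ l c, ∀ z ∈ ⨅ l, LinearMap.ker (e l),
      e l (raise b c z) = (c.count l : k) • raise b (c.erase l) z := by
    intro l c z hz
    induction c with
    | nil => simpa using (Submodule.mem_iInf _).mp hz l
    | cons m c ih =>
      rw [raise_cons, h.comm, one_pow, one_smul, ih, map_smul]
      by_cases hlm : l = m
      · subst hlm
        by_cases hl : l ∈ c
        · have := raise_perm hb (List.perm_cons_erase hl) z
          rw [raise_cons] at this
          rw [← this]
          simp [add_smul, add_comm]
        · simp [List.count_eq_zero_of_not_mem hl]
      · rw [if_neg hlm, zero_add, List.erase_cons_tail (by simpa using Ne.symm hlm),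
          List.count_cons_of_ne (Ne.symm hlm), raise_cons]
  induction c' with
  | nil =>
    intro c hc
    have : c = [] := wordWeight_eq_zero (by simpa using hc)
    subst this
    exact ⟨fun _ => ⟨1, one_ne_zero, by simp⟩, by simp⟩
  | cons l c' ih =>
    intro c hc
    by_cases hl : l ∈ c
    · have hp := List.perm_cons_erase hl
      have hw := wordWeight_perm wt hp
      simp only [wordWeight_cons] at hc hw
      have hiff : c.Perm (l :: c') ↔ (c.erase l).Perm c' :=
        ⟨fun hh => (List.perm_cons l).mp (hp.symm.trans hh),
          fun hh => hp.trans ((List.perm_cons l).mpr hh)⟩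
      obtain ⟨h1, h2⟩ := ih (c.erase l) (by omega)
      rw [hiff]
      refine ⟨fun hh => ?_, fun hh z hz => ?_⟩
      · obtain ⟨t, ht, htz⟩ := h1 hh
        refine ⟨c.count l * t, mul_ne_zero ?_ ht, fun z hz => ?_⟩
        · exact_mod_cast (List.count_pos_iff.mpr hl).ne'
        · rw [lowerWord_cons, hcount l c z hz, map_smul, htz z hz, mul_smul]
      · rw [lowerWord_cons, hcount l c z hz, map_smul, h2 hh z hz, smul_zero]
    · refine ⟨fun hh => absurd (hh.mem_iff.mpr (by simp)) hl, fun _ z hz => ?_⟩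
      rw [lowerWord_cons, hcount l c z hz, List.count_eq_zero_of_not_mem hl]
      simp

/-- Commuting bosons at `q = 1` yield a decomposition indexed by multisets; `r` is a choice of an
ordering of each multiset. -/
theorem exists_decompSystem_multisets [CharZero k] (h : BosonSystem wt 1 W b e)
    (hb : ∀ l m z, b l (b m z) = b m (b l z)) (he : ∀ l m z, e l (e m z) = e m (e l z))
    (r : Multiset Λ → List Λ) (hr : ∀ c, (r c : Multiset Λ) = c) :
    ∃ T, DecompSystem (⨅ l, LinearMap.ker (e l)) W (fun c => wordWeight wt (r c))
      (fun c => raise b (r c)) (fun c => lowerWord e (r c)) T := by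
  classical
  have hrp : ∀ c d, (r c).Perm (r d) ↔ d = c := fun c d => by
    rw [← Multiset.coe_eq_coe, hr, hr, eq_comm]
  have hrl : ∀ l c, (r (l ::ₘ c)).Perm (r c ++ [l]) := fun l c => by
    rw [← Multiset.coe_eq_coe, hr, ← Multiset.coe_add, hr]
    simp [← Multiset.singleton_add, add_comm]
  have key : ∀ c' c, ∃ t : k, wordWeight wt (r c) ≤ wordWeight wt (r c') →
      (c' = c → t ≠ 0) ∧ (c' ≠ c → t = 0) ∧
      ∀ z ∈ ⨅ l, LinearMap.ker (e l), lowerWord e (r c') (raise b (r c) z) = t • z := by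
    intro c' c
    by_cases hc : wordWeight wt (r c) ≤ wordWeight wt (r c')
    · obtain ⟨h1, h2⟩ := h.contraction_of_comm hb (r c') (r c) hc
      rw [hrp] at h1 h2
      by_cases hcc : c' = c
      · obtain ⟨t, ht, htz⟩ := h1 hcc
        exact ⟨t, fun _ => ⟨fun _ => ht, fun hh => absurd hcc hh, htz⟩⟩
      · exact ⟨0, fun _ => ⟨fun hh => absurd hh hcc, fun _ => rfl, fun z hz => by
          rw [h2 hcc z hz, zero_smul]⟩⟩
    · exact ⟨0, fun hh => absurd hh hc⟩
  choose T hT using key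
  have hfin : ∀ n, {c : Multiset Λ | wordWeight wt (r c) = n}.Finite := fun n =>
    ((finite_wordWeight h.inj n).image fun c : List Λ => (c : Multiset Λ)).subset
      fun c hc => ⟨r c, hc, hr c⟩
  refine ⟨T, ⟨hfin, h.W_neg, fun c => h.raise_mem (r c), fun c => h.lowerWord_mem (r c),
    ?_, ?_, ?_, ?_, ?_⟩⟩
  · intro c c' z hlt hz
    obtain ⟨-, h2, h3⟩ := hT c' c hlt.le
    rw [h3 z hz, h2 (fun hh => by subst hh; exact lt_irrefl _ hlt), zero_smul]
  · intro c c' z hd hz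
    exact (hT c' c hd.le).2.2 z hz
  · intro n
    obtain ⟨S, hS⟩ := exists_inverse_of_det_ne_zero (hfin n) T (by
        intro _ _
        have : (Matrix.of fun c c' : {c | wordWeight wt (r c) = n} => T c c') =
            Matrix.diagonal fun c : {c | wordWeight wt (r c) = n} => T c c := by
          ext c c'
          rw [Matrix.of_apply, Matrix.diagonal_apply]
          by_cases hcc : c = c'
          · rw [if_pos hcc, hcc]
          · rw [if_neg hcc]
            exact (hT c c' (by rw [show wordWeight wt (r c) = n from c.2,
              show wordWeight wt (r c') = n from c'.2])).2.1 fun hh => hcc (Subtype.ext hh)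
        rw [this, Matrix.det_diagonal]
        exact Finset.prod_ne_zero_iff.mpr fun c _ => (hT c c le_rfl).1 rfl)
    exact ⟨S, fun c d hc hd => hS c d hc hd⟩
  · intro u n hu c hc
    refine lowerWord_mem_iInf_ker u (r c) fun l => ?_
    rw [← lowerWord_perm he (hrl l c)]
    refine hu _ ?_
    rw [wordWeight_perm wt (hrl l c), wordWeight_append]
    have := (wt l).pos
    simp; omega
  · intro u hu
    have := hu 0
    rwa [show r 0 = [] from by rw [← Multiset.coe_eq_zero, hr]] at this

end BosonSystem

/-- A single `q`-boson, with `q`-integers different from zero, yields a decomposition indexed by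
powers of the raising operator. -/
theorem exists_decompSystem_powers {b e : Module.End k M} {q : k} {W : ℤ → Submodule k M}
    (W_neg : ∀ d < 0, W d = ⊥) (b_mem : ∀ d u, u ∈ W d → b u ∈ W (d + 1))
    (e_mem : ∀ d u, u ∈ W d → e u ∈ W (d - 1))
    (comm : ∀ z, e (b z) = z + q • b (e z))
    (hq : ∀ n, ∑ i ∈ Finset.range (n + 1), q ^ i ≠ 0) (a : ℕ → k) (ha : ∀ n, a n ≠ 0) :
    ∃ T, DecompSystem (LinearMap.ker e) W id (fun n => a n • b ^ n) (fun n => e ^ n) T := by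
  classical
  have hb : ∀ (n : ℕ) d u, u ∈ W d → (b ^ n) u ∈ W (d + n) := by
    intro n
    induction n with
    | zero => intro d u hu; simpa using hu
    | succ n ih =>
      intro d u hu
      have := b_mem _ _ (ih d u hu)
      rw [pow_succ', Module.End.mul_apply]
      convert this using 2
      push_cast; ring
  have he : ∀ (n : ℕ) d u, u ∈ W d → (e ^ n) u ∈ W (d - n) := by
    intro n
    induction n with
    | zero => intro d u hu; simpa using hu
    | succ n ih =>
      intro d u hu
      have := e_mem _ _ (ih d u hu)
      rw [pow_succ', Module.End.mul_apply]
      convert this using 2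
      push_cast; ring
  have h1 : ∀ n, ∀ z ∈ LinearMap.ker e,
      e ((b ^ (n + 1)) z) = (∑ i ∈ Finset.range (n + 1), q ^ i) • (b ^ n) z := by
    intro n z hz
    induction n with
    | zero => simp [comm, LinearMap.mem_ker.mp hz]
    | succ n ih =>
      rw [pow_succ' b (n + 1), Module.End.mul_apply, comm, ih, map_smul, smul_smul,
        ← Module.End.mul_apply, ← pow_succ', Finset.sum_range_succ' _ (n + 1), Finset.mul_sum,
        add_smul]
      simp only [pow_zero, one_smul, pow_succ']
      abel
  have h2 : ∀ n, ∃ t : k, t ≠ 0 ∧ ∀ z ∈ LinearMap.ker e, (e ^ n) ((b ^ n) z) = t • z := by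
    intro n
    induction n with
    | zero => exact ⟨1, one_ne_zero, by simp⟩
    | succ n ih =>
      obtain ⟨t, ht, htz⟩ := ih
      refine ⟨_, mul_ne_zero (hq n) ht, fun z hz => ?_⟩
      rw [pow_succ e, Module.End.mul_apply, h1 n z hz, map_smul, htz z hz, mul_smul]
  choose t ht htz using h2
  refine ⟨fun n m => a m * t m, ⟨fun n => by simp, W_neg, ?_, he, ?_, ?_, ?_, ?_, ?_⟩⟩
  · intro n d u hu
    rw [LinearMap.smul_apply]
    exact (W _).smul_mem _ (hb n d u hu)
  · intro n m z hlt hz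
    obtain ⟨j, rfl⟩ := Nat.exists_eq_add_of_lt (show n < m from hlt)
    rw [LinearMap.smul_apply, map_smul, show n + j + 1 = (j + 1) + n by ring, pow_add,
      Module.End.mul_apply, htz n z hz, map_smul, pow_succ, Module.End.mul_apply,
      LinearMap.mem_ker.mp hz]
    simp
  · rintro n _ z rfl hz
    simp only [id, LinearMap.smul_apply, map_smul, htz n z hz, mul_smul]
  · intro n
    refine ⟨fun m m' => (a m * t m)⁻¹, ?_⟩
    rintro c d rfl hd
    obtain rfl : d = c := hd
    have : a d * t d ≠ 0 := mul_ne_zero (ha d) (ht d)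
    have hs : (show {c | id c = id d}.Finite by simp).toFinset = {d} := by ext; simp
    simp only [hs, Finset.sum_singleton, if_true]
    exact ⟨inv_mul_cancel₀ this, mul_inv_cancel₀ this⟩
  · rintro u n hu c rfl
    rw [LinearMap.mem_ker, ← Module.End.mul_apply, ← pow_succ']
    exact hu _ (Nat.lt_succ_self _)
  · intro u hu
    simpa using hu 0

end Bosons

/-! ### Twisted derivations of free algebras -/

section TwistedDerivation

variable {k X A : Type*} [Field k] [Ring A] [Algebra k A]

/-- The algebra homomorphism `x ↦ [[τ x, D x], [0, σ x]]` into upper triangular matrices; its upper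
right entry `D` is the twisted derivation with prescribed values `d` on the generators. -/
def twistMatrix (τ σ : FreeAlgebra k X →ₐ[k] A) (d : X → A) :
    FreeAlgebra k X →ₐ[k] Matrix (Fin 2) (Fin 2) A :=
  FreeAlgebra.lift k fun x => !![τ (FreeAlgebra.ι k x), d x; 0, σ (FreeAlgebra.ι k x)]

variable (τ σ : FreeAlgebra k X →ₐ[k] A) (d : X → A)

theorem twistMatrix_diag (x : FreeAlgebra k X) :
    twistMatrix τ σ d x 0 0 = τ x ∧ twistMatrix τ σ d x 1 0 = 0 ∧
      twistMatrix τ σ d x 1 1 = σ x := by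
  induction x using FreeAlgebra.induction with
  | grade0 r => simp [Matrix.algebraMap_matrix_apply]
  | grade1 x => simp [twistMatrix]
  | mul a b ha hb =>
    simp [Matrix.mul_apply, Fin.sum_univ_two, ha.1, ha.2.1, ha.2.2, hb.1, hb.2.1, hb.2.2]
  | add a b ha hb => simp [ha.1, ha.2.1, ha.2.2, hb.1, hb.2.1, hb.2.2]

/-- The linear map `D` with `D (x y) = D x * σ y + τ x * D y` and `D x = d x` on generators. -/
def twistDer : FreeAlgebra k X →ₗ[k] A where
  toFun x := twistMatrix τ σ d x 0 1
  map_add' x y := by simp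
  map_smul' r x := by simp

@[simp] theorem twistDer_ι (x : X) : twistDer τ σ d (FreeAlgebra.ι k x) = d x := by
  simp [twistDer, twistMatrix]

@[simp] theorem twistDer_one : twistDer τ σ d 1 = 0 := by
  simp [twistDer]

theorem twistDer_mul (x y : FreeAlgebra k X) :
    twistDer τ σ d (x * y) = twistDer τ σ d x * σ y + τ x * twistDer τ σ d y := by
  simp only [twistDer, LinearMap.coe_mk, AddHom.coe_mk, map_mul, Matrix.mul_apply,
    Fin.sum_univ_two, (twistMatrix_diag τ σ d x).1, (twistMatrix_diag τ σ d y).2.2]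
  rw [add_comm]

/-- A twisted derivation descends to a quotient of the free algebra as soon as it and the two
homomorphisms respect the relations. -/
theorem exists_twistDer_lift {r : FreeAlgebra k X → FreeAlgebra k X → Prop}
    (hτ : ∀ a b, r a b → τ a = τ b) (hσ : ∀ a b, r a b → σ a = σ b)
    (hd : ∀ a b, r a b → twistDer τ σ d a = twistDer τ σ d b) :
    ∃ D : RingQuot r →ₗ[k] A, ∀ x, D (RingQuot.mkAlgHom k r x) = twistDer τ σ d x := by
  have h : ∀ ⦃a b⦄, r a b → twistMatrix τ σ d a = twistMatrix τ σ d b := by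
    intro a b hab
    obtain ⟨h1, h2, h3⟩ := twistMatrix_diag τ σ d a
    obtain ⟨h4, h5, h6⟩ := twistMatrix_diag τ σ d b
    ext i j
    fin_cases i <;> fin_cases j
    · exact h1.trans ((hτ a b hab).trans h4.symm)
    · exact hd a b hab
    · exact h2.trans h5.symm
    · exact h3.trans ((hσ a b hab).trans h6.symm)
  refine ⟨{ toFun := fun x => RingQuot.liftAlgHom k ⟨twistMatrix τ σ d, h⟩ x 0 1
            map_add' := fun x y => by simp
            map_smul' := fun c x => by simp }, fun x => ?_⟩
  simp [twistDer]

/-- A property of the elements of a free algebra holds if it is compatible with linear combinations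
and with left multiplication by generators. -/
theorem freeAlgebra_induction_left {P : FreeAlgebra k X → Prop} (one : P 1)
    (add : ∀ x y, P x → P y → P (x + y)) (smul : ∀ (r : k) x, P x → P (r • x))
    (mul : ∀ x y, P y → P (FreeAlgebra.ι k x * y)) (x : FreeAlgebra k X) : P x := by
  have key : ∀ y, P y → P (x * y) := by
    induction x using FreeAlgebra.induction with
    | grade0 r => intro y hy; rw [← Algebra.smul_def]; exact smul r y hy
    | grade1 x => exact mul x
    | mul a b ha hb => intro y hy; rw [mul_assoc]; exact ha _ (hb y hy)
    | add a b ha hb => intro y hy; rw [add_mul]; exact add _ _ (ha y hy) (hb y hy)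
  simpa using key 1 one

end TwistedDerivation

/-! ### Spans of words of a given degree -/

section WordSpan

variable {k A Λ G : Type*} [Field k] [Ring A] [Algebra k A] [AddCommGroup G]

/-- The span of the products `g s₁ ⋯ g sᵣ` of total degree `h s₁ + ⋯ + h sᵣ = d`. For the generators
`g = F` and `h = -weight` this is `degreePart d`, by definition. -/
def wordSpan (k : Type*) {A Λ G : Type*} [Field k] [Ring A] [Algebra k A] [AddCommGroup G]
    (g : Λ → A) (h : Λ → G) (d : G) : Submodule k A :=
  Submodule.span k {x | ∃ s : List Λ, (s.map h).sum = d ∧ x = (s.map g).prod}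

variable {g : Λ → A} {h : Λ → G}

theorem prod_mem_wordSpan (s : List Λ) : (s.map g).prod ∈ wordSpan k g h (s.map h).sum :=
  Submodule.subset_span ⟨s, rfl, rfl⟩

theorem one_mem_wordSpan : (1 : A) ∈ wordSpan k g h 0 := prod_mem_wordSpan []

theorem apply_mem_wordSpan (l : Λ) : g l ∈ wordSpan k g h (h l) := by
  simpa using prod_mem_wordSpan (k := k) (g := g) (h := h) [l]

theorem wordSpan_induction {P : (d : G) → A → Prop} (one : P 0 1)
    (mul : ∀ l d x, x ∈ wordSpan k g h d → P d x → P (h l + d) (g l * x))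
    (zero : ∀ d, P d 0) (add : ∀ d x y, P d x → P d y → P d (x + y))
    (smul : ∀ d (r : k) x, P d x → P d (r • x)) {d : G} {x : A} (hx : x ∈ wordSpan k g h d) :
    P d x := by
  refine Submodule.span_induction (p := fun x _ => P d x) ?_ (zero d)
    (fun x y _ _ => add d x y) (fun r x _ => smul d r x) hx
  rintro _ ⟨s, rfl, rfl⟩
  clear hx
  induction s with
  | nil => exact one
  | cons l s ih =>
    simp only [List.map_cons, List.sum_cons, List.prod_cons]
    exact mul l _ _ (prod_mem_wordSpan s) ih

theorem mul_mem_wordSpan {d d' : G} {x y : A} (hx : x ∈ wordSpan k g h d)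
    (hy : y ∈ wordSpan k g h d') : x * y ∈ wordSpan k g h (d + d') := by
  refine wordSpan_induction (P := fun d x => x * y ∈ wordSpan k g h (d + d'))
    (by simpa using hy) (fun l d x _ ih => ?_) (by simp)
    (fun d x y hx hy => by rw [add_mul]; exact Submodule.add_mem _ hx hy)
    (fun d r x hx => by rw [smul_mul_assoc]; exact Submodule.smul_mem _ _ hx) hx
  rw [mul_assoc, add_assoc]
  refine Submodule.span_induction (p := fun y _ => g l * y ∈ wordSpan k g h (h l + (d + d')))
    ?_ (by simp) (fun x y _ _ hx hy => by rw [mul_add]; exact Submodule.add_mem _ hx hy)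
    (fun r x _ hx => by rw [mul_smul_comm]; exact Submodule.smul_mem _ _ hx) ih
  rintro _ ⟨s, hs, rfl⟩
  exact Submodule.subset_span ⟨l :: s, by simp [hs], by simp⟩

theorem wordSpan_eq_bot {h : Λ → ℤ} (hh : ∀ l, 0 ≤ h l) (d : ℤ) (hd : d < 0) :
    wordSpan k g h d = ⊥ := by
  refine Submodule.span_eq_bot.mpr ?_
  rintro _ ⟨s, hs, -⟩
  have : 0 ≤ (s.map h).sum := List.sum_nonneg fun x hx => by
    obtain ⟨l, -, rfl⟩ := List.mem_map.mp hx
    exact hh l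
  omega

theorem iSup_wordSpan (hg : Algebra.adjoin k (Set.range g) = ⊤) : ⨆ d, wordSpan k g h d = ⊤ := by
  rw [eq_top_iff, ← Algebra.top_toSubmodule, ← hg, Algebra.adjoin_eq_span, Submodule.span_le]
  intro x hx
  suffices ∃ s : List Λ, x = (s.map g).prod by
    obtain ⟨s, rfl⟩ := this
    exact Submodule.mem_iSup_of_mem _ (prod_mem_wordSpan s)
  induction hx using Submonoid.closure_induction with
  | mem x hx => obtain ⟨l, rfl⟩ := hx; exact ⟨[l], by simp⟩
  | one => exact ⟨[], rfl⟩
  | mul x y _ _ hx hy =>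
    obtain ⟨s, rfl⟩ := hx
    obtain ⟨t, rfl⟩ := hy
    exact ⟨s ++ t, by simp⟩

/-- A property holds on an algebra generated by the `g l` if it is compatible with linear
combinations and with left multiplication by the `g l`. -/
theorem induction_of_adjoin_eq_top (hg : Algebra.adjoin k (Set.range g) = ⊤) {P : A → Prop}
    (one : P 1) (zero : P 0) (add : ∀ x y, P x → P y → P (x + y))
    (smul : ∀ (r : k) x, P x → P (r • x)) (mul : ∀ l x, P x → P (g l * x)) (x : A) : P x := by
  have hx : x ∈ ⨆ d : ℤ, wordSpan k g (fun _ => 0) d :=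
    iSup_wordSpan (h := fun _ => (0 : ℤ)) hg ▸ Submodule.mem_top
  induction hx using Submodule.iSup_induction' with
  | mem d x hx =>
    exact wordSpan_induction (P := fun _ x => P x) one (fun l _ x _ => mul l x) (fun _ => zero)
      (fun _ => add) (fun _ => smul) hx
  | zero => exact zero
  | add x y _ _ hx hy => exact add x y hx hy

end WordSpan

/-! ### Primitive elements of a free algebra with a `q`-twisted coproduct -/

section Primitive

variable (k : Type*) [Field k]

/-- The generator of degree `n` of the free algebra on `ℕ+`, equal to `1` for `n = 0`. -/
def gen (n : ℕ) : FreeAlgebra k ℕ+ := if h : 0 < n then FreeAlgebra.ι k ⟨n, h⟩ else 1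

@[simp] theorem gen_zero : gen k 0 = 1 := rfl

@[simp] theorem gen_coe (n : ℕ+) : gen k n = FreeAlgebra.ι k n := dif_pos n.pos

variable {k}

/-- The homogeneous part of degree `d`, the generator indexed by `n` having degree `n`. -/
abbrev freeDegree (d : ℤ) : Submodule k (FreeAlgebra k ℕ+) :=
  wordSpan k (FreeAlgebra.ι k) (fun m : ℕ+ => ((m : ℕ) : ℤ)) d

theorem gen_mem (n : ℕ) : gen k n ∈ freeDegree (n : ℤ) := by
  rcases n.eq_zero_or_pos with rfl | hn
  · exact one_mem_wordSpan
  · lift n to ℕ+ using hn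
    rw [gen_coe]
    exact apply_mem_wordSpan (h := fun m : ℕ+ => ((m : ℕ) : ℤ)) n

/-- The subalgebra generated by the generators of degree less than `l`. -/
def below (k : Type*) [Field k] (l : ℕ+) : Subalgebra k (FreeAlgebra k ℕ+) :=
  Algebra.adjoin k {x | ∃ m < l, x = FreeAlgebra.ι k m}

theorem ι_mem_below {l m : ℕ+} (h : m < l) : FreeAlgebra.ι k m ∈ below k l :=
  Algebra.subset_adjoin ⟨m, h, rfl⟩

theorem below_mono {l m : ℕ+} (h : m ≤ l) : below k m ≤ below k l :=
  Algebra.adjoin_mono fun _ ⟨n, hn, e⟩ => ⟨n, hn.trans_le h, e⟩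

theorem mem_below_of_mem_freeDegree {l : ℕ+} {d : ℤ} (hd : d < l) {x : FreeAlgebra k ℕ+}
    (hx : x ∈ freeDegree d) : x ∈ below k l := by
  have : freeDegree d ≤ Subalgebra.toSubmodule (below k l) := by
    refine Submodule.span_le.mpr ?_
    rintro _ ⟨s, hs, rfl⟩
    refine Subalgebra.list_prod_mem _ fun y hy => ?_
    obtain ⟨m, hm, rfl⟩ := List.mem_map.mp hy
    refine ι_mem_below ?_
    have : ((m : ℕ) : ℤ) ≤ (s.map fun m : ℕ+ => ((m : ℕ) : ℤ)).sum :=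
      List.single_le_sum (fun x hx => by
        obtain ⟨n, -, rfl⟩ := List.mem_map.mp hx
        positivity) _ (List.mem_map_of_mem hm)
    rw [← PNat.coe_lt_coe]
    omega
  exact this hx

variable (q : k)

/-- The automorphism multiplying the part of degree `d` by `q ^ (d * t)`. -/
def qTwist (t : ℕ) : FreeAlgebra k ℕ+ →ₐ[k] FreeAlgebra k ℕ+ :=
  FreeAlgebra.lift k fun m => q ^ ((m : ℕ) * t) • FreeAlgebra.ι k m

@[simp] theorem qTwist_ι (t : ℕ) (m : ℕ+) :
    qTwist q t (FreeAlgebra.ι k m) = q ^ ((m : ℕ) * t) • FreeAlgebra.ι k m := by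
  simp [qTwist]

theorem qTwist_of_mem (t n : ℕ) {x : FreeAlgebra k ℕ+} (hx : x ∈ freeDegree (n : ℤ)) :
    qTwist q t x = q ^ (n * t) • x := by
  suffices ∀ d : ℤ, x ∈ freeDegree d → 0 ≤ d ∧ qTwist q t x = q ^ (d.toNat * t) • x ∨ x = 0 by
    rcases this n hx with h | h
    · simpa using h.2
    · simp [h]
  intro d hx
  have hx' : 0 ≤ d ∨ x = 0 := by
    by_cases hd : 0 ≤ d
    · exact Or.inl hd
    · rw [freeDegree, wordSpan_eq_bot (fun _ => by positivity) d (by omega)] at hx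
      exact Or.inr hx
  refine hx'.imp_left fun hd => ⟨hd, ?_⟩
  refine Submodule.span_induction (p := fun x _ => qTwist q t x = q ^ (d.toNat * t) • x) ?_
    (by simp) (fun x y _ _ hx hy => by rw [map_add, hx, hy, smul_add])
    (fun r x _ hx => by rw [map_smul, hx, smul_comm]) hx
  rintro _ ⟨s, rfl, rfl⟩
  have hs : ((s.map fun m : ℕ+ => ((m : ℕ) : ℤ)).sum).toNat = wordWeight id s := by
    have : (s.map fun m : ℕ+ => ((m : ℕ) : ℤ)).sum = (wordWeight id s : ℤ) := by
      clear hx hx' hd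
      induction s with
      | nil => rfl
      | cons l s ih =>
        simp only [List.map_cons, List.sum_cons, ih, wordWeight_cons, id]
        push_cast
        rfl
    rw [this, Int.toNat_natCast]
  rw [hs]
  clear hx hx' hd hs
  induction s with
  | nil => simp
  | cons l s ih =>
    simp only [List.map_cons, List.prod_cons, map_mul, qTwist_ι, ih, wordWeight_cons, id,
      add_mul, pow_add, smul_mul_smul_comm]

theorem qTwist_comp (s t : ℕ) (x : FreeAlgebra k ℕ+) :
    qTwist q s (qTwist q t x) = qTwist q t (qTwist q s x) := by
  have : (qTwist q s).comp (qTwist q t) = (qTwist q t).comp (qTwist q s) := by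
    ext m
    simp [smul_comm (q ^ ((m : ℕ) * s)) (q ^ ((m : ℕ) * t))]
  exact DFunLike.congr_fun this x

/-- Left multiplication by `a ⊗ b`, `b` of degree `t`, for the `q`-twisted multiplication. -/
def qMulLeft (a b : FreeAlgebra k ℕ+) (t : ℕ) :
    Module.End k (FreeAlgebra k ℕ+ ⊗[k] FreeAlgebra k ℕ+) :=
  TensorProduct.map (LinearMap.mulLeft k a ∘ₗ (qTwist q t).toLinearMap) (LinearMap.mulLeft k b)

@[simp] theorem qMulLeft_tmul (a b c d : FreeAlgebra k ℕ+) (t : ℕ) :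
    qMulLeft q a b t (c ⊗ₜ d) = (a * qTwist q t c) ⊗ₜ (b * d) := rfl

/-- Left multiplication by the coproduct of the generator of degree `n`. -/
def genCoprod (n : ℕ) : Module.End k (FreeAlgebra k ℕ+ ⊗[k] FreeAlgebra k ℕ+) :=
  ∑ p ∈ Finset.HasAntidiagonal.antidiagonal n, qMulLeft q (gen k p.1) (gen k p.2) p.2

/-- The `q`-twisted coproduct with `G_n ↦ ∑_{s+t=n} G_s ⊗ G_t`. -/
def qCoprod : FreeAlgebra k ℕ+ →ₗ[k] FreeAlgebra k ℕ+ ⊗[k] FreeAlgebra k ℕ+ :=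
  LinearMap.applyₗ (1 ⊗ₜ[k] 1) ∘ₗ
    (FreeAlgebra.lift k fun m : ℕ+ => genCoprod q m).toLinearMap

@[simp] theorem qCoprod_one : qCoprod q 1 = 1 ⊗ₜ 1 := by simp [qCoprod]

@[simp] theorem qCoprod_ι_mul (m : ℕ+) (x : FreeAlgebra k ℕ+) :
    qCoprod q (FreeAlgebra.ι k m * x) = genCoprod q m (qCoprod q x) := by simp [qCoprod]

@[simp] theorem genCoprod_zero : genCoprod q 0 = 1 := by
  have : qTwist q 0 = AlgHom.id k (FreeAlgebra k ℕ+) := by ext m; simp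
  ext x y
  simp [genCoprod, this]

theorem qCoprod_gen_mul (n : ℕ) (x : FreeAlgebra k ℕ+) :
    qCoprod q (gen k n * x) = genCoprod q n (qCoprod q x) := by
  rcases n.eq_zero_or_pos with rfl | hn
  · simp
  · lift n to ℕ+ using hn
    simp

/-- The twisted derivation with `G_n ↦ G_{n-m}`, dual to the generator `G_m`. -/
def genDer (m : ℕ+) : FreeAlgebra k ℕ+ →ₗ[k] FreeAlgebra k ℕ+ :=
  twistDer (qTwist q m) (AlgHom.id k _) fun n => if m ≤ n then gen k ((n : ℕ) - m) else 0

theorem genDer_mul (m : ℕ+) (x y : FreeAlgebra k ℕ+) :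
    genDer q m (x * y) = genDer q m x * y + qTwist q m x * genDer q m y := by
  simp [genDer, twistDer_mul]

@[simp] theorem genDer_one (m : ℕ+) : genDer q m (1 : FreeAlgebra k ℕ+) = 0 := twistDer_one _ _ _

theorem genDer_gen (m : ℕ+) (n : ℕ) :
    genDer q m (gen k n) = if (m : ℕ) ≤ n then gen k (n - m) else 0 := by
  rcases n.eq_zero_or_pos with rfl | hn
  · simp
  · lift n to ℕ+ using hn
    rw [gen_coe, genDer, twistDer_ι]
    simp

theorem genDer_mem (m : ℕ+) {d : ℤ} {x : FreeAlgebra k ℕ+} (hx : x ∈ freeDegree d) :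
    genDer q m x ∈ freeDegree (d - m) := by
  refine wordSpan_induction (P := fun d x => genDer q m x ∈ freeDegree (d - m)) ?_
    (fun l d x hx ih => ?_) (by simp) (fun d x y hx hy => ?_) (fun d r x hx => ?_) hx
  · rw [genDer_one]; exact Submodule.zero_mem _
  · rw [genDer_mul]
    refine Submodule.add_mem _ ?_ ?_
    · rw [← gen_coe, genDer_gen]
      split_ifs with hml
      · have := mul_mem_wordSpan (gen_mem (k := k) ((l : ℕ) - m)) hx
        convert this using 2
        push_cast [hml]; ring
      · rw [zero_mul]; exact Submodule.zero_mem _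
    · rw [qTwist_ι, smul_mul_assoc, add_sub_assoc]
      exact Submodule.smul_mem _ _ (mul_mem_wordSpan (apply_mem_wordSpan l) ih)
  · rw [map_add]; exact Submodule.add_mem _ hx hy
  · rw [map_smul]; exact Submodule.smul_mem _ _ hx

theorem genDer_qTwist (m : ℕ+) (t : ℕ) (x : FreeAlgebra k ℕ+) :
    genDer q m (qTwist q t x) = q ^ ((m : ℕ) * t) • qTwist q t (genDer q m x) := by
  induction x using freeAlgebra_induction_left with
  | one => simp
  | add x y hx hy => simp [hx, hy]
  | smul r x hx => rw [map_smul, map_smul, hx, map_smul, map_smul, smul_comm]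
  | mul n x hx =>
    have h1 : q ^ ((n : ℕ) * t) • genDer q m (FreeAlgebra.ι k n) =
        q ^ ((m : ℕ) * t) • qTwist q t (genDer q m (FreeAlgebra.ι k n)) := by
      rw [← gen_coe, genDer_gen]
      split_ifs with hmn
      · rw [qTwist_of_mem q t _ (gen_mem _), smul_smul, ← pow_add, ← add_mul,
          Nat.add_sub_cancel' hmn]
      · simp
    rw [map_mul, genDer_mul, genDer_mul, map_add, map_mul, map_mul, hx, qTwist_comp q m t,
      qTwist_ι q t, map_smul, h1, smul_add, smul_mul_assoc, mul_smul_comm]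

theorem rTensor_genDer_genCoprod (m : ℕ+) (n : ℕ)
    (X : FreeAlgebra k ℕ+ ⊗[k] FreeAlgebra k ℕ+) :
    (genDer q m).rTensor _ (genCoprod q n X) =
      (if (m : ℕ) ≤ n then genCoprod q (n - m) X else 0) +
        q ^ ((n : ℕ) * m) • genCoprod q n ((genDer q m).rTensor _ X) := by
  induction X using TensorProduct.induction_on with
  | zero => simp
  | add x y hx hy =>
    rw [map_add, map_add, hx, hy, map_add, map_add, map_add, smul_add]
    split_ifs <;> abel
  | tmul c d =>
    simp only [genCoprod, LinearMap.sum_apply, qMulLeft_tmul, map_sum, LinearMap.rTensor_tmul,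
      genDer_mul, TensorProduct.add_tmul, Finset.sum_add_distrib, genDer_gen]
    congr 1
    · simp only [ite_mul, zero_mul, TensorProduct.ite_tmul]
      rw [← Finset.sum_filter]
      split_ifs with hmn
      · rw [Finset.Nat.antidiagonal_filter_le_fst_of_le hmn, Finset.sum_map]
        simp
      · refine Finset.sum_eq_zero fun p hp => ?_
        simp only [Finset.mem_filter, Finset.HasAntidiagonal.mem_antidiagonal] at hp
        omega
    · rw [Finset.smul_sum]
      refine Finset.sum_congr rfl fun p hp => ?_
      rw [Finset.HasAntidiagonal.mem_antidiagonal] at hp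
      rw [genDer_qTwist, qTwist_of_mem q _ _ (gen_mem _), smul_mul_smul_comm,
        ← TensorProduct.smul_tmul', ← pow_add, ← hp]
      congr 2
      ring

/-- The derivations `genDer` act on the first factor of the coproduct: this is coassociativity,
read off on the generators. -/
theorem rTensor_genDer_qCoprod (m : ℕ+) (x : FreeAlgebra k ℕ+) :
    (genDer q m).rTensor _ (qCoprod q x) = qCoprod q (genDer q m x) := by
  induction x using freeAlgebra_induction_left with
  | one => simp
  | add x y hx hy => simp [hx, hy]
  | smul r x hx => simp [hx]
  | mul n x hx =>
    rw [qCoprod_ι_mul, rTensor_genDer_genCoprod, genDer_mul, map_add, hx, qTwist_ι,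
      smul_mul_assoc, map_smul, qCoprod_ι_mul, ← gen_coe, genDer_gen]
    congr 1
    split_ifs
    · rw [qCoprod_gen_mul]
    · simp

/-- The augmentation. -/
def augmentation (k X : Type*) [Field k] : FreeAlgebra k X →ₐ[k] k := FreeAlgebra.lift k fun _ => 0

@[simp] theorem augmentation_ι {X : Type*} (m : X) :
    augmentation k X (FreeAlgebra.ι k m) = 0 := by simp [augmentation]

theorem augmentation_gen (n : ℕ) :
    augmentation k ℕ+ (gen k n) = if n = 0 then 1 else 0 := by
  rcases n.eq_zero_or_pos with rfl | hn
  · simp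
  · lift n to ℕ+ using hn
    simp

theorem counit_qCoprod (x : FreeAlgebra k ℕ+) :
    TensorProduct.lid k _ ((augmentation k ℕ+).toLinearMap.rTensor _ (qCoprod q x)) = x := by
  have hτ : ∀ t x, augmentation k ℕ+ (qTwist q t x) = augmentation k ℕ+ x := fun t x => by
    have : (augmentation k ℕ+).comp (qTwist q t) = augmentation k ℕ+ := by ext m; simp
    exact DFunLike.congr_fun this x
  have key : ∀ (n : ℕ) X,
      TensorProduct.lid k _ ((augmentation k ℕ+).toLinearMap.rTensor _ (genCoprod q n X)) =
      gen k n * TensorProduct.lid k _ ((augmentation k ℕ+).toLinearMap.rTensor _ X) := by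
    intro n X
    induction X using TensorProduct.induction_on with
    | zero => simp
    | add x y hx hy => rw [map_add, map_add, map_add, hx, hy, map_add, map_add, mul_add]
    | tmul c d =>
      simp only [genCoprod, LinearMap.sum_apply, qMulLeft_tmul, map_sum, LinearMap.rTensor_tmul,
        AlgHom.toLinearMap_apply, map_mul, hτ, augmentation_gen, TensorProduct.lid_tmul]
      rw [Finset.sum_eq_single (0, n)]
      · simp
      · rintro ⟨s, t⟩ hp hne
        rw [Finset.HasAntidiagonal.mem_antidiagonal] at hp
        rw [if_neg, zero_mul, zero_smul]
        rintro rfl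
        exact hne (by simpa using hp)
      · simp
  induction x using freeAlgebra_induction_left with
  | one => simp
  | add x y hx hy => simp [hx, hy]
  | smul r x hx => simp [hx]
  | mul n x hx => rw [qCoprod_ι_mul, key, hx, gen_coe]

/-- If the derivations have only the scalars as their common kernel, then together with the
augmentation they separate the first factors of tensors. -/
theorem eq_zero_of_rTensor_genDer_eq_zero
    (hker : ∀ x : FreeAlgebra k ℕ+, (∀ m, genDer q m x = 0) →
      x = algebraMap k _ (augmentation k ℕ+ x))
    {X : FreeAlgebra k ℕ+ ⊗[k] FreeAlgebra k ℕ+} (hX : ∀ m, (genDer q m).rTensor _ X = 0)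
    (h0 : (augmentation k ℕ+).toLinearMap.rTensor (FreeAlgebra k ℕ+) X = 0) : X = 0 := by
  classical
  let 𝓑 := Module.Basis.ofVectorSpace k (FreeAlgebra k ℕ+)
  have hcomm : ∀ {N : Type _} [AddCommGroup N] [Module k N] (f : FreeAlgebra k ℕ+ →ₗ[k] N) i X,
      TensorProduct.equivFinsuppOfBasisRight 𝓑 (f.rTensor _ X) i =
        f (TensorProduct.equivFinsuppOfBasisRight 𝓑 X i) := by
    intro N _ _ f i X
    induction X using TensorProduct.induction_on with
    | zero => simp
    | add x y hx hy => simp only [map_add, Finsupp.add_apply, hx, hy]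
    | tmul c d => simp
  apply (TensorProduct.equivFinsuppOfBasisRight 𝓑).injective
  ext1 i
  have h1 := hker (TensorProduct.equivFinsuppOfBasisRight 𝓑 X i)
    fun m => by rw [← hcomm, hX m]; simp
  have h2 := hcomm (augmentation k ℕ+).toLinearMap i X
  rw [h0] at h2
  rw [h1, ← AlgHom.toLinearMap_apply, ← h2]
  simp

end Primitive

/-! ### Primitive elements for generic `q` -/

section Generic

variable {k : Type*} [Field k] (q : k)

open Polynomial in
/-- For `q` generic there is, in each degree `l`, an element with leading term `G_l` which is dual
to the derivations. It is the component of `G_l` along the common kernel of the derivations of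
smaller index, in the decomposition defined by the elements of smaller degree. -/
theorem exists_dual_element (hq : ∀ p : ℤ[X], p.eval 0 = 1 → aeval q p ≠ 0) (l : ℕ+) :
    ∃ x : FreeAlgebra k ℕ+, x ∈ freeDegree ((l : ℕ) : ℤ) ∧
      x - FreeAlgebra.ι k l ∈ below k l ∧ ∀ m, genDer q m x = if m = l then 1 else 0 := by
  induction l using PNat.strongInductionOn with
  | _ l ih =>
    choose b hbdeg hbsub hbdual using ih
    have hsys : BosonSystem (Subtype.val : {m : ℕ+ // m < l} → ℕ+) q (freeDegree (k := k))
        (fun m => LinearMap.mulLeft k (b m m.2)) (fun m => genDer q m) :=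
      { inj := Subtype.val_injective
        W_neg := wordSpan_eq_bot fun _ => by positivity
        b_mem := fun m d u hu => by
          rw [add_comm]
          exact mul_mem_wordSpan (hbdeg m m.2) hu
        e_mem := fun m d u hu => genDer_mem q m hu
        comm := fun m n z => by
          simp only [LinearMap.mulLeft_apply]
          rw [genDer_mul, hbdual, qTwist_of_mem q m _ (hbdeg n n.2), smul_mul_assoc,
            mul_comm (n.1 : ℕ)]
          congr 1
          by_cases hmn : m = n
          · simp [hmn]
          · rw [if_neg hmn, if_neg (fun h => hmn (Subtype.ext h)), zero_mul] }
    obtain ⟨T, hT⟩ := hsys.exists_decompSystem_words hq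
    obtain ⟨z, hz, hsum⟩ := hT.exists_decomp
      (apply_mem_wordSpan (k := k) (g := FreeAlgebra.ι k) (h := fun m : ℕ+ => ((m : ℕ) : ℤ)) l)
    have hdeg : z [] ∈ freeDegree ((l : ℕ) : ℤ) := by simpa using (hz []).2
    have hsub : z [] - FreeAlgebra.ι k l ∈ below k l := by
      have h1 : FreeAlgebra.ι k l = z [] + ∑ c ∈ z.support.erase [],
          raise (fun m : {m : ℕ+ // m < l} => LinearMap.mulLeft k (b m m.2)) c (z c) := by
        rw [hsum, Finsupp.sum]
        by_cases h0 : [] ∈ z.support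
        · rw [← Finset.add_sum_erase _ _ h0, raise_nil]
        · rw [Finset.erase_eq_of_notMem h0, Finsupp.notMem_support_iff.mp h0, zero_add]
      rw [h1, sub_add_cancel_left]
      refine Subalgebra.neg_mem _ (Subalgebra.sum_mem _ fun c hc => ?_)
      have hb : ∀ m : {m : ℕ+ // m < l}, b m m.2 ∈ below k l := fun m => by
        rw [← sub_add_cancel (b m m.2) (FreeAlgebra.ι k m.1)]
        exact Subalgebra.add_mem _ (below_mono m.2.le (hbsub m m.2)) (ι_mem_below m.2)
      have hzc : z c ∈ below k l := by
        refine mem_below_of_mem_freeDegree ?_ (hz c).2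
        have : wordWeight Subtype.val c ≠ 0 := fun h =>
          (Finset.mem_erase.mp hc).1 (wordWeight_eq_zero h)
        omega
      clear hc
      generalize z c = y at hzc
      induction c with
      | nil => simpa using hzc
      | cons m c ihc => rw [raise_cons]; exact Subalgebra.mul_mem _ (hb m) ihc
    refine ⟨z [], hdeg, hsub, fun m => ?_⟩
    rcases lt_trichotomy m l with hm | rfl | hm
    · rw [if_neg hm.ne]
      exact (Submodule.mem_iInf _).mp (hz []).1 ⟨m, hm⟩
    · rw [if_pos rfl, ← sub_add_cancel (z []) (FreeAlgebra.ι k m), map_add, ← gen_coe,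
        genDer_gen, if_pos le_rfl, Nat.sub_self, gen_zero]
      rw [gen_coe]
      suffices ∀ y ∈ below k m, genDer q m y = 0 by rw [this _ hsub, zero_add]
      intro y hy
      induction hy using Algebra.adjoin_induction with
      | mem x hx =>
        obtain ⟨n, hn, rfl⟩ := hx
        rw [← gen_coe, genDer_gen, if_neg (by simpa using hn)]
      | algebraMap r => rw [Algebra.algebraMap_eq_smul_one, map_smul, genDer_one, smul_zero]
      | add x y _ _ hx hy => rw [map_add, hx, hy, add_zero]
      | mul x y _ _ hx hy => rw [genDer_mul, hx, hy, zero_mul, mul_zero, add_zero]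
    · rw [if_neg hm.ne']
      have := genDer_mem q m hdeg
      rw [freeDegree, wordSpan_eq_bot (fun _ => by positivity)] at this
      · exact (Submodule.mem_bot k).mp this
      · have : (l : ℕ) < m := hm
        omega

theorem adjoin_eq_top_of_sub_mem_below (b : ℕ+ → FreeAlgebra k ℕ+)
    (hb : ∀ l, b l - FreeAlgebra.ι k l ∈ below k l) : Algebra.adjoin k (Set.range b) = ⊤ := by
  have key : ∀ l, FreeAlgebra.ι k l ∈ Algebra.adjoin k (Set.range b) := by
    intro l
    induction l using PNat.strongInductionOn with
    | _ l ih =>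
      rw [← sub_sub_cancel (b l) (FreeAlgebra.ι k l)]
      refine Subalgebra.sub_mem _ (Algebra.subset_adjoin ⟨l, rfl⟩) ?_
      refine (Algebra.adjoin_le ?_ : below k l ≤ _) (hb l)
      rintro _ ⟨m, hm, rfl⟩
      exact ih m hm
  rw [eq_top_iff, ← FreeAlgebra.adjoin_range_ι]
  refine Algebra.adjoin_le ?_
  rintro _ ⟨l, rfl⟩
  exact key l

open Polynomial in
/-- For `q` generic the elements dual to the derivations are primitive. The words in these elements
span the free algebra, so that by uniqueness of decompositions only scalars are killed by all
derivations; and `δ(b) - b ⊗ 1 - 1 ⊗ b` is killed by all of them. -/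
theorem exists_primitive_of_generic (hq : ∀ p : ℤ[X], p.eval 0 = 1 → aeval q p ≠ 0) (l : ℕ+) :
    ∃ x : FreeAlgebra k ℕ+, x ∈ freeDegree ((l : ℕ) : ℤ) ∧
      x - FreeAlgebra.ι k l ∈ below k l ∧ qCoprod q x = x ⊗ₜ 1 + 1 ⊗ₜ x := by
  choose b hbdeg hbsub hbdual using exists_dual_element q hq
  have hsys : BosonSystem (id : ℕ+ → ℕ+) q (freeDegree (k := k))
      (fun m => LinearMap.mulLeft k (b m)) (fun m => genDer q m) :=
    { inj := Function.injective_id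
      W_neg := wordSpan_eq_bot fun _ => by positivity
      b_mem := fun m d u hu => by
        rw [add_comm]
        exact mul_mem_wordSpan (hbdeg m) hu
      e_mem := fun m d u hu => genDer_mem q m hu
      comm := fun m n z => by
        simp only [LinearMap.mulLeft_apply]
        rw [genDer_mul, hbdual, qTwist_of_mem q m _ (hbdeg n), smul_mul_assoc,
          mul_comm (n : ℕ)]
        congr 1
        by_cases hmn : m = n <;> simp [hmn] }
  obtain ⟨T, hT⟩ := hsys.exists_decompSystem_words hq
  have hker : ∀ x : FreeAlgebra k ℕ+, (∀ m, genDer q m x = 0) →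
      x = algebraMap k _ (augmentation k ℕ+ x) := by
    intro x hx
    obtain ⟨z, hz, hsum⟩ : ∃ z : List ℕ+ →₀ FreeAlgebra k ℕ+,
        (∀ c, ∃ r, z c = algebraMap k _ r) ∧
          x = z.sum fun c y => raise (fun m => LinearMap.mulLeft k (b m)) c y := by
      clear hx
      induction x using induction_of_adjoin_eq_top (adjoin_eq_top_of_sub_mem_below b hbsub) with
      | one =>
        refine ⟨Finsupp.single [] 1, fun c => ?_, by
          rw [Finsupp.sum_single_index]
          · rfl
          · exact map_zero _⟩
        rw [Finsupp.single_apply]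
        split_ifs
        · exact ⟨1, (map_one _).symm⟩
        · exact ⟨0, (map_zero _).symm⟩
      | zero => exact ⟨0, fun c => ⟨0, (map_zero _).symm⟩, Finsupp.sum_zero_index.symm⟩
      | add x y hx hy =>
        obtain ⟨z, hz, rfl⟩ := hx
        obtain ⟨z', hz', rfl⟩ := hy
        refine ⟨z + z', fun c => ?_, ?_⟩
        · obtain ⟨r, hr⟩ := hz c
          obtain ⟨r', hr'⟩ := hz' c
          exact ⟨r + r', by rw [Finsupp.add_apply, hr, hr', map_add]⟩
        · rw [Finsupp.sum_add_index' (fun c => map_zero _) (fun c x y => map_add _ _ _)]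
      | smul r x hx =>
        obtain ⟨z, hz, rfl⟩ := hx
        refine ⟨r • z, fun c => ?_, ?_⟩
        · obtain ⟨r', hr'⟩ := hz c
          exact ⟨r * r', by rw [Finsupp.smul_apply, hr', map_mul, ← Algebra.smul_def]⟩
        · rw [Finsupp.sum_smul_index' (fun c => map_zero _), Finsupp.smul_sum]
          simp only [map_smul]
      | mul m x hx =>
        obtain ⟨z, hz, rfl⟩ := hx
        have hinj : Function.Injective (List.cons m) := List.cons_injective
        refine ⟨z.embDomain ⟨List.cons m, hinj⟩, fun c => ?_, ?_⟩
        · by_cases hc : c ∈ Set.range (List.cons m)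
          · obtain ⟨c, rfl⟩ := hc
            obtain ⟨r, hr⟩ := hz c
            exact ⟨r, by rw [← hr]; exact Finsupp.embDomain_apply_self ⟨_, hinj⟩ z c⟩
          · exact ⟨0, by rw [map_zero]; exact Finsupp.embDomain_of_notMem_range ⟨_, hinj⟩ z c hc⟩
        · rw [Finsupp.sum_embDomain, Finsupp.mul_sum]
          simp
    have hone : ∀ m, genDer q m (1 : FreeAlgebra k ℕ+) = 0 := genDer_one q
    have heq : Finsupp.single [] x = z := by
      refine hT.unique (fun c => ?_) (fun c => ?_) ?_
      · rw [Finsupp.single_apply]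
        split_ifs
        · exact (Submodule.mem_iInf _).mpr hx
        · exact Submodule.zero_mem _
      · obtain ⟨r, hr⟩ := hz c
        rw [hr, Algebra.algebraMap_eq_smul_one]
        exact Submodule.smul_mem _ _ ((Submodule.mem_iInf _).mpr hone)
      · rw [← hsum]
        exact Finsupp.sum_single_index (by exact map_zero _)
    obtain ⟨r, hr⟩ := hz []
    rw [← heq, Finsupp.single_eq_same] at hr
    rw [hr, AlgHom.commutes, Algebra.algebraMap_self_apply]
  refine ⟨b l, hbdeg l, hbsub l, ?_⟩
  have haug : augmentation k ℕ+ (b l) = 0 := by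
    have : ∀ x ∈ freeDegree ((l : ℕ) : ℤ), augmentation k ℕ+ x = 0 := fun x hx => by
      refine Submodule.span_induction (p := fun x _ => augmentation k ℕ+ x = 0) ?_
        (map_zero _) (fun x y _ _ hx hy => by rw [map_add, hx, hy, add_zero])
        (fun r x _ hx => by rw [map_smul, hx, smul_zero]) hx
      rintro _ ⟨s, hs, rfl⟩
      cases s with
      | nil =>
        have := l.pos
        simp only [List.map_nil, List.sum_nil] at hs
        omega
      | cons m s => simp
    exact this _ (hbdeg l)
  rw [← sub_eq_zero]
  refine eq_zero_of_rTensor_genDer_eq_zero q hker (fun m => ?_) ?_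
  · rw [map_sub, map_add, rTensor_genDer_qCoprod, hbdual]
    simp only [LinearMap.rTensor_tmul, genDer_one, hbdual]
    split_ifs <;> simp
  · apply (TensorProduct.lid k (FreeAlgebra k ℕ+)).injective
    rw [map_sub, map_sub, counit_qCoprod]
    simp [haug]

end Generic

/-! ### Primitive elements for `q = 1` -/

section PowerSums

variable {k : Type*} [Field k]

/-- At `q = 1` the coproduct is an algebra homomorphism to the ordinary tensor square. -/
def oneCoprod (k : Type*) [Field k] :
    FreeAlgebra k ℕ+ →ₐ[k] FreeAlgebra k ℕ+ ⊗[k] FreeAlgebra k ℕ+ :=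
  FreeAlgebra.lift k fun m : ℕ+ =>
    ∑ p ∈ Finset.HasAntidiagonal.antidiagonal (m : ℕ), gen k p.1 ⊗ₜ gen k p.2

theorem oneCoprod_gen (n : ℕ) : oneCoprod k (gen k n) =
    ∑ p ∈ Finset.HasAntidiagonal.antidiagonal n, gen k p.1 ⊗ₜ gen k p.2 := by
  rcases n.eq_zero_or_pos with rfl | hn
  · simp [Algebra.TensorProduct.one_def]
  · lift n to ℕ+ using hn
    simp [oneCoprod]

theorem qCoprod_one_eq (x : FreeAlgebra k ℕ+) : qCoprod (1 : k) x = oneCoprod k x := by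
  have hτ : ∀ t, qTwist (1 : k) t = AlgHom.id k (FreeAlgebra k ℕ+) := fun t => by ext m; simp
  induction x using freeAlgebra_induction_left with
  | one => simp [Algebra.TensorProduct.one_def]
  | add x y hx hy => simp [hx, hy]
  | smul r x hx => simp [hx]
  | mul n x hx =>
    rw [qCoprod_ι_mul, hx, map_mul, ← gen_coe, oneCoprod_gen]
    generalize oneCoprod k x = X
    induction X using TensorProduct.induction_on with
    | zero => simp
    | add x y hx hy => rw [map_add, hx, hy, mul_add]
    | tmul c d => simp [genCoprod, hτ, Finset.sum_mul]

/-- The Euler derivation `t d/dt` of power series. -/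
def euler {R : Type*} [Ring R] (f : PowerSeries R) : PowerSeries R :=
  PowerSeries.mk fun n => n • PowerSeries.coeff n f

theorem euler_mul {R : Type*} [Ring R] (f g : PowerSeries R) :
    euler (f * g) = euler f * g + f * euler g := by
  ext n
  simp only [euler, PowerSeries.coeff_mk, PowerSeries.coeff_mul, map_add, Finset.smul_sum,
    ← Finset.sum_add_distrib]
  refine Finset.sum_congr rfl fun p hp => ?_
  rw [← Finset.HasAntidiagonal.mem_antidiagonal.mp hp, add_smul, smul_mul_assoc, mul_smul_comm]

theorem euler_map {R S : Type*} [Ring R] [Ring S] (φ : R →+* S) (f : PowerSeries R) :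
    euler (PowerSeries.map φ f) = PowerSeries.map φ (euler f) := by
  ext n
  simp [euler]

theorem commute_map {R S : Type*} [Ring R] [Ring S] {φ χ : R →+* S}
    (h : ∀ a b, Commute (φ a) (χ b)) (f g : PowerSeries R) :
    PowerSeries.map φ f * PowerSeries.map χ g = PowerSeries.map χ g * PowerSeries.map φ f := by
  ext n
  simp only [PowerSeries.coeff_mul, PowerSeries.coeff_map]
  rw [← Finset.Nat.sum_antidiagonal_swap]
  exact Finset.sum_congr rfl fun p _ => h _ _

/-- The case `q = 1`. Writing `σ` for the generating series of the `G_n`, which is group-like,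
the coefficients of its logarithmic derivative `ψ = σ⁻¹ * t dσ/dt` are primitive. -/
theorem exists_primitive_of_one [CharZero k] (l : ℕ+) :
    ∃ x : FreeAlgebra k ℕ+, x ∈ freeDegree ((l : ℕ) : ℤ) ∧
      x - FreeAlgebra.ι k l ∈ below k l ∧ qCoprod (1 : k) x = x ⊗ₜ 1 + 1 ⊗ₜ x := by
  let σ : PowerSeries (FreeAlgebra k ℕ+) := PowerSeries.mk (gen k)
  obtain ⟨ψ, hσψ⟩ : ∃ ψ, euler σ = σ * ψ := ⟨PowerSeries.invOfUnit σ 1 * euler σ, by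
    rw [← mul_assoc, PowerSeries.mul_invOfUnit σ 1 (by simp [σ]), one_mul]⟩
  have hcoeff : ∀ n, n • gen k n =
      ∑ p ∈ Finset.HasAntidiagonal.antidiagonal n, gen k p.1 * PowerSeries.coeff p.2 ψ :=
    fun n => by
      have := congrArg (PowerSeries.coeff n) hσψ
      simpa [euler, σ, PowerSeries.coeff_mul] using this
  have hrec : ∀ n, PowerSeries.coeff n ψ =
      n • gen k n - ∑ j ∈ Finset.range n, gen k (n - j) * PowerSeries.coeff j ψ := fun n => by
    rw [hcoeff, ← Finset.Nat.sum_antidiagonal_swap,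
      Finset.Nat.sum_antidiagonal_eq_sum_range_succ_mk, Finset.sum_range_succ]
    simp
  have hdeg : ∀ n : ℕ, PowerSeries.coeff n ψ ∈ freeDegree (n : ℤ) := by
    intro n
    induction n using Nat.strong_induction_on with
    | _ n ih =>
      rw [hrec]
      refine Submodule.sub_mem _ (Submodule.smul_of_tower_mem _ n (gen_mem n))
        (Submodule.sum_mem _ fun j hj => ?_)
      have hj := Finset.mem_range.mp hj
      have := mul_mem_wordSpan (gen_mem (k := k) (n - j)) (ih j hj)
      convert this using 2
      push_cast [hj.le]; ring
  have hprim : PowerSeries.map (oneCoprod k).toRingHom ψ =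
      PowerSeries.map (Algebra.TensorProduct.includeLeft : _ →ₐ[k] _ ⊗[k] _).toRingHom ψ +
      PowerSeries.map (Algebra.TensorProduct.includeRight : _ →ₐ[k] _ ⊗[k] _).toRingHom ψ := by
    set φ₁ := (Algebra.TensorProduct.includeLeft :
      FreeAlgebra k ℕ+ →ₐ[k] FreeAlgebra k ℕ+ ⊗[k] FreeAlgebra k ℕ+).toRingHom with h1
    set φ₂ := (Algebra.TensorProduct.includeRight :
      FreeAlgebra k ℕ+ →ₐ[k] FreeAlgebra k ℕ+ ⊗[k] FreeAlgebra k ℕ+).toRingHom with h2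
    have hcomm : ∀ a b, Commute (φ₁ a) (φ₂ b) := fun a b => by simp [h1, h2, Commute, SemiconjBy]
    have hΔ : PowerSeries.map (oneCoprod k).toRingHom σ =
        PowerSeries.map φ₁ σ * PowerSeries.map φ₂ σ := by
      ext n
      have := oneCoprod_gen (k := k) n
      simpa [PowerSeries.coeff_mul, σ, h1, h2] using this
    have hD : PowerSeries.map (oneCoprod k).toRingHom σ *
        PowerSeries.map (oneCoprod k).toRingHom ψ = PowerSeries.map (oneCoprod k).toRingHom σ *
          (PowerSeries.map φ₁ ψ + PowerSeries.map φ₂ ψ) := by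
      rw [← map_mul, ← hσψ, ← euler_map, hΔ, euler_mul, euler_map, euler_map, hσψ, map_mul,
        map_mul, mul_add, mul_assoc, commute_map hcomm ψ σ, mul_assoc, mul_assoc]
    have hinv := PowerSeries.invOfUnit_mul (PowerSeries.map (oneCoprod k).toRingHom σ) 1
      (by rw [← PowerSeries.coeff_zero_eq_constantCoeff_apply]; simp [σ])
    have := congrArg (PowerSeries.invOfUnit (PowerSeries.map (oneCoprod k).toRingHom σ) 1 * ·) hD
    simpa only [← mul_assoc, hinv, one_mul] using this
  have hl : (l : k) ≠ 0 := by exact_mod_cast l.pos.ne'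
  refine ⟨(l : k)⁻¹ • PowerSeries.coeff l ψ, Submodule.smul_mem _ _ (hdeg l), ?_, ?_⟩
  · rw [hrec, smul_sub, gen_coe, ← Nat.cast_smul_eq_nsmul k, inv_smul_smul₀ hl, sub_sub_cancel_left]
    refine Subalgebra.neg_mem _ (Subalgebra.smul_mem _ (Subalgebra.sum_mem _ fun j hj => ?_) _)
    have hj := Finset.mem_range.mp hj
    rcases j.eq_zero_or_pos with rfl | hj0
    · have : PowerSeries.coeff 0 ψ = 0 := by simpa using hrec 0
      rw [this, mul_zero]
      exact Subalgebra.zero_mem _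
    · refine Subalgebra.mul_mem _ (mem_below_of_mem_freeDegree ?_ (gen_mem _))
        (mem_below_of_mem_freeDegree ?_ (hdeg j))
      · push_cast [hj.le]; omega
      · exact_mod_cast hj
  · have := congrArg (PowerSeries.coeff (l : ℕ)) hprim
    simp only [PowerSeries.coeff_map, map_add] at this
    rw [qCoprod_one_eq, map_smul]
    have h3 : oneCoprod k (PowerSeries.coeff (l : ℕ) ψ) = PowerSeries.coeff (l : ℕ) ψ ⊗ₜ 1 +
      1 ⊗ₜ PowerSeries.coeff (l : ℕ) ψ := this
    rw [h3, smul_add, TensorProduct.smul_tmul', TensorProduct.tmul_smul]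

end PowerSums

/-! ### Existence of Bozec's elements -/

section Bozec

variable {V : Type u} [Quiver.{w + 1} V]

theorem v_ne_zero : v ≠ 0 := RatFunc.X_ne_zero

theorem form_single (i j : V) (a c : ℤ) :
    form (Finsupp.single i a) (Finsupp.single j c) = a * c * vertexForm i j := by
  simp [form]

theorem form_add_left (x y z : V →₀ ℤ) : form (x + y) z = form x z + form y z := by
  unfold form
  rw [Finsupp.sum_add_index' (by simp)]
  intro i a c
  rw [← Finsupp.sum_add]
  simp only [add_mul]

theorem form_add_right (x y z : V →₀ ℤ) : form x (y + z) = form x y + form x z := by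
  unfold form
  rw [← Finsupp.sum_add]
  refine Finsupp.sum_congr fun i _ => ?_
  rw [Finsupp.sum_add_index' (by simp)]
  intro j a c
  ring

@[simp] theorem form_zero_right (x : V →₀ ℤ) : form x 0 = 0 := by simp [form]

@[simp] theorem form_zero_left (x : V →₀ ℤ) : form 0 x = 0 := by simp [form]

@[simp] theorem form_neg_left (x y : V →₀ ℤ) : form (-x) y = -form x y := by
  rw [eq_neg_iff_add_eq_zero, ← form_add_left, neg_add_cancel, form_zero_left]

@[simp] theorem form_neg_right (x y : V →₀ ℤ) : form x (-y) = -form x y := by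
  rw [eq_neg_iff_add_eq_zero, ← form_add_right, neg_add_cancel, form_zero_right]

theorem coprod_ι_mul (κ : IInf V) (x : FreeU V) :
    coprod (freeF κ * x) = coprodGen κ (coprod x) := by simp [coprod]

theorem coprod_one : coprod (1 : FreeU V) = 1 ⊗ₜ 1 := by simp [coprod]

theorem twist_freeF (β : V →₀ ℤ) (κ : IInf V) :
    twist β (freeF κ) = v ^ form β (-κ.weight) • freeF κ := by simp [twist]

/-- `v_i = v^{1 - ω_i}`. -/
def vi (i : V) : Kv := v ^ (1 - (loops i : ℤ))

theorem vi_ne_zero (i : V) : vi i ≠ 0 := zpow_ne_zero _ v_ne_zero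

/-- The scalar by which `F_{i,n}` is rescaled, so that the powers of `v_i` in its coproduct are
absorbed. -/
def rescale (i : V) (n : ℕ) : Kv := (vi i ^ (n.choose 2))⁻¹

theorem rescale_ne_zero (i : V) (n : ℕ) : rescale i n ≠ 0 :=
  inv_ne_zero (pow_ne_zero _ (vi_ne_zero i))

theorem rescale_mul (i : V) (s t : ℕ) :
    rescale i s * rescale i t = rescale i (s + t) * vi i ^ (s * t) := by
  have h : (s + t).choose 2 = s.choose 2 + t.choose 2 + s * t := by
    rw [Nat.add_choose_eq]
    simp [Finset.Nat.antidiagonal_succ]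
    ring
  have h0 := vi_ne_zero i
  rw [rescale, rescale, rescale, h, pow_add, pow_add]
  field_simp

/-- The homomorphism from the free algebra on `ℕ+` onto the subalgebra generated by the `F_{i,l}`.
It rescales the generators so as to respect the coproducts, with `q = v_i ^ 2`. -/
def vertexHom (i : V) (hi : IsImagVertex i) : FreeAlgebra Kv ℕ+ →ₐ[Kv] FreeU V :=
  FreeAlgebra.lift Kv fun m => rescale i m • freeF (.im i hi m)

theorem vertexHom_gen (i : V) (hi : IsImagVertex i) (n : ℕ) :
    vertexHom i hi (gen Kv n) = rescale i n • freeF₀ i hi n := by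
  rcases n.eq_zero_or_pos with rfl | hn
  · simp [rescale, freeF₀]
  · lift n to ℕ+ using hn
    rw [gen_coe, vertexHom, FreeAlgebra.lift_ι_apply, freeF₀, dif_pos n.pos]
    rfl

theorem vertexForm_self (i : V) : vertexForm i i = 2 - 2 * (loops i : ℤ) := if_pos rfl

theorem twist_vertexHom (i : V) (hi : IsImagVertex i) (t : ℕ) (x : FreeAlgebra Kv ℕ+) :
    twist (-Finsupp.single i (t : ℤ)) (vertexHom i hi x) =
      vertexHom i hi (qTwist (vi i ^ 2) t x) := by
  have : (twist (-Finsupp.single i (t : ℤ))).comp (vertexHom i hi) =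
      (vertexHom i hi).comp (qTwist (vi i ^ 2) t) := by
    ext m
    have h : v ^ form (-Finsupp.single i (t : ℤ)) (-(IInf.im i hi m).weight) =
        (vi i ^ 2) ^ ((m : ℕ) * t) := by
      rw [form_neg_left, form_neg_right, neg_neg, IInf.weight, form_single, vertexForm_self, vi,
        ← zpow_natCast, ← zpow_natCast, ← zpow_mul, ← zpow_mul]
      congr 1
      push_cast
      ring
    simp only [AlgHom.comp_apply, Function.comp_apply, vertexHom, FreeAlgebra.lift_ι_apply,
      map_smul, twist_freeF, h, qTwist_ι]
    rw [smul_comm]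
  exact DFunLike.congr_fun this x

theorem coprodGen_vertexHom (i : V) (hi : IsImagVertex i) (n : ℕ+)
    (X : FreeAlgebra Kv ℕ+ ⊗[Kv] FreeAlgebra Kv ℕ+) :
    TensorProduct.map (vertexHom i hi).toLinearMap (vertexHom i hi).toLinearMap
        (genCoprod (vi i ^ 2) n X) =
      rescale i n • coprodGen (.im i hi n)
        (TensorProduct.map (vertexHom i hi).toLinearMap (vertexHom i hi).toLinearMap X) := by
  induction X using TensorProduct.induction_on with
  | zero => simp
  | add x y hx hy => simp only [map_add, hx, hy, smul_add]
  | tmul c d =>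
    simp only [genCoprod, coprodGen, LinearMap.sum_apply, map_sum, Finset.smul_sum,
      LinearMap.smul_apply, twistedMulLeft, TensorProduct.map_tmul, LinearMap.comp_apply,
      LinearMap.mulLeft_apply, AlgHom.toLinearMap_apply, map_mul, qMulLeft_tmul, vertexHom_gen]
    refine Finset.sum_congr rfl fun p hp => ?_
    rw [twist_vertexHom, smul_smul, ← Finset.HasAntidiagonal.mem_antidiagonal.mp hp,
      smul_mul_assoc, smul_mul_assoc, TensorProduct.tmul_smul, TensorProduct.smul_tmul', smul_smul,
      mul_comm (rescale i p.2), rescale_mul, vi, ← zpow_natCast, ← zpow_mul]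
    push_cast
    rfl

theorem coprod_vertexHom (i : V) (hi : IsImagVertex i) (x : FreeAlgebra Kv ℕ+) :
    coprod (vertexHom i hi x) =
      TensorProduct.map (vertexHom i hi).toLinearMap (vertexHom i hi).toLinearMap
        (qCoprod (vi i ^ 2) x) := by
  induction x using freeAlgebra_induction_left with
  | one => simp [coprod_one]
  | add x y hx hy => simp [hx, hy]
  | smul r x hx => simp [hx]
  | mul n x hx =>
    rw [qCoprod_ι_mul, coprodGen_vertexHom, ← hx, ← coprod_ι_mul, map_mul, ← map_smul,
      ← smul_mul_assoc]
    simp [vertexHom]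

open Polynomial in
/-- If there are at least two loops, `v_i ^ 2` is a negative power of `v`, hence transcendental. -/
theorem generic_vi_sq {i : V} (hi : 1 < loops i) (p : ℤ[X]) (hp : p.eval 0 = 1) :
    p.eval₂ (Int.castRingHom Kv) (vi i ^ 2) ≠ 0 := by
  have h1 : vi i ^ 2 = (v⁻¹) ^ (2 * (loops i - 1)) := by
    rw [vi, ← zpow_natCast, ← zpow_natCast, ← zpow_mul, inv_zpow']
    congr 1
    push_cast [hi.le]
    ring
  have h2 : Transcendental ℂ (vi i ^ 2) := by
    rw [h1]
    refine Transcendental.pow ?_ (by omega)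
    intro h
    exact RatFunc.transcendental_X (K := ℂ) (by simpa [v] using h.inv)
  intro h0
  have hp0 : p.map (Int.castRingHom ℂ) ≠ 0 := by
    intro h
    have := congrArg (eval 0) h
    rw [eval_zero, ← map_zero (Int.castRingHom ℂ), eval_map_apply, hp] at this
    simp at this
  refine h2 ⟨p.map (Int.castRingHom ℂ), hp0, ?_⟩
  rw [aeval_def, eval₂_map, ← h0]
  congr 1
  exact RingHom.ext_int _ _

theorem loops_pos {i : V} (hi : IsImagVertex i) : 0 < loops i := Nat.pos_of_ne_zero hi

theorem exists_primitive_vertex (i : V) (hi : IsImagVertex i) (l : ℕ+) :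
    ∃ x : FreeAlgebra Kv ℕ+, x ∈ freeDegree ((l : ℕ) : ℤ) ∧
      x - FreeAlgebra.ι Kv l ∈ below Kv l ∧ qCoprod (vi i ^ 2) x = x ⊗ₜ 1 + 1 ⊗ₜ x := by
  rcases (Nat.succ_le_of_lt (loops_pos hi)).eq_or_lt with h | h
  · have : vi i ^ 2 = 1 := by
      rw [vi, ← h]; simp
    rw [this]
    exact exists_primitive_of_one l
  · exact exists_primitive_of_generic _ (fun p hp => generic_vi_sq h p hp) l

theorem proj_vertexHom_mem (i : V) (hi : IsImagVertex i) {d : ℤ} {x : FreeAlgebra Kv ℕ+}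
    (hx : x ∈ freeDegree d) :
    proj V (vertexHom i hi x) ∈ degreePart (-Finsupp.single i d) := by
  refine wordSpan_induction (P := fun d x => proj V (vertexHom i hi x) ∈
    degreePart (-Finsupp.single i d)) ?_ (fun m d x _ ih => ?_) (fun d => ?_)
    (fun d x y hx hy => ?_) (fun d r x hx => ?_) hx
  · rw [map_one, map_one, Finsupp.single_zero, neg_zero]
    exact one_mem_wordSpan (k := Kv) (g := F) (h := fun ι : IInf V => -ι.weight)
  · rw [map_mul, map_mul, Finsupp.single_add, neg_add]
    refine mul_mem_wordSpan (k := Kv) (g := F) (h := fun ι : IInf V => -ι.weight) ?_ ih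
    rw [vertexHom, FreeAlgebra.lift_ι_apply, map_smul]
    exact Submodule.smul_mem _ _
      (apply_mem_wordSpan (k := Kv) (g := F) (h := fun ι : IInf V => -ι.weight) (.im i hi m))
  · rw [map_zero, map_zero]; exact Submodule.zero_mem _
  · rw [map_add, map_add]; exact Submodule.add_mem _ hx hy
  · rw [map_smul, map_smul]; exact Submodule.smul_mem _ _ hx

theorem proj_vertexHom_mem_adjoin (i : V) (hi : IsImagVertex i) {l : ℕ+}
    {x : FreeAlgebra Kv ℕ+} (hx : x ∈ below Kv l) :
    proj V (vertexHom i hi x) ∈ Algebra.adjoin Kv {x | ∃ k : ℕ+, k < l ∧ x = F (.im i hi k)} := by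
  have : below Kv l ≤ (Algebra.adjoin Kv {x | ∃ k : ℕ+, k < l ∧ x = F (.im i hi k)}).comap
      ((proj V).comp (vertexHom i hi)) := by
    refine Algebra.adjoin_le ?_
    rintro _ ⟨m, hm, rfl⟩
    change proj V (vertexHom i hi (FreeAlgebra.ι Kv m)) ∈
      Algebra.adjoin Kv {x | ∃ k : ℕ+, k < l ∧ x = F (.im i hi k)}
    rw [vertexHom, FreeAlgebra.lift_ι_apply, map_smul]
    refine Subalgebra.smul_mem _ (Algebra.subset_adjoin ?_) _
    exact ⟨m, hm, rfl⟩
  exact this hx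

theorem exists_isBozecElement (i : V) (hi : IsImagVertex i) (l : ℕ+) :
    ∃ b, IsBozecElement i hi l b := by
  obtain ⟨x, hdeg, hsub, hprim⟩ := exists_primitive_vertex i hi l
  have h0 := rescale_ne_zero i l
  set y := (rescale i l)⁻¹ • x with hy
  have hF : F (.im i hi l) =
      proj V (vertexHom i hi ((rescale i l)⁻¹ • FreeAlgebra.ι Kv l)) := by
    rw [map_smul, vertexHom, FreeAlgebra.lift_ι_apply, inv_smul_smul₀ h0]
    rfl
  have hyprim : qCoprod (vi i ^ 2) y = y ⊗ₜ 1 + 1 ⊗ₜ y := by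
    rw [hy, map_smul, hprim, smul_add, TensorProduct.smul_tmul', TensorProduct.tmul_smul]
  refine ⟨proj V (vertexHom i hi y), ⟨?_, ?_, vertexHom i hi y, rfl, ?_⟩⟩
  · exact proj_vertexHom_mem i hi (Submodule.smul_mem _ _ hdeg)
  · rw [hF, ← map_sub, ← map_sub, hy, ← smul_sub]
    exact proj_vertexHom_mem_adjoin i hi (Subalgebra.smul_mem _ hsub _)
  · rw [coprod_vertexHom, hyprim, map_add, map_add]
    simp only [TensorProduct.map_tmul, AlgHom.toLinearMap_apply, map_one]

/-- The elements `b_{i,l}` are Bozec's elements. -/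
theorem isBozecElement_b (i : V) (hi : IsImagVertex i) (l : ℕ+) :
    IsBozecElement i hi l (b (.im i hi l)) :=
  Classical.epsilon_spec (exists_isBozecElement i hi l)

end Bozec

/-! ### The quantum Serre relations as iterated `q`-commutators -/

section Serre

variable {A : Type*} [Ring A] [Algebra Kv A]

/-- The iterated `q`-commutator obtained from `y` by applying, for `s = 0, …, m - 1`, the operators
`z ↦ z x - v ^ (a + 2 s) x z`. -/
def qAd (x : A) (a : ℤ) : ℕ → A → A
  | 0, y => y
  | m + 1, y => qAd x a m y * x - v ^ (a + 2 * m) • (x * qAd x a m y)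

theorem qAd_zero (x : A) (a : ℤ) (m : ℕ) : qAd x a m 0 = 0 := by
  induction m with
  | zero => rfl
  | succ m ih => simp [qAd, ih]

theorem qAd_smul (x : A) (a : ℤ) (m : ℕ) (r s : Kv) (y : A) :
    qAd (r • x) a m (s • y) = (r ^ m * s) • qAd x a m y := by
  induction m with
  | zero => simp [qAd]
  | succ m ih =>
    rw [qAd, ih, qAd, smul_sub, smul_mul_smul_comm, smul_mul_smul_comm,
      smul_comm (v ^ (a + 2 * (m : ℤ))) (r * (r ^ m * s))]
    congr 2 <;> ring

theorem map_qAd {B : Type*} [Ring B] [Algebra Kv B] (f : A →ₐ[Kv] B) (x : A) (a : ℤ) (m : ℕ)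
    (y : A) : f (qAd x a m y) = qAd (f x) a m (f y) := by
  induction m with
  | zero => rfl
  | succ m ih => rw [qAd, map_sub, map_smul, map_mul, map_mul, ih, qAd]

/-- The operators composing an iterated `q`-commutator commute, so that the last ones may be
applied first. -/
theorem qAd_add (x : A) (a : ℤ) (m m' : ℕ) (y : A) :
    qAd x a (m + m') y = qAd x a m (qAd x (a + 2 * m) m' y) := by
  have hcomm : ∀ (c : Kv) m y, qAd x a m (y * x - c • (x * y)) =
      qAd x a m y * x - c • (x * qAd x a m y) := by
    intro c m y
    induction m with
    | zero => rfl
    | succ m ih =>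
      simp only [qAd, ih]
      generalize qAd x a m y = z
      simp only [sub_mul, mul_sub, smul_sub, smul_mul_assoc, mul_smul_comm, mul_assoc]
      rw [smul_comm c]
      abel
  induction m' with
  | zero => rfl
  | succ m' ih =>
    rw [← add_assoc, qAd, ih, qAd, hcomm]
    push_cast
    rw [mul_add, add_assoc]

theorem v_sub_inv_ne_zero {n : ℕ} (hn : 0 < n) : v ^ (n : ℤ) - v ^ (-(n : ℤ)) ≠ 0 := by
  intro h
  have h1 : v ^ (2 * n) = 1 := by
    have h2 : v ^ (n : ℤ) = v ^ (-(n : ℤ)) := sub_eq_zero.mp h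
    have h3 := congrArg (· * v ^ (n : ℤ)) h2
    simp only [← zpow_add₀ v_ne_zero, neg_add_cancel, zpow_zero] at h3
    rw [← h3, ← zpow_natCast]
    congr 1
    push_cast; ring
  refine (RatFunc.transcendental_X (K := ℂ)).pow (n := 2 * n) (by omega) ?_
  rw [show RatFunc.X ^ (2 * n) = (1 : Kv) from h1]
  exact isAlgebraic_one

theorem qInt_zero : qInt 0 = 0 := by simp [qInt]

theorem qInt_ne_zero {n : ℕ} (hn : 0 < n) : qInt n ≠ 0 := by
  refine div_ne_zero (v_sub_inv_ne_zero hn) ?_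
  simpa using v_sub_inv_ne_zero one_pos

theorem qInt_add (s t : ℕ) :
    qInt (s + t) = v ^ (-(s : ℤ)) * qInt t + v ^ (t : ℤ) * qInt s := by
  unfold qInt
  rw [← mul_div_assoc, ← mul_div_assoc, ← add_div, mul_sub, mul_sub]
  simp only [← zpow_add₀ v_ne_zero]
  congr 1
  push_cast
  rw [show -((s : ℤ) + t) = -s + -t by ring, show (s : ℤ) + t = t + s by ring,
    show -(s : ℤ) + t = t + -s by ring]
  ring

theorem qFactorial_succ (n : ℕ) : qFactorial (n + 1) = qFactorial n * qInt (n + 1) := by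
  rw [qFactorial, Finset.prod_Icc_succ_top (by omega), qFactorial]

theorem qFactorial_ne_zero (n : ℕ) : qFactorial n ≠ 0 :=
  Finset.prod_ne_zero_iff.mpr fun k hk => qInt_ne_zero (by simp at hk; omega)

theorem divPow_mul_self (x : A) (n : ℕ) : divPow x n * x = qInt (n + 1) • divPow x (n + 1) := by
  have := qInt_ne_zero n.succ_pos
  rw [divPow, divPow, smul_mul_assoc, ← pow_succ, smul_smul, qFactorial_succ]
  congr 1
  field_simp

theorem self_mul_divPow (x : A) (n : ℕ) : x * divPow x n = qInt (n + 1) • divPow x (n + 1) := by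
  rw [← divPow_mul_self, divPow, mul_smul_comm, smul_mul_assoc, ← pow_succ, ← pow_succ']

/-- The `q`-binomial theorem for the commuting operators of left and right multiplication by `x`. -/
theorem sum_divPow_eq_qAd (x : A) (a : ℤ) (y : A) (m : ℕ) :
    ∑ p ∈ Finset.HasAntidiagonal.antidiagonal m, ((-1) ^ p.1 * v ^ ((a + m - 1) * p.1)) •
      (divPow x p.1 * y * divPow x p.2) = (qFactorial m)⁻¹ • qAd x a m y := by
  induction m with
  | zero => simp [qAd, divPow, qFactorial]
  | succ m ih =>
    have hm : qInt (m + 1) ≠ 0 := qInt_ne_zero m.succ_pos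
    have h1 : (qFactorial (m + 1))⁻¹ • qAd x a (m + 1) y =
        (qInt (m + 1))⁻¹ • (((qFactorial m)⁻¹ • qAd x a m y) * x -
          v ^ (a + 2 * m) • (x * ((qFactorial m)⁻¹ • qAd x a m y))) := by
      rw [qAd, qFactorial_succ, mul_inv_rev, mul_smul, smul_mul_assoc, mul_smul_comm,
        smul_comm (v ^ (a + 2 * (m : ℤ))), ← smul_sub]
    have hf : ((qFactorial m)⁻¹ • qAd x a m y) * x =
        ∑ p ∈ Finset.HasAntidiagonal.antidiagonal (m + 1),
          ((-1) ^ p.1 * v ^ ((a + m - 1) * p.1) * qInt p.2) •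
            (divPow x p.1 * y * divPow x p.2) := by
      rw [Finset.Nat.sum_antidiagonal_succ', ← ih, Finset.sum_mul]
      simp only [qInt_zero, mul_zero, zero_smul, zero_add, smul_mul_assoc, mul_assoc,
        divPow_mul_self, mul_smul_comm, smul_smul]
    have hg : x * ((qFactorial m)⁻¹ • qAd x a m y) =
        ∑ p ∈ Finset.HasAntidiagonal.antidiagonal (m + 1),
          (-((-1) ^ p.1) * v ^ ((a + m - 1) * (p.1 - 1)) * qInt p.1) •
            (divPow x p.1 * y * divPow x p.2) := by
      rw [Finset.Nat.sum_antidiagonal_succ, ← ih, Finset.mul_sum]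
      simp only [qInt_zero, mul_zero, zero_smul, zero_add, mul_smul_comm, ← mul_assoc,
        self_mul_divPow, smul_mul_assoc, smul_smul]
      refine Finset.sum_congr rfl fun p _ => ?_
      rw [pow_succ]
      push_cast
      rw [add_sub_cancel_right]
      congr 1
      ring
    rw [h1, hf, hg, Finset.smul_sum, ← Finset.sum_sub_distrib, Finset.smul_sum]
    refine Finset.sum_congr rfl fun p hp => ?_
    rw [Finset.HasAntidiagonal.mem_antidiagonal] at hp
    rw [smul_smul, ← sub_smul, smul_smul]
    congr 1
    have hq := qInt_add p.1 p.2
    rw [hp] at hq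
    rw [eq_inv_mul_iff_mul_eq₀ hm, hq]
    have e1 : v ^ ((a + m - 1) * (p.1 : ℤ)) =
        v ^ ((a + (m + 1 : ℕ) - 1) * (p.1 : ℤ)) * v ^ (-(p.1 : ℤ)) := by
      rw [← zpow_add₀ v_ne_zero]; congr 1; push_cast; ring
    have e2 : v ^ (a + 2 * (m : ℤ)) * v ^ ((a + m - 1) * ((p.1 : ℤ) - 1)) =
        v ^ ((a + (m + 1 : ℕ) - 1) * (p.1 : ℤ)) * v ^ (p.2 : ℤ) := by
      rw [← zpow_add₀ v_ne_zero, ← zpow_add₀ v_ne_zero]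
      congr 1
      have : (p.2 : ℤ) = m + 1 - p.1 := by omega
      rw [this]; push_cast; ring
    rw [e1, show v ^ (a + 2 * (m : ℤ)) *
        (-(-1) ^ p.1 * v ^ ((a + m - 1) * ((p.1 : ℤ) - 1)) * qInt p.1) =
        -(-1) ^ p.1 * (v ^ (a + 2 * (m : ℤ)) * v ^ ((a + m - 1) * ((p.1 : ℤ) - 1))) * qInt p.1
        by ring, e2]
    ring

theorem serre_sum_eq_qAd (x y : A) (m : ℕ) :
    ∑ p ∈ Finset.HasAntidiagonal.antidiagonal m, (-1 : Kv) ^ p.1 •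
      (divPow x p.1 * y * divPow x p.2) = (qFactorial m)⁻¹ • qAd x (1 - m) m y := by
  rw [← sum_divPow_eq_qAd]
  simp

end Serre

/-! ### The twisted derivations of the free algebra as components of the coproduct -/

section Derivations

variable {V : Type u} [Quiver.{w + 1} V]

theorem vertexForm_comm (i j : V) : vertexForm i j = vertexForm j i := by
  unfold vertexForm edges
  by_cases h : i = j
  · subst h; rfl
  · rw [if_neg h, if_neg (Ne.symm h), add_comm]

theorem vertexForm_nonpos {i j : V} (h : i ≠ j) : vertexForm i j ≤ 0 := by
  rw [vertexForm, if_neg h]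
  omega

theorem form_comm (x y : V →₀ ℤ) : form x y = form y x := by
  unfold form
  rw [Finsupp.sum_comm]
  refine Finsupp.sum_congr fun i _ => Finsupp.sum_congr fun j _ => ?_
  rw [vertexForm_comm j i]
  ring

theorem IInf.pairing_comm (ι κ : IInf V) : ι.pairing κ = κ.pairing ι := form_comm _ _

theorem form_neg_weight (ι κ : IInf V) : form (-ι.weight) (-κ.weight) = ι.pairing κ := by
  rw [form_neg_left, form_neg_right, neg_neg, IInf.pairing]

theorem IInf.weight_injective : Function.Injective (IInf.weight (V := V)) := by
  intro ι κ h
  cases ι with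
  | re j hj =>
    cases κ with
    | re k hk =>
      obtain rfl := (Finsupp.single_left_inj one_ne_zero).mp h
      rfl
    | im i hi l =>
      have hl : ((l : ℕ) : ℤ) ≠ 0 := by exact_mod_cast l.ne_zero
      rcases (Finsupp.single_eq_single_iff _ _ _ _).mp h with ⟨rfl, -⟩ | ⟨h1, -⟩
      · exact absurd hj hi
      · exact absurd h1 one_ne_zero
  | im i hi l =>
    have hl : ((l : ℕ) : ℤ) ≠ 0 := by exact_mod_cast l.ne_zero
    cases κ with
    | re k hk =>
      rcases (Finsupp.single_eq_single_iff _ _ _ _).mp h with ⟨rfl, -⟩ | ⟨h1, -⟩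
      · exact absurd hk hi
      · exact absurd h1 hl
    | im i' hi' l' =>
      rcases (Finsupp.single_eq_single_iff _ _ _ _).mp h with ⟨rfl, h2⟩ | ⟨h1, -⟩
      · obtain rfl : l = l' := PNat.coe_injective (by exact_mod_cast h2)
        rfl
      · exact absurd h1 hl

theorem pairing_re_re (j k : V) (hj : IsRealVertex j) (hk : IsRealVertex k) :
    (IInf.re j hj).pairing (.re k hk) = vertexForm j k := by
  simp [IInf.pairing, IInf.weight, form_single]

theorem pairing_re_im (j i : V) (hj : IsRealVertex j) (hi : IsImagVertex i) (l : ℕ+) :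
    (IInf.re j hj).pairing (.im i hi l) = l * vertexForm j i := by
  simp [IInf.pairing, IInf.weight, form_single]

theorem pairing_im_im (i i' : V) (hi : IsImagVertex i) (hi' : IsImagVertex i') (l m : ℕ+) :
    (IInf.im i hi l).pairing (.im i' hi' m) = l * m * vertexForm i i' := by
  simp [IInf.pairing, IInf.weight, form_single]

theorem pairing_re_nonpos {j : V} {hj : IsRealVertex j} {κ : IInf V} (h : κ ≠ .re j hj) :
    (IInf.re j hj).pairing κ ≤ 0 := by
  cases κ with
  | re k hk =>
    rw [pairing_re_re]
    exact vertexForm_nonpos fun hjk => h (by subst hjk; rfl)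
  | im i hi l =>
    rw [pairing_re_im]
    exact mul_nonpos_of_nonneg_of_nonpos (by positivity)
      (vertexForm_nonpos fun hji => hi (by subst hji; exact hj))

theorem proj_surjective : Function.Surjective (proj V) := RingQuot.mkAlgHom_surjective _ _

open Classical in
/-- The values of the twisted derivation `e'_ι` on the generators `F_κ`, as read off from the
coproduct. -/
def derGen : IInf V → IInf V → FreeU V
  | .re j hj, κ => if κ = .re j hj then 1 else 0
  | .im _ _ _, .re _ _ => 0
  | .im i _ l, .im i' hi' n =>
      if i = i' ∧ l ≤ n then
        vi i ^ ((l : ℕ) * ((n : ℕ) - l)) • freeF₀ i' hi' ((n : ℕ) - l)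
      else 0

theorem derGen_re (j : V) (hj : IsRealVertex j) : derGen (.re j hj) (.re j hj) = 1 := if_pos rfl

theorem derGen_re_of_ne {j : V} {hj : IsRealVertex j} {κ : IInf V} (h : κ ≠ .re j hj) :
    derGen (.re j hj) κ = 0 := if_neg h

theorem derGen_im (i : V) (hi : IsImagVertex i) (l n : ℕ+) (h : l ≤ n) :
    derGen (.im i hi l) (.im i hi n) =
      vi i ^ ((l : ℕ) * ((n : ℕ) - l)) • freeF₀ i hi ((n : ℕ) - l) := if_pos ⟨rfl, h⟩

theorem derGen_cases (ι κ : IInf V) : derGen ι κ = 0 ∨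
    (ι = κ ∧ derGen ι κ = 1) ∨
    ∃ (i : V) (hi : IsImagVertex i) (l n : ℕ+), ι = .im i hi l ∧ κ = .im i hi n ∧ l ≤ n ∧
      derGen ι κ = vi i ^ ((l : ℕ) * ((n : ℕ) - l)) • freeF₀ i hi ((n : ℕ) - l) := by
  cases ι with
  | re j hj =>
    by_cases h : κ = .re j hj
    · subst h
      exact Or.inr (Or.inl ⟨rfl, derGen_re j hj⟩)
    · exact Or.inl (derGen_re_of_ne h)
  | im i hi l =>
    cases κ with
    | re k hk => exact Or.inl rfl
    | im i' hi' n =>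
      by_cases h : i = i' ∧ l ≤ n
      · obtain ⟨rfl, hln⟩ := h
        exact Or.inr (Or.inr ⟨i, hi, l, n, rfl, rfl, hln, derGen_im i hi l n hln⟩)
      · exact Or.inl (if_neg h)

/-- The twisted derivation `e'_ι` on the free algebra. -/
def freeDer (ι : IInf V) : FreeU V →ₗ[Kv] FreeU V :=
  twistDer (twist (-ι.weight)) (AlgHom.id Kv _) (derGen ι)

open Classical in
/-- The functional on the free algebra dual to `F_ι` and vanishing on decomposable elements. -/
def dualGen (ι : IInf V) : FreeU V →ₗ[Kv] Kv :=
  twistDer (augmentation Kv (IInf V)) (augmentation Kv (IInf V)) fun κ => if ι = κ then 1 else 0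

theorem dualGen_mul (ι : IInf V) (x y : FreeU V) : dualGen ι (x * y) =
    dualGen ι x * augmentation Kv _ y + augmentation Kv _ x * dualGen ι y := twistDer_mul _ _ _ x y

open Classical in
theorem dualGen_freeF (ι κ : IInf V) : dualGen ι (freeF κ) = if ι = κ then 1 else 0 :=
  twistDer_ι _ _ _ κ

theorem dualGen_one (ι : IInf V) : dualGen ι 1 = 0 := twistDer_one _ _ _

theorem augmentation_twist (β : V →₀ ℤ) (x : FreeU V) :
    augmentation Kv _ (twist β x) = augmentation Kv _ x := by
  have : (augmentation Kv _).comp (twist β) = augmentation Kv (IInf V) := by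
    ext κ; simp [twist_freeF]
  exact DFunLike.congr_fun this x

theorem dualGen_twist (ι : IInf V) (β : V →₀ ℤ) (x : FreeU V) :
    dualGen ι (twist β x) = v ^ form β (-ι.weight) * dualGen ι x := by
  induction x using freeAlgebra_induction_left with
  | one => simp [dualGen_one]
  | add x y hx hy => rw [map_add, map_add, map_add, hx, hy, mul_add]
  | smul r x hx => rw [map_smul, map_smul, map_smul, hx, smul_eq_mul, smul_eq_mul]; ring
  | mul κ x hx =>
    rw [map_mul, dualGen_mul, dualGen_mul, twist_freeF, hx, map_smul, map_smul, dualGen_freeF,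
      augmentation_twist, augmentation_ι]
    split_ifs with h
    · subst h; simp
    · simp

theorem augmentation_freeF₀ (i : V) (hi : IsImagVertex i) (n : ℕ) :
    augmentation Kv _ (freeF₀ i hi n) = if n = 0 then 1 else 0 := by
  rcases n.eq_zero_or_pos with rfl | hn
  · simp [freeF₀]
  · simp [freeF₀, hn, hn.ne']

theorem freeF₀_coe (i : V) (hi : IsImagVertex i) (n : ℕ+) :
    freeF₀ i hi n = freeF (.im i hi n) := dif_pos n.pos

theorem freeF₀_zero (i : V) (hi : IsImagVertex i) : freeF₀ i hi 0 = 1 := rfl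

/-- Evaluation of the first tensor factor by a functional. -/
def slice {A : Type*} [AddCommGroup A] [Module Kv A] (φ : A →ₗ[Kv] Kv) : A ⊗[Kv] A →ₗ[Kv] A :=
  (TensorProduct.lid Kv A).toLinearMap ∘ₗ φ.rTensor A

@[simp] theorem slice_tmul {A : Type*} [AddCommGroup A] [Module Kv A] (φ : A →ₗ[Kv] Kv)
    (x y : A) : slice φ (x ⊗ₜ y) = φ x • y := by simp [slice]

theorem slice_augmentation_coprodGen (κ : IInf V) (X : FreeU V ⊗[Kv] FreeU V) :
    slice (augmentation Kv _).toLinearMap (coprodGen κ X) =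
      freeF κ * slice (augmentation Kv _).toLinearMap X := by
  induction X using TensorProduct.induction_on with
  | zero => simp
  | add x y hx hy => rw [map_add, map_add, hx, hy, map_add, mul_add]
  | tmul c d =>
    cases κ with
    | re j hj =>
      simp [coprodGen, twistedMulLeft, augmentation_twist]
    | im i hi n =>
      simp only [coprodGen, LinearMap.sum_apply, LinearMap.smul_apply, twistedMulLeft,
        TensorProduct.map_tmul, LinearMap.comp_apply, LinearMap.mulLeft_apply,
        AlgHom.toLinearMap_apply, map_sum, map_smul, slice_tmul, map_mul, augmentation_twist,
        augmentation_freeF₀]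
      rw [Finset.sum_eq_single (0, (n : ℕ))]
      · simp [freeF₀_coe]
      · rintro ⟨s, t⟩ hp hne
        rw [Finset.HasAntidiagonal.mem_antidiagonal] at hp
        rw [if_neg, zero_mul, zero_smul, smul_zero]
        rintro rfl
        exact hne (by simpa using hp)
      · simp

theorem slice_dualGen_coprodGen (ι κ : IInf V) (X : FreeU V ⊗[Kv] FreeU V) :
    slice (dualGen ι) (coprodGen κ X) =
      derGen ι κ * slice (augmentation Kv _).toLinearMap X +
        v ^ ι.pairing κ • (freeF κ * slice (dualGen ι) X) := by
  classical
  induction X using TensorProduct.induction_on with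
  | zero => simp
  | add x y hx hy =>
    rw [map_add, map_add, hx, hy, map_add, map_add, mul_add, mul_add, smul_add]
    abel
  | tmul c d =>
    cases κ with
    | re j hj =>
      simp only [coprodGen, LinearMap.add_apply, twistedMulLeft, TensorProduct.map_tmul,
        LinearMap.comp_apply, LinearMap.mulLeft_apply, AlgHom.toLinearMap_apply, map_add,
        slice_tmul, one_mul, dualGen_mul, augmentation_twist, dualGen_twist, augmentation_ι,
        dualGen_freeF, zero_mul, add_zero]
      have hw : form (-Finsupp.single j 1) (-ι.weight) = ι.pairing (.re j hj) := by
        rw [IInf.pairing_comm, ← form_neg_weight]; rfl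
      rw [hw, mul_smul_comm, mul_smul_comm, smul_smul]
      congr 1
      by_cases h : ι = .re j hj
      · subst h
        rw [derGen_re, if_pos rfl, one_mul, one_mul]
      · rw [if_neg h, zero_mul, zero_smul]
        cases ι with
        | re k hk => rw [derGen_re_of_ne (Ne.symm h), zero_mul, smul_zero]
        | im i hi l => simp [derGen]
    | im i hi n =>
      simp only [coprodGen, LinearMap.sum_apply, LinearMap.smul_apply, twistedMulLeft,
        TensorProduct.map_tmul, LinearMap.comp_apply, LinearMap.mulLeft_apply,
        AlgHom.toLinearMap_apply, map_sum, map_smul, slice_tmul, dualGen_mul,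
        augmentation_twist, dualGen_twist, augmentation_freeF₀, add_smul, smul_add,
        Finset.sum_add_distrib]
      congr 1
      · have h0 : ∀ t : ℕ, ι ≠ .im i hi t.succPNat → dualGen ι (freeF₀ i hi (t + 1)) = 0 := by
          intro t ht
          rw [freeF₀, dif_pos t.succ_pos, dualGen_freeF]
          exact if_neg ht
        by_cases hι : ∃ l, ι = .im i hi l ∧ l ≤ n
        · obtain ⟨l, rfl, hln⟩ := hι
          have hln' : (l : ℕ) ≤ n := hln
          rw [derGen_im i hi l n hln, Finset.sum_eq_single ((l : ℕ), (n : ℕ) - l)]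
          · rw [freeF₀_coe, dualGen_freeF, if_pos rfl, one_mul, smul_mul_assoc, mul_smul_comm, vi,
              ← zpow_natCast, ← zpow_mul]
            push_cast [hln']
            rfl
          · rintro ⟨s, t⟩ hp hne
            rw [Finset.HasAntidiagonal.mem_antidiagonal] at hp
            have : dualGen (.im i hi l) (freeF₀ i hi s) = 0 := by
              cases s with
              | zero => rw [freeF₀_zero, dualGen_one]
              | succ s =>
                refine h0 s fun h => hne ?_
                have h1 : (l : ℕ) = s + 1 := by
                  injection h with _ h2
                  rw [h2]; rfl
                ext <;> simp at hp ⊢ <;> omega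
            rw [this, zero_mul, zero_smul, smul_zero]
          · intro h
            exact absurd (by rw [Finset.HasAntidiagonal.mem_antidiagonal]; simp [hln']) h
        · have hd : derGen ι (.im i hi n) = 0 := by
            rcases derGen_cases ι (.im i hi n) with h | ⟨rfl, -⟩ | ⟨i', hi', l, n', rfl, h2, h3, -⟩
            · exact h
            · exact absurd ⟨n, rfl, le_rfl⟩ hι
            · injection h2 with h4 h5
              subst h4 h5
              exact absurd ⟨l, rfl, h3⟩ hι
          rw [hd, zero_mul]
          refine Finset.sum_eq_zero fun p hp => ?_
          rw [Finset.HasAntidiagonal.mem_antidiagonal] at hp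
          have : dualGen ι (freeF₀ i hi p.1) = 0 := by
            rcases p with ⟨s, t⟩
            cases s with
            | zero => rw [freeF₀_zero, dualGen_one]
            | succ s =>
              refine h0 s fun h => hι ⟨_, h, ?_⟩
              rw [← PNat.coe_le_coe, Nat.succPNat_coe]
              simp at hp; omega
          rw [this, zero_mul, zero_smul, smul_zero]
      · rw [Finset.sum_eq_single (0, (n : ℕ))]
        · have hw : form (-Finsupp.single i ((n : ℕ) : ℤ)) (-ι.weight) =
              ι.pairing (.im i hi n) := by
            rw [IInf.pairing_comm, ← form_neg_weight]; rfl
          simp only [if_true, hw, one_mul, freeF₀_coe, Nat.cast_zero, zero_mul, mul_zero, zpow_zero,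
            mul_smul_comm, smul_smul]
        · rintro ⟨s, t⟩ hp hne
          rw [Finset.HasAntidiagonal.mem_antidiagonal] at hp
          rw [if_neg, zero_mul, zero_smul, smul_zero]
          rintro rfl
          exact hne (by simpa using hp)
        · simp

theorem freeDer_mul (ι : IInf V) (x y : FreeU V) :
    freeDer ι (x * y) = freeDer ι x * y + twist (-ι.weight) x * freeDer ι y := by
  simp [freeDer, twistDer_mul]

theorem slice_augmentation_coprod (x : FreeU V) :
    slice (augmentation Kv _).toLinearMap (coprod x) = x := by
  induction x using freeAlgebra_induction_left with
  | one => simp [coprod_one]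
  | add x y hx hy => rw [map_add, map_add, hx, hy]
  | smul r x hx => rw [map_smul, map_smul, hx]
  | mul κ x hx => rw [coprod_ι_mul, slice_augmentation_coprodGen, hx]

/-- The twisted derivation `e'_ι` is the component of the coproduct dual to `F_ι`. -/
theorem slice_dualGen_coprod (ι : IInf V) (x : FreeU V) :
    slice (dualGen ι) (coprod x) = freeDer ι x := by
  induction x using freeAlgebra_induction_left with
  | one => simp [coprod_one, dualGen_one, freeDer]
  | add x y hx hy => rw [map_add, map_add, map_add, hx, hy]
  | smul r x hx => rw [map_smul, map_smul, map_smul, hx]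
  | mul κ x hx =>
    rw [coprod_ι_mul, slice_dualGen_coprodGen, hx, slice_augmentation_coprod, freeDer_mul,
      twist_freeF, form_neg_weight, smul_mul_assoc]
    simp [freeDer]

end Derivations

/-! ### The twisted derivations respect the defining relations -/

section Descent

variable {V : Type u} [Quiver.{w + 1} V]

/-- The truncation to a natural number is harmless in the Serre relations. -/
theorem serre_length {j : V} {hj : IsRealVertex j} {κ : IInf V} (h : κ ≠ .re j hj) :
    ((1 - (IInf.re j hj).pairing κ).toNat : ℤ) = 1 - (IInf.re j hj).pairing κ :=
  Int.toNat_of_nonneg (by have := pairing_re_nonpos h; omega)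

theorem F_mul_comm {ι κ : IInf V} (h : ι.pairing κ = 0) : F ι * F κ = F κ * F ι := by
  have := RingQuot.mkAlgHom_rel Kv (Rel.comm ι κ h)
  rw [map_mul, map_mul] at this
  exact this

theorem serre_rel_eq (j : V) (hj : IsRealVertex j) (κ : IInf V) (h : κ ≠ .re j hj) :
    (∑ p ∈ Finset.HasAntidiagonal.antidiagonal (1 - (IInf.re j hj).pairing κ).toNat,
        (-1 : Kv) ^ p.1 • (divPow (freeF (.re j hj)) p.1 * freeF κ *
          divPow (freeF (.re j hj)) p.2)) =
      (qFactorial (1 - (IInf.re j hj).pairing κ).toNat)⁻¹ •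
        qAd (freeF (.re j hj)) ((IInf.re j hj).pairing κ)
          (1 - (IInf.re j hj).pairing κ).toNat (freeF κ) := by
  rw [serre_sum_eq_qAd, serre_length h, sub_sub_cancel]

theorem qAd_F (j : V) (hj : IsRealVertex j) (κ : IInf V) (h : κ ≠ .re j hj) :
    qAd (F (.re j hj)) ((IInf.re j hj).pairing κ) (1 - (IInf.re j hj).pairing κ).toNat (F κ) =
      0 := by
  have h1 := RingQuot.mkAlgHom_rel Kv (Rel.serre j hj κ h)
  rw [serre_rel_eq j hj κ h, map_zero, map_smul] at h1
  have h2 := (smul_eq_zero.mp h1).resolve_left (inv_ne_zero (qFactorial_ne_zero _))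
  rw [map_qAd] at h2
  exact h2

/-- To check that a linear map respects the defining relations of `U^-`, the Serre relations may be
replaced by iterated `q`-commutators. -/
theorem respects_rel {M : Type*} [AddCommGroup M] [Module Kv M] (f : FreeU V →ₗ[Kv] M)
    (hcomm : ∀ ι κ : IInf V, ι.pairing κ = 0 → f (freeF ι * freeF κ) = f (freeF κ * freeF ι))
    (hserre : ∀ j hj (κ : IInf V), κ ≠ .re j hj →
      f (qAd (freeF (.re j hj)) ((IInf.re j hj).pairing κ)
        (1 - (IInf.re j hj).pairing κ).toNat (freeF κ)) = 0) :
    ∀ a b, Rel V a b → f a = f b := by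
  intro a b hab
  cases hab with
  | comm ι κ h => exact hcomm ι κ h
  | serre j hj κ h => rw [serre_rel_eq j hj κ h, map_smul, hserre j hj κ h, smul_zero, map_zero]

theorem proj_rel : ∀ a b, Rel V a b → proj V a = proj V b := fun _ _ h =>
  RingQuot.mkAlgHom_rel Kv h

theorem proj_twist_rel (β : V →₀ ℤ) : ∀ a b, Rel V a b →
    ((proj V).comp (twist β)) a = ((proj V).comp (twist β)) b := by
  refine respects_rel ((proj V).comp (twist β)).toLinearMap (fun ι κ h => ?_)
    (fun j hj κ h => ?_)
  · simp only [AlgHom.toLinearMap_apply, AlgHom.comp_apply, map_mul, twist_freeF, map_smul,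
      smul_mul_smul_comm]
    rw [mul_comm (v ^ form β (-κ.weight))]
    exact congrArg _ (F_mul_comm h)
  · simp only [AlgHom.toLinearMap_apply, AlgHom.comp_apply]
    rw [map_qAd, twist_freeF, twist_freeF, qAd_smul, map_smul, map_qAd]
    have := qAd_F j hj κ h
    rw [F, F] at this
    rw [this, smul_zero]

/-- The twisted derivation `e'_ι` with values in `U^-`. -/
def projDer (ι : IInf V) : FreeU V →ₗ[Kv] UMinus V :=
  twistDer ((proj V).comp (twist (-ι.weight))) (proj V) fun κ => proj V (derGen ι κ)

theorem projDer_mul (ι : IInf V) (x y : FreeU V) : projDer ι (x * y) =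
    projDer ι x * proj V y + proj V (twist (-ι.weight) x) * projDer ι y :=
  twistDer_mul _ _ _ x y

theorem projDer_freeF (ι κ : IInf V) : projDer ι (freeF κ) = proj V (derGen ι κ) :=
  twistDer_ι _ _ _ κ

theorem projDer_eq (ι : IInf V) (x : FreeU V) : projDer ι x = proj V (freeDer ι x) := by
  induction x using freeAlgebra_induction_left with
  | one => simp [projDer, freeDer]
  | add x y hx hy => rw [map_add, map_add, map_add, hx, hy]
  | smul r x hx => rw [map_smul, map_smul, map_smul, hx]
  | mul κ x hx =>
    rw [projDer_mul, freeDer_mul, map_add, map_mul, map_mul, hx, projDer_freeF]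
    simp [freeDer]

theorem derGen_mul_F (ι : IInf V) {κ κ' : IInf V} (h : κ.pairing κ' = 0) :
    proj V (derGen ι κ) * F κ' = v ^ ι.pairing κ' • (F κ' * proj V (derGen ι κ)) := by
  rcases derGen_cases ι κ with h0 | ⟨rfl, h1⟩ | ⟨i, hi, l, n, rfl, rfl, hln, h2⟩
  · rw [h0, map_zero, zero_mul, mul_zero, smul_zero]
  · rw [h1, h, map_one, one_mul, mul_one, zpow_zero, one_smul]
  · have hi0 : ∀ m : ℕ+, (IInf.im i hi m).pairing κ' = 0 := by
      intro m
      have hn : ((n : ℕ) : ℤ) ≠ 0 := by exact_mod_cast n.ne_zero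
      cases κ' with
      | re k hk =>
        rw [IInf.pairing_comm, pairing_re_im] at h ⊢
        rw [(mul_eq_zero.mp h).resolve_left hn, mul_zero]
      | im i' hi' n' =>
        have hn' : ((n' : ℕ) : ℤ) ≠ 0 := by exact_mod_cast n'.ne_zero
        rw [pairing_im_im] at h ⊢
        rw [(mul_eq_zero.mp h).resolve_left (mul_ne_zero hn hn'), mul_zero]
    rw [hi0, zpow_zero, one_smul, h2, map_smul, smul_mul_assoc, mul_smul_comm]
    congr 1
    rcases ((n : ℕ) - l).eq_zero_or_pos with h3 | h3
    · rw [h3, freeF₀_zero, map_one, one_mul, mul_one]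
    · lift (n : ℕ) - l to ℕ+ using h3 with m
      rw [freeF₀_coe]
      exact F_mul_comm (hi0 m)

/-- For `ι` different from `j`, the derivation `e'_ι` kills `F_j`, so that it passes through the
iterated `q`-commutator and shifts the exponents by `(ι, j)`. -/
theorem projDer_qAd_of_ne {ι : IInf V} {j : V} {hj : IsRealVertex j} (h : ι ≠ .re j hj)
    (a : ℤ) (m : ℕ) (y : FreeU V) : projDer ι (qAd (freeF (.re j hj)) a m y) =
      qAd (F (.re j hj)) (a + ι.pairing (.re j hj)) m (projDer ι y) := by
  have h0 : projDer ι (freeF (.re j hj)) = 0 := by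
    rw [projDer_freeF]
    cases ι with
    | re k hk => rw [derGen_re_of_ne (Ne.symm h), map_zero]
    | im i hi l => exact map_zero _
  induction m with
  | zero => rfl
  | succ m ih =>
    rw [qAd, map_sub, map_smul, projDer_mul, projDer_mul, h0, ih, twist_freeF, form_neg_weight,
      mul_zero, add_zero, zero_mul, zero_add, map_smul, smul_mul_assoc, smul_smul,
      ← zpow_add₀ v_ne_zero, qAd, show a + 2 * (m : ℤ) + ι.pairing (.re j hj) =
        a + ι.pairing (.re j hj) + 2 * m by ring]
    rfl

theorem twist_qAd (β : V →₀ ℤ) (ι κ : IInf V) (a : ℤ) (m : ℕ) :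
    twist β (qAd (freeF ι) a m (freeF κ)) =
      v ^ (form β (-κ.weight) + m * form β (-ι.weight)) • qAd (freeF ι) a m (freeF κ) := by
  rw [map_qAd, twist_freeF, twist_freeF, qAd_smul]
  congr 1
  rw [zpow_add₀ v_ne_zero, mul_comm, ← zpow_natCast, ← zpow_mul, mul_comm (m : ℤ)]

/-- The derivation `e'_j` kills the iterated `q`-commutators entering the Serre relations for
`j`. -/
theorem projDer_qAd_self {j : V} {hj : IsRealVertex j} {κ : IInf V} (h : κ ≠ .re j hj) (m : ℕ) :
    projDer (.re j hj)
      (qAd (freeF (.re j hj)) ((IInf.re j hj).pairing κ) m (freeF κ)) = 0 := by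
  induction m with
  | zero => rw [qAd, projDer_freeF, derGen_re_of_ne h, map_zero]
  | succ m ih =>
    have h2 : (IInf.re j hj).pairing (.re j hj) = 2 := by
      rw [pairing_re_re, vertexForm_self, show loops j = 0 from hj]; rfl
    rw [qAd, map_sub, map_smul, projDer_mul, projDer_mul, ih, twist_qAd, form_neg_weight,
      form_neg_weight, h2, projDer_freeF, derGen_re, map_one, zero_mul, mul_zero, mul_one, one_mul,
      map_smul, zero_add, add_zero, mul_comm (m : ℤ), sub_self]

/-- The derivation `e'_ι` turns the Serre relation for `j` and `κ` into an iterated `q`-commutator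
of the same length with the value of `e'_ι` on `F_κ`, with a shifted exponent. It vanishes: this
value is a multiple of `1` or of some `F_{i,m}`, and the last factors, which may be applied first,
already form the commutator `[1, F_j]` or the Serre relation for `j` and `F_{i,m}`. -/
theorem qAd_derGen {ι κ : IInf V} {j : V} {hj : IsRealVertex j} (h : κ ≠ .re j hj) :
    qAd (F (.re j hj)) ((IInf.re j hj).pairing κ + ι.pairing (.re j hj))
      (1 - (IInf.re j hj).pairing κ).toNat (proj V (derGen ι κ)) = 0 := by
  have hone : ∀ x : UMinus V, qAd x 0 1 1 = 0 := fun x => by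
    simp only [qAd, one_mul, mul_one, Nat.cast_zero, mul_zero, add_zero, zpow_zero, one_smul]
    exact sub_self x
  -- Splitting off the last `m'` factors, whose exponents start at `a'`.
  have hsplit : ∀ (a a' : ℤ) (N m' : ℕ) (y : UMinus V), m' ≤ N → a + 2 * (N - m') = a' →
      qAd (F (.re j hj)) a' m' y = 0 → qAd (F (.re j hj)) a N y = 0 := by
    intro a a' N m' y hle ha hy
    obtain ⟨m, rfl⟩ := Nat.exists_eq_add_of_le' hle
    rw [qAd_add, show a + 2 * (m : ℤ) = a' by rw [← ha]; push_cast; ring, hy, qAd_zero]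
  have hN := serre_length h
  have hnon := pairing_re_nonpos h
  rcases derGen_cases ι κ with h0 | ⟨rfl, h1⟩ | ⟨i, hi, l, n, rfl, rfl, hln, h2⟩
  · rw [h0, map_zero, qAd_zero]
  · rw [h1, map_one]
    refine hsplit _ 0 _ 1 _ (by omega) ?_ (hone _)
    rw [hN, IInf.pairing_comm ι]
    push_cast; ring
  · rw [h2, map_smul]
    suffices hs : qAd (F (.re j hj)) ((IInf.re j hj).pairing (.im i hi n) +
        (IInf.im i hi l).pairing (.re j hj)) (1 - (IInf.re j hj).pairing (.im i hi n)).toNat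
        (proj V (freeF₀ i hi ((n : ℕ) - l))) = 0 by
      have := qAd_smul (F (.re j hj)) ((IInf.re j hj).pairing (.im i hi n) +
        (IInf.im i hi l).pairing (.re j hj)) (1 - (IInf.re j hj).pairing (.im i hi n)).toNat
        1 (vi i ^ ((l : ℕ) * ((n : ℕ) - l))) (proj V (freeF₀ i hi ((n : ℕ) - l)))
      rw [one_smul, hs, smul_zero] at this
      exact this
    have hln' : (l : ℕ) ≤ n := hln
    rw [IInf.pairing_comm (.im i hi l)]
    rcases ((n : ℕ) - l).eq_zero_or_pos with h3 | h3
    · have hnl : l = n := le_antisymm hln (PNat.coe_le_coe _ _ |>.mp (by omega))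
      subst hnl
      rw [h3, freeF₀_zero, map_one]
      refine hsplit _ 0 _ 1 _ (by omega) ?_ (hone _)
      rw [hN]
      push_cast; ring
    · obtain ⟨m, hm⟩ : ∃ m : ℕ+, (m : ℕ) = n - l := ⟨⟨_, h3⟩, rfl⟩
      have hm' : (m : ℤ) = n - l := by
        have : ((m : ℕ) : ℤ) = ((n : ℕ) : ℤ) - (l : ℕ) := by omega
        exact this
      have hne : (IInf.im i hi m) ≠ .re j hj := by simp
      have hM := serre_length (hj := hj) hne
      have hMnon := pairing_re_nonpos (hj := hj) hne
      rw [← hm, freeF₀_coe]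
      have e1 : (IInf.re j hj).pairing (.im i hi m) = (IInf.re j hj).pairing (.im i hi n) -
          (IInf.re j hj).pairing (.im i hi l) := by
        rw [pairing_re_im, pairing_re_im, pairing_re_im, hm']; ring
      have hl := pairing_re_nonpos (hj := hj) (κ := .im i hi l) (by simp)
      refine hsplit _ _ _ _ _ (by omega) ?_ (qAd_F j hj (.im i hi m) hne)
      rw [hN, hM, e1]
      ring

theorem projDer_rel (ι : IInf V) : ∀ a b, Rel V a b → projDer ι a = projDer ι b := by
  refine respects_rel (projDer ι) (fun κ κ' h => ?_) (fun j hj κ h => ?_)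
  · rw [projDer_mul, projDer_mul, projDer_freeF, projDer_freeF, twist_freeF, twist_freeF,
      form_neg_weight, form_neg_weight, map_smul, map_smul, smul_mul_assoc, smul_mul_assoc]
    have h1 := derGen_mul_F ι h
    have h2 := derGen_mul_F ι ((IInf.pairing_comm κ' κ).trans h)
    rw [F] at h1 h2
    rw [h1, h2, add_comm]
  · by_cases hι : ι = .re j hj
    · subst hι
      exact projDer_qAd_self h _
    · rw [projDer_qAd_of_ne hι, projDer_freeF, qAd_derGen h]

theorem augmentation_rel : ∀ a b, Rel V a b →
    augmentation Kv (IInf V) a = augmentation Kv (IInf V) b := by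
  refine respects_rel (augmentation Kv (IInf V)).toLinearMap (fun ι κ _ => ?_) fun j hj κ _ => ?_
  · simp
  · rw [AlgHom.toLinearMap_apply, map_qAd, augmentation_ι κ, qAd_zero]

theorem dualGen_rel (ι : IInf V) : ∀ a b, Rel V a b → dualGen ι a = dualGen ι b := by
  refine respects_rel (dualGen ι) (fun κ κ' _ => ?_) fun j hj κ h => ?_
  · simp [dualGen_mul]
  · obtain ⟨m, hm⟩ : ∃ m, (1 - (IInf.re j hj).pairing κ).toNat = m + 1 :=
      Nat.exists_eq_add_one.mpr (by have := serre_length h; have := pairing_re_nonpos h; omega)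
    rw [hm, qAd, map_sub, map_smul, dualGen_mul, dualGen_mul, map_qAd, augmentation_ι κ, qAd_zero,
      augmentation_ι]
    simp

end Descent

/-! ### The twisted derivations on `U^-` and their values on the `b_κ` -/

section Existence

variable {V : Type u} [Quiver.{w + 1} V]

theorem exists_dualGen_lift (ι : IInf V) :
    ∃ φ : UMinus V →ₗ[Kv] Kv, ∀ x, φ (proj V x) = dualGen ι x := by
  classical
  exact exists_twistDer_lift _ _ _ augmentation_rel augmentation_rel (dualGen_rel ι)

theorem dualGen_eq_zero_of_mem_degreePart {ι κ : IInf V} (h : ι ≠ κ) {φ : UMinus V →ₗ[Kv] Kv}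
    (hφ : ∀ x, φ (proj V x) = dualGen ι x) {x : UMinus V}
    (hx : x ∈ degreePart (-κ.weight)) : φ x = 0 := by
  refine (Submodule.span_le.mpr ?_ : degreePart (-κ.weight) ≤ LinearMap.ker φ) hx
  rintro _ ⟨s, hs, rfl⟩
  have : (s.map F).prod = proj V (s.map freeF).prod := by
    rw [map_list_prod, List.map_map]; rfl
  rw [SetLike.mem_coe, LinearMap.mem_ker, this, hφ]
  cases s with
  | nil => exact dualGen_one ι
  | cons μ s =>
    rw [List.map_cons, List.prod_cons, dualGen_mul, augmentation_ι, zero_mul, add_zero]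
    cases s with
    | nil =>
      rw [dualGen_freeF, if_neg, zero_mul]
      rintro rfl
      refine h (IInf.weight_injective ?_)
      simpa using hs
    | cons μ' s => simp

open Classical in
theorem dualGen_b (ι : IInf V) (i : V) (hi : IsImagVertex i) (l : ℕ+) {φ : UMinus V →ₗ[Kv] Kv}
    (hφ : ∀ x, φ (proj V x) = dualGen ι x) :
    φ (b (.im i hi l)) = if ι = .im i hi l then 1 else 0 := by
  have hB := isBozecElement_b i hi l
  by_cases h : ι = .im i hi l
  · rw [if_pos h]
    have h1 : φ (F (.im i hi l)) = 1 := by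
      rw [F, hφ, dualGen_freeF, if_pos h]
    have h2 : φ (b (.im i hi l) - F (.im i hi l)) = 0 := by
      suffices ∀ y ∈ Algebra.adjoin Kv {x | ∃ k : ℕ+, k < l ∧ x = F (.im i hi k)},
          ∃ Y, proj V Y = y ∧ dualGen ι Y = 0 by
        obtain ⟨Y, hY, hY0⟩ := this _ hB.sub_mem
        rw [← hY, hφ, hY0]
      intro y hy
      induction hy using Algebra.adjoin_induction with
      | mem x hx =>
        obtain ⟨k, hk, rfl⟩ := hx
        refine ⟨freeF (.im i hi k), rfl, ?_⟩
        rw [dualGen_freeF, if_neg]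
        rw [h]
        intro he
        injection he with _ he
        exact hk.ne he.symm
      | algebraMap r =>
        exact ⟨algebraMap Kv _ r, AlgHom.commutes _ r, by
          rw [Algebra.algebraMap_eq_smul_one, map_smul, dualGen_one, smul_zero]⟩
      | add x y _ _ hx hy =>
        obtain ⟨X, rfl, hX⟩ := hx
        obtain ⟨Y, rfl, hY⟩ := hy
        exact ⟨X + Y, map_add _ _ _, by rw [map_add, hX, hY, add_zero]⟩
      | mul x y _ _ hx hy =>
        obtain ⟨X, rfl, hX⟩ := hx
        obtain ⟨Y, rfl, hY⟩ := hy
        exact ⟨X * Y, map_mul _ _ _, by rw [dualGen_mul, hX, hY, zero_mul, mul_zero, add_zero]⟩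
    rw [map_sub, h1] at h2
    exact sub_eq_zero.mp h2
  · rw [if_neg h]
    exact dualGen_eq_zero_of_mem_degreePart h hφ hB.mem_degreePart

/-- Evaluating the coproduct of a primitive element shows that the twisted derivation dual to `F_ι`
is also dual to `b_ι`. -/
theorem projDer_of_isPrimitive (ι : IInf V) {φ : UMinus V →ₗ[Kv] Kv}
    (hφ : ∀ x, φ (proj V x) = dualGen ι x) {x : FreeU V} {y : UMinus V}
    (hx : TensorProduct.map (proj V).toLinearMap (proj V).toLinearMap (coprod x) =
      y ⊗ₜ[Kv] 1 + 1 ⊗ₜ[Kv] y) : projDer ι x = φ y • 1 := by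
  have hslice : ∀ X : FreeU V ⊗[Kv] FreeU V, slice φ
      (TensorProduct.map (proj V).toLinearMap (proj V).toLinearMap X) =
        proj V (slice (dualGen ι) X) := by
    intro X
    induction X using TensorProduct.induction_on with
    | zero => simp
    | add x y hx hy => rw [map_add, map_add, hx, hy, map_add, map_add]
    | tmul c d =>
      rw [TensorProduct.map_tmul, slice_tmul, slice_tmul, map_smul, AlgHom.toLinearMap_apply,
        AlgHom.toLinearMap_apply, hφ]
  have h1 : φ 1 = 0 := by rw [← map_one (proj V), hφ, dualGen_one]
  rw [projDer_eq, ← slice_dualGen_coprod, ← hslice, hx, map_add, slice_tmul, slice_tmul, h1,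
    zero_smul, add_zero]

theorem exists_isTwistedDerivation (ι : IInf V) : ∃ e, IsTwistedDerivation ι e := by
  classical
  obtain ⟨D, hD⟩ := exists_twistDer_lift _ _ _ (proj_twist_rel (-ι.weight)) proj_rel
    (projDer_rel ι)
  replace hD : ∀ x, D (proj V x) = projDer ι x := hD
  have hgen : ∀ κ w, D (F κ * w) = proj V (derGen ι κ) * w + v ^ ι.pairing κ • (F κ * D w) := by
    intro κ w
    obtain ⟨W, rfl⟩ := proj_surjective w
    rw [F, ← map_mul, hD, hD, projDer_mul, projDer_freeF, twist_freeF, form_neg_weight, map_smul,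
      smul_mul_assoc]
  have hD1 : D 1 = 0 := by
    rw [← map_one (proj V), hD]
    exact twistDer_one _ _ _
  refine ⟨D, ⟨fun d y z hy => ?_, fun κ => ?_⟩⟩
  · revert z
    refine wordSpan_induction (k := Kv) (g := F) (h := fun ι : IInf V => -ι.weight)
      (P := fun d y => ∀ z, D (y * z) = D y * z + v ^ form (-ι.weight) d • (y * D z))
      (fun z => ?_) (fun κ d x _ ih z => ?_) (fun d z => ?_) (fun d x y hx hy z => ?_)
      (fun d r x hx z => ?_) hy
    · rw [hD1, one_mul, one_mul, zero_mul, zero_add, form_zero_right, zpow_zero, one_smul]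
    · rw [mul_assoc, hgen, ih, hgen, form_add_right, form_neg_weight, zpow_add₀ v_ne_zero, mul_add,
        smul_add, add_mul, mul_smul_comm, smul_smul, smul_mul_assoc, mul_assoc, mul_assoc,
        mul_assoc, add_assoc]
    · rw [zero_mul, map_zero, zero_mul, zero_mul, smul_zero, add_zero]
    · rw [add_mul, map_add, map_add, hx, hy, add_mul, add_mul, smul_add]
      abel
    · rw [smul_mul_assoc, map_smul, map_smul, hx, smul_add, smul_mul_assoc, smul_mul_assoc,
        smul_comm r]
  · cases κ with
    | re j hj =>
      rw [b, F, hD, projDer_freeF]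
      cases ι with
      | re k hk =>
        by_cases h : IInf.re k hk = .re j hj
        · rw [if_pos h, ← h, derGen_re, map_one]
        · rw [if_neg h, derGen_re_of_ne (Ne.symm h), map_zero]
      | im i hi l =>
        rw [if_neg (by simp)]
        exact map_zero _
    | im i hi l =>
      obtain ⟨φ, hφ⟩ := exists_dualGen_lift ι
      obtain ⟨x, hx, hprim⟩ := (isBozecElement_b i hi l).primitive
      rw [← hx, hD, projDer_of_isPrimitive ι hφ hprim, dualGen_b ι i hi l hφ]
      split_ifs
      · rw [one_smul]
      · rw [zero_smul]

theorem isTwistedDerivation_ePrime (ι : IInf V) : IsTwistedDerivation ι (ePrime ι) :=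
  Classical.epsilon_spec (exists_isTwistedDerivation ι)

end Existence

/-! ### The boson relations in `U^-` -/

section UMinusBosons

variable {V : Type u} [Quiver.{w + 1} V]

/-- The vertex supporting an index. -/
def IInf.vertex : IInf V → V
  | .re j _ => j
  | .im i _ _ => i

theorem IInf.eq_re_of_vertex_eq {j : V} {hj : IsRealVertex j} {μ : IInf V}
    (h : μ.vertex = j) : μ = .re j hj := by
  cases μ with
  | re k hk => obtain rfl : k = j := h; rfl
  | im i hi l => obtain rfl : i = j := h; exact absurd hj hi

theorem IInf.exists_eq_im_of_vertex_eq {i : V} {hi : IsImagVertex i} {μ : IInf V}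
    (h : μ.vertex = i) : ∃ l, μ = .im i hi l := by
  cases μ with
  | re k hk => obtain rfl : k = i := h; exact absurd hk hi
  | im i' hi' l => obtain rfl : i' = i := h; exact ⟨l, rfl⟩

theorem IInf.exists_pairing_eq (ι κ : IInf V) :
    ∃ r : ℤ, r ≠ 0 ∧ ι.pairing κ = r * vertexForm ι.vertex κ.vertex := by
  cases ι with
  | re j hj =>
    cases κ with
    | re k hk => exact ⟨1, one_ne_zero, by rw [pairing_re_re, one_mul]; rfl⟩
    | im i hi l => exact ⟨l, by exact_mod_cast l.ne_zero, pairing_re_im _ _ _ _ _⟩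
  | im i hi l =>
    cases κ with
    | re k hk =>
      refine ⟨l, by exact_mod_cast l.ne_zero, ?_⟩
      rw [IInf.pairing_comm, pairing_re_im, vertexForm_comm]
      rfl
    | im i' hi' l' =>
      exact ⟨l * l', by exact_mod_cast (mul_ne_zero l.ne_zero l'.ne_zero),
        pairing_im_im _ _ _ _ _ _⟩

theorem IInf.pairing_eq_zero_iff (ι κ : IInf V) :
    ι.pairing κ = 0 ↔ vertexForm ι.vertex κ.vertex = 0 := by
  obtain ⟨r, hr, h⟩ := ι.exists_pairing_eq κ
  rw [h, mul_eq_zero, or_iff_right hr]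

theorem F_mem_adjoin_b (κ : IInf V) : F κ ∈ Algebra.adjoin Kv (Set.range (b (V := V))) := by
  cases κ with
  | re j hj => exact Algebra.subset_adjoin ⟨.re j hj, rfl⟩
  | im i hi l =>
    induction l using PNat.strongInductionOn with
    | _ l ih =>
      have h1 : b (.im i hi l) - F (.im i hi l) ∈ Algebra.adjoin Kv (Set.range (b (V := V))) := by
        refine (Algebra.adjoin_le ?_ : Algebra.adjoin Kv
          {x | ∃ k : ℕ+, k < l ∧ x = F (.im i hi k)} ≤ _) (isBozecElement_b i hi l).sub_mem
        rintro _ ⟨k, hk, rfl⟩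
        exact ih k hk
      rw [← sub_sub_cancel (b (.im i hi l)) (F (.im i hi l))]
      exact Subalgebra.sub_mem _ (Algebra.subset_adjoin ⟨_, rfl⟩) h1

theorem adjoin_b : Algebra.adjoin Kv (Set.range (b (V := V))) = ⊤ := by
  rw [eq_top_iff]
  intro x _
  obtain ⟨X, rfl⟩ := proj_surjective x
  induction X using FreeAlgebra.induction with
  | grade0 r => rw [AlgHom.commutes]; exact Subalgebra.algebraMap_mem _ r
  | grade1 κ => exact F_mem_adjoin_b κ
  | mul x y hx hy => rw [map_mul]; exact Subalgebra.mul_mem _ (hx trivial) (hy trivial)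
  | add x y hx hy => rw [map_add]; exact Subalgebra.add_mem _ (hx trivial) (hy trivial)

theorem b_mem_degreePart (κ : IInf V) : b κ ∈ degreePart (-κ.weight) := by
  cases κ with
  | re j hj =>
    exact apply_mem_wordSpan (k := Kv) (g := F) (h := fun ι : IInf V => -ι.weight) (.re j hj)
  | im i hi l => exact (isBozecElement_b i hi l).mem_degreePart

open Classical in
theorem ePrime_b_mul (ι κ : IInf V) (z : UMinus V) : ePrime ι (b κ * z) =
    (if ι = κ then z else 0) + v ^ ι.pairing κ • (b κ * ePrime ι z) := by
  have h := isTwistedDerivation_ePrime ι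
  rw [h.map_mul _ _ _ (b_mem_degreePart κ), h.map_b, form_neg_weight]
  split_ifs
  · rw [one_mul]
  · rw [zero_mul]

theorem ePrime_one (ι : IInf V) : ePrime ι 1 = 0 := by
  have h := (isTwistedDerivation_ePrime ι).map_mul 0 1 1
    (one_mem_wordSpan (k := Kv) (g := F) (h := fun ι : IInf V => -ι.weight))
  rw [one_mul, one_mul, mul_one, form_zero_right, zpow_zero, one_smul] at h
  exact left_eq_add.mp h

/-- The derivations of orthogonal indices commute, as they do on words in the `b_κ`. -/
theorem ePrime_comm {ι κ : IInf V} (h : ι.pairing κ = 0) (x : UMinus V) :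
    ePrime ι (ePrime κ x) = ePrime κ (ePrime ι x) := by
  induction x using induction_of_adjoin_eq_top adjoin_b with
  | one => rw [ePrime_one, ePrime_one, map_zero, map_zero]
  | zero => simp only [map_zero]
  | add x y hx hy => simp only [map_add, hx, hy]
  | smul r x hx => simp only [map_smul, hx]
  | mul μ x hx =>
    classical
    -- The twist occurs only where it is trivial by orthogonality.
    have h1 : ∀ ι κ : IInf V, ι.pairing κ = 0 →
        (if κ = μ then v ^ ι.pairing μ • ePrime ι x else 0) =
          if κ = μ then ePrime ι x else 0 := by
      rintro ι κ h0
      split_ifs with hκ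
      · subst hκ; rw [h0, zpow_zero, one_smul]
      · rfl
    have h2 : ∀ ι κ : IInf V, ι.pairing κ = 0 → ePrime ι (ePrime κ (b μ * x)) =
        (if κ = μ then ePrime ι x else 0) + ((if ι = μ then ePrime κ x else 0) +
          (v ^ κ.pairing μ * v ^ ι.pairing μ) • (b μ * ePrime ι (ePrime κ x))) := by
      intro ι κ h0
      have h3 := h1 κ ι ((IInf.pairing_comm κ ι).trans h0)
      rw [ePrime_b_mul, map_add, map_smul, ePrime_b_mul, smul_add, smul_smul, smul_ite, smul_zero,
        h3, apply_ite (ePrime ι), map_zero]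
    rw [h2 ι κ h, h2 κ ι ((IInf.pairing_comm κ ι).trans h), hx, mul_comm (v ^ κ.pairing μ),
      add_left_comm]

/-- The generators `F_μ` attached to the vertex of `κ` generate a subalgebra containing `b_κ`. -/
theorem b_mem_adjoin_vertex (κ : IInf V) :
    b κ ∈ Algebra.adjoin Kv {x | ∃ μ : IInf V, μ.vertex = κ.vertex ∧ x = F μ} := by
  cases κ with
  | re j hj =>
    refine Algebra.subset_adjoin ?_
    exact ⟨.re j hj, rfl, rfl⟩
  | im i hi l =>
    rw [← sub_add_cancel (b (.im i hi l)) (F (.im i hi l))]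
    refine Subalgebra.add_mem _ (Algebra.adjoin_mono ?_ (isBozecElement_b i hi l).sub_mem)
      (Algebra.subset_adjoin ?_)
    · rintro _ ⟨k, -, rfl⟩
      exact ⟨.im i hi k, rfl, rfl⟩
    · exact ⟨.im i hi l, rfl, rfl⟩

theorem b_comm {ι κ : IInf V} (h : ι.pairing κ = 0) : Commute (b ι) (b κ) := by
  refine Algebra.commute_of_mem_adjoin_of_forall_mem_commute (b_mem_adjoin_vertex κ) ?_
  rintro _ ⟨μ, hμ, rfl⟩
  refine (Algebra.commute_of_mem_adjoin_of_forall_mem_commute (b_mem_adjoin_vertex ι) ?_).symm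
  rintro _ ⟨ν, hν, rfl⟩
  refine F_mul_comm ?_
  rw [IInf.pairing_eq_zero_iff] at h ⊢
  rw [hμ, hν, vertexForm_comm, h]

/-- The part of `U^-` spanned by the words in the `b_κ` of degree `d` in the vertex `i`. -/
abbrev vertexDegree (i : V) (d : ℤ) : Submodule Kv (UMinus V) :=
  wordSpan Kv b (fun κ : IInf V => κ.weight i) d

theorem weight_nonneg (i : V) (κ : IInf V) : 0 ≤ κ.weight i := by
  classical
  cases κ with
  | re j hj => rw [IInf.weight, Finsupp.single_apply]; split_ifs <;> simp
  | im i hi l => rw [IInf.weight, Finsupp.single_apply]; split_ifs <;> simp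

theorem ePrime_mem (i : V) (ι : IInf V) {d : ℤ} {u : UMinus V} (hu : u ∈ vertexDegree i d) :
    ePrime ι u ∈ vertexDegree i (d - ι.weight i) := by
  classical
  refine wordSpan_induction (P := fun d u => ePrime ι u ∈ vertexDegree i (d - ι.weight i)) ?_
    (fun κ d x hx ih => ?_) (fun d => ?_) (fun d x y hx hy => ?_) (fun d r x hx => ?_) hu
  · rw [ePrime_one]; exact Submodule.zero_mem _
  · rw [ePrime_b_mul]
    refine Submodule.add_mem _ ?_ (Submodule.smul_mem _ _ ?_)
    · split_ifs with h
      · subst h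
        rwa [add_sub_cancel_left]
      · exact Submodule.zero_mem _
    · rw [add_sub_assoc]
      exact mul_mem_wordSpan (apply_mem_wordSpan (h := fun κ : IInf V => κ.weight i) κ) ih
  · rw [map_zero]; exact Submodule.zero_mem _
  · rw [map_add]; exact Submodule.add_mem _ hx hy
  · rw [map_smul]; exact Submodule.smul_mem _ _ hx

theorem b_mul_mem (i : V) (κ : IInf V) {d : ℤ} {u : UMinus V} (hu : u ∈ vertexDegree i d) :
    b κ * u ∈ vertexDegree i (d + κ.weight i) := by
  rw [add_comm]
  exact mul_mem_wordSpan (apply_mem_wordSpan (h := fun κ : IInf V => κ.weight i) κ) hu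

theorem iSup_vertexDegree (i : V) : ⨆ d, vertexDegree i d = ⊤ := iSup_wordSpan adjoin_b

/-- At an imaginary vertex the boson relations hold with `q = v ^ (i, i) = v_i ^ 2`. -/
theorem bosonSystem_im (i : V) (hi : IsImagVertex i) :
    BosonSystem (id : ℕ+ → ℕ+) (vi i ^ 2) (vertexDegree i)
      (fun l => LinearMap.mulLeft Kv (b (.im i hi l))) (fun l => ePrime (.im i hi l)) where
  inj := Function.injective_id
  W_neg := wordSpan_eq_bot (weight_nonneg i)
  b_mem l d u hu := by
    have := b_mul_mem i (.im i hi l) hu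
    rwa [IInf.weight, Finsupp.single_eq_same] at this
  e_mem l d u hu := by
    have := ePrime_mem i (.im i hi l) hu
    rwa [IInf.weight, Finsupp.single_eq_same] at this
  comm l m z := by
    rw [LinearMap.mulLeft_apply, LinearMap.mulLeft_apply, ePrime_b_mul]
    congr 1
    · by_cases h : l = m
      · subst h; simp
      · rw [if_neg h, if_neg]
        intro h'
        injection h' with _ h'
        exact h h'
    · congr 1
      rw [pairing_im_im, vertexForm_self, vi, ← zpow_natCast, ← zpow_natCast, ← zpow_mul,
        ← zpow_mul]
      congr 1
      push_cast
      simp only [id]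
      ring

end UMinusBosons

/-! ### Kashiwara decompositions -/

section Kashiwara

variable {V : Type u} [Quiver.{w + 1} V]

/-- Every `u` is uniquely a finite sum `∑ a c * z c` with all `z c` in `K`. -/
structure IsDecomposition {C : Type} (K : Submodule Kv (UMinus V)) (a : C → UMinus V) : Prop where
  exists_sum : ∀ u, ∃ z : C →₀ UMinus V, (∀ c, z c ∈ K) ∧ u = z.sum fun c x => a c * x
  unique : ∀ z z' : C →₀ UMinus V, (∀ c, z c ∈ K) → (∀ c, z' c ∈ K) →
    (z.sum fun c x => a c * x) = (z'.sum fun c x => a c * x) → z = z'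

theorem DecompSystem.isDecomposition {C : Type} {K : Submodule Kv (UMinus V)}
    {W : ℤ → Submodule Kv (UMinus V)} {deg : C → ℕ} {B E : C → Module.End Kv (UMinus V)}
    {T : C → C → Kv} (h : DecompSystem K W deg B E T) (hW : ⨆ d, W d = ⊤) {a : C → UMinus V}
    (ha : ∀ c z, B c z = a c * z) : IsDecomposition K a where
  exists_sum u := by
    obtain ⟨z, hz, hu⟩ := h.exists_decomp_of_iSup hW u
    exact ⟨z, hz, by simpa only [ha] using hu⟩
  unique z z' hz hz' he := h.unique hz hz' (by simpa only [ha] using he)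

theorem raise_mulLeft {A : Type*} [Ring A] [Algebra Kv A] (f : ℕ+ → A) (c : List ℕ+) (z : A) :
    raise (fun l => LinearMap.mulLeft Kv (f l)) c z = (c.map f).prod * z := by
  induction c with
  | nil => simp
  | cons l c ih => rw [raise_cons, ih, List.map_cons, List.prod_cons, mul_assoc]; rfl

theorem isDecomposition_re (j : V) (hj : IsRealVertex j) :
    IsDecomposition (kerRe j hj) (divPow (F (.re j hj))) := by
  have hw : (IInf.re j hj).weight j = 1 := Finsupp.single_eq_same
  obtain ⟨T, hT⟩ := exists_decompSystem_powers (k := Kv) (M := UMinus V)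
    (b := LinearMap.mulLeft Kv (F (.re j hj))) (e := ePrime (.re j hj)) (q := v ^ 2)
    (W := vertexDegree j) (wordSpan_eq_bot (weight_nonneg j))
    (fun d u hu => hw ▸ b_mul_mem j (.re j hj) hu)
    (fun d u hu => by simpa only [hw] using ePrime_mem j (.re j hj) hu)
    (fun z => by
      have := ePrime_b_mul (.re j hj) (.re j hj) z
      rw [if_pos rfl, pairing_re_re, vertexForm_self, show loops j = 0 from hj] at this
      exact this)
    (fun n h0 => by
      have h1 := geom_sum_mul (v ^ 2) (n + 1)
      rw [h0, zero_mul, ← pow_mul] at h1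
      refine (RatFunc.transcendental_X (K := ℂ)).pow (n := 2 * (n + 1)) (by omega) ?_
      rw [show RatFunc.X ^ (2 * (n + 1)) = (1 : Kv) from (sub_eq_zero.mp h1.symm)]
      exact isAlgebraic_one)
    (fun n => (qFactorial n)⁻¹) (fun n => inv_ne_zero (qFactorial_ne_zero n))
  refine hT.isDecomposition (iSup_vertexDegree j) fun n z => ?_
  rw [LinearMap.smul_apply, LinearMap.pow_mulLeft, LinearMap.mulLeft_apply, divPow, smul_mul_assoc]

theorem isDecomposition_comp (i : V) (hi : IsImagVertex i) (h : ¬ IsIsotropic i) :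
    IsDecomposition (kerIm i hi) (bList i hi) := by
  have h1 : 1 < loops i := lt_of_le_of_ne (loops_pos hi) (Ne.symm h)
  obtain ⟨T, hT⟩ := (bosonSystem_im i hi).exists_decompSystem_words
    fun p hp => generic_vi_sq h1 p hp
  exact hT.isDecomposition (iSup_vertexDegree i) fun c z => raise_mulLeft _ c z

theorem pairing_of_isotropic {i : V} (hi : IsImagVertex i) (h : IsIsotropic i) (l m : ℕ+) :
    (IInf.im i hi l).pairing (.im i hi m) = 0 := by
  rw [pairing_im_im, vertexForm_self, show loops i = 1 from h]
  simp

theorem isDecomposition_part (i : V) (hi : IsImagVertex i) (h : IsIsotropic i) :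
    IsDecomposition (kerIm i hi) (bMultiset i hi) := by
  have hsys := bosonSystem_im i hi
  have hq : vi i ^ 2 = 1 := by
    rw [vi, show loops i = 1 from h]; simp
  rw [hq] at hsys
  obtain ⟨T, hT⟩ := hsys.exists_decompSystem_multisets
    (fun l m z => by
      simp only [LinearMap.mulLeft_apply]
      rw [← mul_assoc, ← mul_assoc, (b_comm (pairing_of_isotropic hi h l m)).eq])
    (fun l m z => ePrime_comm (pairing_of_isotropic hi h l m) z)
    (fun c => c.sort (· ≤ ·)) (fun c => Multiset.sort_eq c _)
  exact hT.isDecomposition (iSup_vertexDegree i) fun c z => raise_mulLeft _ _ z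

/-- The map `f` replaces `a c` by `a' c` in decompositions along `K`. -/
def Replaces {C : Type} (K : Submodule Kv (UMinus V)) (a a' : C → UMinus V)
    (f : UMinus V → UMinus V) : Prop :=
  ∀ z : C →₀ UMinus V, (∀ c, z c ∈ K) →
    f (z.sum fun c x => a c * x) = z.sum fun c x => a' c * x

namespace Replaces

variable {C : Type} {K : Submodule Kv (UMinus V)} {a a' : C → UMinus V}
  {f : UMinus V → UMinus V}

theorem map_mul (hf : Replaces K a a' f) {c : C} {z : UMinus V} (hz : z ∈ K) :
    f (a c * z) = a' c * z := by
  classical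
  have h := hf (Finsupp.single c z) fun d => by
    rw [Finsupp.single_apply]
    split_ifs
    · exact hz
    · exact K.zero_mem
  rwa [Finsupp.sum_single_index (mul_zero _), Finsupp.sum_single_index (mul_zero _)] at h

theorem map_add (hf : Replaces K a a' f) (ha : IsDecomposition K a) (x y : UMinus V) :
    f (x + y) = f x + f y := by
  obtain ⟨z, hz, rfl⟩ := ha.exists_sum x
  obtain ⟨z', hz', rfl⟩ := ha.exists_sum y
  rw [hf z hz, hf z' hz', ← Finsupp.sum_add_index' (fun c => mul_zero _) (fun c => mul_add _),
    ← Finsupp.sum_add_index' (fun c => mul_zero _) (fun c => mul_add _)]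
  exact hf _ fun c => K.add_mem (hz c) (hz' c)

theorem map_zero (hf : Replaces K a a' f) : f 0 = 0 := by
  simpa using hf 0 fun c => K.zero_mem

end Replaces

/-- An additive property holds everywhere as soon as it holds on the products `a c * z`, `z` in
`K`. -/
theorem IsDecomposition.induction {C : Type} {K : Submodule Kv (UMinus V)} {a : C → UMinus V}
    (ha : IsDecomposition K a) {P : UMinus V → Prop} (zero : P 0)
    (add : ∀ x y, P x → P y → P (x + y)) (mul : ∀ c, ∀ z ∈ K, P (a c * z)) (u : UMinus V) :
    P u := by
  obtain ⟨z, hz, rfl⟩ := ha.exists_sum u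
  exact Finset.sum_induction _ P add zero fun c _ => mul c _ (hz c)

/-- An operator commuting with the coefficients of a decomposition and preserving `K` kills the
components of the elements that it kills. -/
theorem IsDecomposition.component_mem_ker {C : Type} {K : Submodule Kv (UMinus V)}
    {a : C → UMinus V} (ha : IsDecomposition K a) (e : UMinus V →ₗ[Kv] UMinus V)
    (hea : ∀ c x, e (a c * x) = a c * e x) (heK : ∀ x ∈ K, e x ∈ K) {z : C →₀ UMinus V}
    (hz : ∀ c, z c ∈ K) (h0 : e (z.sum fun c x => a c * x) = 0) (c : C) : e (z c) = 0 := by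
  have h1 : z.mapRange e (map_zero e) = 0 := by
    refine ha.unique _ _ (fun c => ?_) (fun c => K.zero_mem) ?_
    · rw [Finsupp.mapRange_apply]
      exact heK _ (hz c)
    · rw [Finsupp.sum_mapRange_index (fun c => mul_zero _), Finsupp.sum_zero_index, ← h0,
        Finsupp.sum, Finsupp.sum, map_sum]
      exact Finset.sum_congr rfl fun c _ => (hea c _).symm
  have := DFunLike.congr_fun h1 c
  rwa [Finsupp.mapRange_apply] at this

theorem fTilde_re (j : V) (hj : IsRealVertex j) :
    Replaces (kerRe j hj) (divPow (F (.re j hj))) (fun n => divPow (F (.re j hj)) (n + 1))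
      (fTilde (.re j hj)) := by
  intro z hz
  have hex : ∃ z', IsDecompRe j hj (z.sum fun c x => divPow (F (.re j hj)) c * x) z' :=
    ⟨z, hz, rfl⟩
  have hsp := Classical.epsilon_spec hex
  have := (isDecomposition_re j hj).unique _ _ hz hsp.1 hsp.2
  rw [fTilde, ← this]

theorem fTilde_comp (i : V) (hi : IsImagVertex i) (h : ¬ IsIsotropic i) (l : ℕ+) :
    Replaces (kerIm i hi) (bList i hi) (fun c => bList i hi (l :: c)) (fTilde (.im i hi l)) := by
  intro z hz
  have hex : ∃ z', IsDecompComp i hi (z.sum fun c x => bList i hi c * x) z' := ⟨z, hz, rfl⟩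
  have hsp := Classical.epsilon_spec hex
  have := (isDecomposition_comp i hi h).unique _ _ hz hsp.1 hsp.2
  rw [fTilde, if_neg h, ← this]

/-- The normalization `√(l / (m_l(λ) + 1))` in the isotropic case. -/
def isoCoeff (l : ℕ+) (c : Multiset ℕ+) : Kv :=
  algebraMap ℂ Kv ((Real.sqrt ((l : ℝ) / ((c.count l : ℝ) + 1)) : ℝ) : ℂ)

theorem fTilde_part (i : V) (hi : IsImagVertex i) (h : IsIsotropic i) (l : ℕ+) :
    Replaces (kerIm i hi) (bMultiset i hi) (fun c => isoCoeff l c • bMultiset i hi (l ::ₘ c))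
      (fTilde (.im i hi l)) := by
  intro z hz
  have hex : ∃ z', IsDecompPart i hi (z.sum fun c x => bMultiset i hi c * x) z' := ⟨z, hz, rfl⟩
  have hsp := Classical.epsilon_spec hex
  have := (isDecomposition_part i hi h).unique _ _ hz hsp.1 hsp.2
  rw [fTilde, if_pos h, ← this]
  refine Finsupp.sum_congr fun c _ => ?_
  rw [smul_mul_assoc, isoCoeff]

/-- The common kernel of the derivations attached to the vertex of `ι`. -/
def vertexKer (ι : IInf V) : Submodule Kv (UMinus V) :=
  ⨅ μ : {μ : IInf V // μ.vertex = ι.vertex}, LinearMap.ker (ePrime μ.1)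

theorem mem_vertexKer {ι : IInf V} {x : UMinus V} :
    x ∈ vertexKer ι ↔ ∀ μ : IInf V, μ.vertex = ι.vertex → ePrime μ x = 0 := by
  simp [vertexKer, Submodule.mem_iInf]

theorem vertexKer_re (j : V) (hj : IsRealVertex j) : vertexKer (.re j hj) = kerRe j hj := by
  ext x
  rw [mem_vertexKer, kerRe, LinearMap.mem_ker]
  refine ⟨fun h => h _ rfl, fun h μ hμ => ?_⟩
  obtain rfl := IInf.eq_re_of_vertex_eq (hj := hj) hμ
  exact h

theorem vertexKer_im (i : V) (hi : IsImagVertex i) (l : ℕ+) :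
    vertexKer (.im i hi l) = kerIm i hi := by
  ext x
  rw [mem_vertexKer, kerIm, Submodule.mem_iInf]
  refine ⟨fun h m => h _ rfl, fun h μ hμ => ?_⟩
  obtain ⟨m, rfl⟩ := IInf.exists_eq_im_of_vertex_eq (hi := hi) hμ
  exact h m

/-- The subalgebra generated by the `b_μ` attached to the vertex of `ι`. -/
def vertexAlg (ι : IInf V) : Subalgebra Kv (UMinus V) :=
  Algebra.adjoin Kv {x | ∃ μ : IInf V, μ.vertex = ι.vertex ∧ x = b μ}

theorem b_mem_vertexAlg {ι μ : IInf V} (h : μ.vertex = ι.vertex) : b μ ∈ vertexAlg ι :=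
  Algebra.subset_adjoin ⟨μ, h, rfl⟩

theorem bList_mem (i : V) (hi : IsImagVertex i) (l : ℕ+) (c : List ℕ+) :
    bList i hi c ∈ vertexAlg (.im i hi l) := by
  refine Subalgebra.list_prod_mem _ fun x hx => ?_
  obtain ⟨m, -, rfl⟩ := List.mem_map.mp hx
  exact b_mem_vertexAlg rfl

theorem divPow_mem (j : V) (hj : IsRealVertex j) (n : ℕ) :
    divPow (F (.re j hj)) n ∈ vertexAlg (.re j hj) :=
  Subalgebra.smul_mem _ (Subalgebra.pow_mem _ (b_mem_vertexAlg (μ := .re j hj) rfl) n) _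

/-- All Kashiwara operators have the same shape: they replace the coefficients of a decomposition
along the common kernel of the derivations at a vertex, the coefficients lying in the subalgebra
attached to that vertex. -/
theorem exists_replaces_fTilde (ι : IInf V) : ∃ (C : Type) (a a' : C → UMinus V),
    (∀ c, a c ∈ vertexAlg ι) ∧ (∀ c, a' c ∈ vertexAlg ι) ∧
      IsDecomposition (vertexKer ι) a ∧ Replaces (vertexKer ι) a a' (fTilde ι) := by
  cases ι with
  | re j hj =>
    rw [vertexKer_re]
    exact ⟨ℕ, _, _, divPow_mem j hj, fun n => divPow_mem j hj (n + 1), isDecomposition_re j hj,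
      fTilde_re j hj⟩
  | im i hi l =>
    rw [vertexKer_im]
    by_cases h : IsIsotropic i
    · exact ⟨Multiset ℕ+, _, _, fun c => bList_mem i hi l _,
        fun c => Subalgebra.smul_mem _ (bList_mem i hi l _) _, isDecomposition_part i hi h,
        fTilde_part i hi h l⟩
    · exact ⟨List ℕ+, _, _, fun c => bList_mem i hi l _, fun c => bList_mem i hi l _,
        isDecomposition_comp i hi h, fTilde_comp i hi h l⟩

section Orthogonal

variable {ι κ : IInf V} (h : ι.pairing κ = 0)
include h

theorem pairing_eq_zero_of_vertex_eq {μ ν : IInf V} (hμ : μ.vertex = ι.vertex)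
    (hν : ν.vertex = κ.vertex) : μ.pairing ν = 0 := by
  rw [IInf.pairing_eq_zero_iff] at h ⊢
  rw [hμ, hν, h]

theorem commute_of_mem_vertexAlg {x y : UMinus V} (hx : x ∈ vertexAlg ι) (hy : y ∈ vertexAlg κ) :
    Commute x y := by
  refine Algebra.commute_of_mem_adjoin_of_forall_mem_commute hy ?_
  rintro _ ⟨ν, hν, rfl⟩
  refine (Algebra.commute_of_mem_adjoin_of_forall_mem_commute hx ?_).symm
  rintro _ ⟨μ, hμ, rfl⟩
  exact (b_comm (pairing_eq_zero_of_vertex_eq h hμ hν)).symm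

theorem ePrime_mul_of_mem_vertexAlg (hne : ι.vertex ≠ κ.vertex) {μ : IInf V}
    (hμ : μ.vertex = ι.vertex) {y : UMinus V} (hy : y ∈ vertexAlg κ) (x : UMinus V) :
    ePrime μ (y * x) = y * ePrime μ x := by
  induction hy using Algebra.adjoin_induction generalizing x with
  | mem y hy =>
    obtain ⟨ν, hν, rfl⟩ := hy
    rw [ePrime_b_mul, if_neg (by rintro rfl; exact hne (hμ.symm.trans hν)),
      pairing_eq_zero_of_vertex_eq h hμ hν, zpow_zero, one_smul, zero_add]
  | algebraMap r => rw [← Algebra.smul_def, map_smul, Algebra.smul_def]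
  | add y z _ _ hy hz => rw [add_mul, map_add, hy, hz, add_mul]
  | mul y z _ _ hy hz => rw [mul_assoc, hy, hz, mul_assoc]

theorem mul_mem_vertexKer (hne : ι.vertex ≠ κ.vertex) {y x : UMinus V} (hy : y ∈ vertexAlg κ)
    (hx : x ∈ vertexKer ι) : y * x ∈ vertexKer ι := by
  rw [mem_vertexKer] at hx ⊢
  intro μ hμ
  rw [ePrime_mul_of_mem_vertexAlg h hne hμ hy, hx μ hμ, mul_zero]

theorem ePrime_mem_vertexKer {μ : IInf V} (hμ : μ.vertex = ι.vertex) {x : UMinus V}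
    (hx : x ∈ vertexKer κ) : ePrime μ x ∈ vertexKer κ := by
  rw [mem_vertexKer] at hx ⊢
  intro ν hν
  rw [← ePrime_comm (pairing_eq_zero_of_vertex_eq h hμ hν), hx ν hν, map_zero]

/-- For orthogonal vertices, the components of an element of one kernel in the decomposition along
the other kernel lie in the first kernel. -/
theorem component_mem_vertexKer (hne : ι.vertex ≠ κ.vertex) {C : Type} {a : C → UMinus V}
    (ha : ∀ c, a c ∈ vertexAlg κ) (hdec : IsDecomposition (vertexKer κ) a) {z : C →₀ UMinus V}
    (hz : ∀ c, z c ∈ vertexKer κ) (hu : (z.sum fun c x => a c * x) ∈ vertexKer ι) (c : C) :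
    z c ∈ vertexKer ι :=
  mem_vertexKer.mpr fun μ hμ => hdec.component_mem_ker (ePrime μ)
    (fun c x => ePrime_mul_of_mem_vertexAlg h hne hμ (ha c) x)
    (fun _ hx => ePrime_mem_vertexKer h hμ hx) hz (mem_vertexKer.mp hu μ hμ) c

/-- For orthogonal vertices it suffices to compare the operators on products `a c * d e * z`, with
`a`, `d` the coefficients of the two decompositions and `z` in both kernels; there they act on
commuting factors. -/
theorem fTilde_comm_of_ne (hne : ι.vertex ≠ κ.vertex) (u : UMinus V) :
    fTilde ι (fTilde κ u) = fTilde κ (fTilde ι u) := by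
  obtain ⟨C, a, a', ha, ha', hdec, hf⟩ := exists_replaces_fTilde ι
  obtain ⟨D, d, d', hd, hd', hdec', hf'⟩ := exists_replaces_fTilde κ
  have h' : κ.pairing ι = 0 := (IInf.pairing_comm κ ι).trans h
  refine hdec.induction (P := fun u => fTilde ι (fTilde κ u) = fTilde κ (fTilde ι u)) ?_
    (fun x y hx hy => ?_) (fun c z hz => ?_) u
  · rw [hf.map_zero, hf'.map_zero, hf.map_zero]
  · rw [hf.map_add hdec, hf'.map_add hdec', hf.map_add hdec, hf'.map_add hdec', hx, hy]
  · obtain ⟨y, hy, rfl⟩ := hdec'.exists_sum z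
    have hyι := component_mem_vertexKer h hne hd hdec' hy hz
    rw [Finsupp.sum, Finset.mul_sum]
    refine Finset.sum_induction _ (fun u => fTilde ι (fTilde κ u) = fTilde κ (fTilde ι u))
      (fun x y hx hy => ?_) ?_ fun e _ => ?_
    · rw [hf.map_add hdec, hf'.map_add hdec', hf.map_add hdec, hf'.map_add hdec', hx, hy]
    · rw [hf.map_zero, hf'.map_zero, hf.map_zero]
    · have key : ∀ {x y : UMinus V}, x ∈ vertexAlg ι → y ∈ vertexAlg κ → ∀ z,
          x * (y * z) = y * (x * z) := fun hx hy z => by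
        rw [← mul_assoc, (commute_of_mem_vertexAlg h hx hy).eq, mul_assoc]
      rw [hf.map_mul (mul_mem_vertexKer h hne (hd e) (hyι e)), key (ha c) (hd e),
        hf'.map_mul (mul_mem_vertexKer h' hne.symm (ha c) (hy e)), ← key (ha c) (hd' e),
        hf.map_mul (mul_mem_vertexKer h hne (hd' e) (hyι e)), key (ha' c) (hd' e),
        key (ha' c) (hd e), hf'.map_mul (mul_mem_vertexKer h' hne.symm (ha' c) (hy e))]

end Orthogonal

/-- At an isotropic vertex, the coefficient of the operator for `l` depends only on the number of
parts equal to `l`, which the operator for `m ≠ l` does not change. -/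
theorem fTilde_comm_of_isotropic (i : V) (hi : IsImagVertex i) (h : IsIsotropic i) {l m : ℕ+}
    (hlm : l ≠ m) (u : UMinus V) :
    fTilde (.im i hi l) (fTilde (.im i hi m) u) = fTilde (.im i hi m) (fTilde (.im i hi l) u) := by
  have hdec := isDecomposition_part i hi h
  have hf := fTilde_part i hi h
  refine hdec.induction (P := fun u => fTilde (.im i hi l) (fTilde (.im i hi m) u) =
    fTilde (.im i hi m) (fTilde (.im i hi l) u)) ?_ (fun x y hx hy => ?_) (fun c z hz => ?_) u
  · rw [(hf l).map_zero, (hf m).map_zero, (hf l).map_zero]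
  · rw [(hf l).map_add hdec, (hf m).map_add hdec, (hf l).map_add hdec, (hf m).map_add hdec, hx, hy]
  · have key : ∀ {l m : ℕ+}, l ≠ m → fTilde (.im i hi l) (fTilde (.im i hi m)
        (bMultiset i hi c * z)) =
          (isoCoeff m c * isoCoeff l c) • (bMultiset i hi (l ::ₘ m ::ₘ c) * z) := by
      intro l m hlm
      have hcount : isoCoeff l (m ::ₘ c) = isoCoeff l c := by
        rw [isoCoeff, isoCoeff, Multiset.count_cons_of_ne hlm]
      rw [(hf m).map_mul hz, smul_mul_assoc, ← mul_smul_comm,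
        (hf l).map_mul ((kerIm i hi).smul_mem _ hz), hcount, smul_mul_smul_comm,
        mul_comm (isoCoeff l c)]
    rw [key hlm, key hlm.symm, Multiset.cons_swap, mul_comm (isoCoeff m c)]

end Kashiwara

end

end GenQuantum

theorem mainTheorem5 {V : Type u} [Quiver.{w + 1} V] [∀ i j : V, Finite (i ⟶ j)] :
    (∀ ι ι' : GenQuantum.IInf V, GenQuantum.IInf.pairing ι ι' = 0 →
      ∀ x : GenQuantum.UMinus V,
        GenQuantum.fTilde ι (GenQuantum.fTilde ι' x) =
          GenQuantum.fTilde ι' (GenQuantum.fTilde ι x)) ∧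
    (∀ (j k : V) (hj : GenQuantum.IsRealVertex j) (hk : GenQuantum.IsRealVertex k),
      GenQuantum.vertexForm j k = 0 →
        (∀ x : GenQuantum.UMinus V,
          GenQuantum.ePrime (.re j hj) (GenQuantum.ePrime (.re k hk) x) =
            GenQuantum.ePrime (.re k hk) (GenQuantum.ePrime (.re j hj) x)) ∧
        (∀ x ∈ GenQuantum.kerRe k hk, ∀ z : ℕ →₀ GenQuantum.UMinus V,
          GenQuantum.IsDecompRe j hj x z → ∀ n, z n ∈ GenQuantum.kerRe k hk)) := by
  open GenQuantum in
  refine ⟨fun ι κ h x => ?_, fun j k hj hk h => ?_⟩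
  · by_cases hne : ι.vertex = κ.vertex
    · cases ι with
      | re j hj =>
        obtain rfl := IInf.eq_re_of_vertex_eq (hj := hj) hne.symm
        rfl
      | im i hi l =>
        obtain ⟨m, rfl⟩ := IInf.exists_eq_im_of_vertex_eq (hi := hi) hne.symm
        have hiso : IsIsotropic i := by
          rw [IInf.pairing_eq_zero_iff] at h
          have : vertexForm i i = 0 := h
          rw [vertexForm_self] at this
          rw [IsIsotropic]
          omega
        by_cases hlm : l = m
        · rw [hlm]
        · exact fTilde_comm_of_isotropic i hi hiso hlm x
    · exact fTilde_comm_of_ne h hne x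
  · have hp : (IInf.re j hj).pairing (.re k hk) = 0 := by rw [pairing_re_re, h]
    have hjk : k ≠ j := by
      rintro rfl
      rw [vertexForm_self, show loops k = 0 from hk] at h
      simp at h
    refine ⟨fun x => ePrime_comm hp x, fun x hx z hz n => ?_⟩
    rw [← vertexKer_re] at hx ⊢
    refine component_mem_vertexKer ((IInf.pairing_comm _ _).trans hp) hjk (divPow_mem j hj)
      (vertexKer_re j hj ▸ isDecomposition_re j hj) (fun c => ?_) ?_ n
    · rw [vertexKer_re]
      exact hz.1 c
    · rw [← hz.2]
      exact hx
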